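/- **Setting.** Let $\mathcal T$ be a finite rooted tree with root $s_0$, set of leaves $\mathcal L$, children sets $\mathcal C(s)$, and a label MAX or MIN at every internal node. Let $D$ be its depth (number of edges on a longest root-to-leaf path) and $K=\max_s|\mathcal C(s)|$, with $K\ge 2$. Rewards come from a one-parameter exponential family on $\mathbb R$, parametrized by its mean $x\in X$, where $X\subseteq\mathbb R$ is an interval that contains all rewards: all members have densities with respect to a common base measure, proportional to $r\mapsto e^{\eta r}$ for some $\eta\in\mathbb R$ if the mean is interior to $X$ (at an end point belonging to $X$ the member is a point mass, as for Bernoulli laws with $X=[0,1]$); $d(x,y)$ is the Kullback–Leibler divergence between the members with means $x$ and $y$. Let $\theta\in\operatorname{int}X$ be the threshold and $\delta\in(0,1)$. For $\mu\in X^{\mathcal L}$ put $V_\ell(\mu)=\mu_\ell$ at leaves and let $V_s(\mu)$ be the maximum (MAX) or minimum (MIN) of $V_c(\mu)$ over $c\in\mathcal C(s)$; the answer of $\mu$ is "win" if $V_{s_0}(\mu)\ge\theta$ and "lose" otherwise. Let $\mathrm{Alt}(\mu)$ be the set of $\lambda\in X^{\mathcal L}$ with a different answer, and call $w$ in the simplex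 $\Delta$ over $\mathcal L$ optimal for $\mu$ if it maximizes $\inf_{\lambda\in\mathrm{Alt}(\mu)}\sum_\ell w_\ell\, d(\mu_\ell,\lambda_\ell)$ over $\Delta$. **RD-Tracking-TMCTS.** Let $N_\ell(t)$ and $\hat\mu_\ell(t)$ be the number of draws and the sample mean of leaf $\ell$ after $t$ draws in total. The algorithm first draws every leaf once. In each later round, whose draw is the $t$-th in total, it draws one leaf $I(t)$ and observes its reward, where * $I(t)\in\arg\min_\ell N_\ell(t-1)$ if $N_\ell(t-1)<\sqrt t-|\mathcal L|/2$ for some leaf $\ell$; * otherwise $I(t)\in\arg\max_\ell w_\ell/N_\ell(t-1)$ for some $w$ that is optimal for $\hat\mu(t-1)$. It then stops and returns the answer of $\hat\mu(t)$ if and only if $$\inf_{\lambda\in\mathrm{Alt}(\hat\mu(t))}\sum_{\ell}N_\ell(t)\,d(\hat\mu_\ell(t),\lambda_\ell)\;\ge\;\beta(t,\delta)=3\sum_{\ell}\log(1+\log N_\ell(t))+|\mathcal L|\,C_{\exp}\!\left(\frac{\log(1/\delta)}{|\mathcal L|}\right),$$ where $C_{\exp}(x)=2\tilde h\big(\tfrac12(h^{-1}(1+x)+\ln(\pi^2/3))\big)$,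 $h^{-1}$ is the inverse of $h(x)=x-\ln x$ on $[1,\infty)$, and $\tilde h(x)=e^{1/h^{-1}(x)}h^{-1}(x)$ if $x\ge h(1/\ln(3/2))$, $\tilde h(x)=\tfrac32(x-\ln\ln\tfrac32)$ otherwise. **Machine model.** A program for a real RAM: finitely many arrays of natural numbers and of reals with computed indices; each arithmetic operation (on naturals: addition, truncated subtraction, halving), comparison, memory access, draw, and evaluation of $\sqrt{\cdot}$, $\log$, $\exp$, $h^{-1}$ or $d(\cdot,\theta)$ takes one time unit. The tree, $\theta$ and $\delta$ are its input. The program has an initialization phase, in which every leaf is drawn once, followed by rounds. **Theorem.** There is a single program that, for all trees, exponential families, $\theta$, $\delta$ as above and all reward sequences in $X$, performs RD-Tracking-TMCTS (with some breaking of ties), and 1. there is an absolute constant $C$ such that every round takes at most $C\,D\log K$ time units; 2. for every $c>0$ there is a constant $C_c$ depending only on $c$ such that on all trees with $|\mathcal L|\ge c\,K^D$ (balanced trees) every round takes at most $C_c\log|\mathcal L|$ time units. -/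

import Mathlib

open MeasureTheory InformationTheory
open scoped ENNReal

namespace TMCTS

/-! ### One-parameter exponential families, parametrized by the mean -/

/-- A one-parameter exponential family of reward laws on the real line, in its mean
parametrization: `P x` is the member with mean `x`, for `x` in the interval `X` of possible means,
and rewards take their values in `X`. All members have a density with respect to `base`; every
member whose mean is not an end point of `X` has density proportional to `r ↦ exp (η * r)` for some
natural parameter `η`. If `X` contains an end point `x` (as for Bernoulli laws, where
`X = [0, 1]`), then the conditions force `P x` to be the point mass at `x`. -/
structure ExpFamily where
  X : Set ℝ
  P : ℝ → Measure ℝ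
  base : Measure ℝ
  ordConnected : X.OrdConnected
  isProb : ∀ x ∈ X, IsProbabilityMeasure (P x)
  dominated : ∀ x ∈ X, P x ≪ base
  supported : ∀ x ∈ X, ∀ᵐ r ∂(P x), r ∈ X
  integrable : ∀ x ∈ X, Integrable (fun r => r) (P x)
  mean : ∀ x ∈ X, ∫ r, r ∂(P x) = x
  tilted : ∀ x ∈ interior X, ∃ η : ℝ, P x = base.tilted (fun r => η * r)

/-- `d(x, y)`: the Kullback-Leibler divergence between the members with means `x` and `y`. -/
noncomputable def ExpFamily.d (E : ExpFamily) (x y : ℝ) : ℝ≥0∞ := klDiv (E.P x) (E.P y)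

/-! ### Rooted trees with MAX / MIN labels -/

/-- A finite rooted tree. The nodes are `0, …, n`, numbered such that parents precede their
children, and `0` is the root; `parent 0` has no meaning. The label of an internal node `s` is
MAX if `isMax s` and MIN otherwise; labels of leaves have no meaning. -/
structure GameTree where
  n : ℕ
  parent : Fin (n + 1) → Fin (n + 1)
  parent_lt : ∀ s, s ≠ 0 → parent s < s
  isMax : Fin (n + 1) → Bool

namespace GameTree

variable (T : GameTree)

abbrev Node : Type := Fin (T.n + 1)

def children (s : T.Node) : Finset T.Node :=
  Finset.univ.filter fun c => c ≠ 0 ∧ T.parent c = s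

def leaves : Finset T.Node :=
  Finset.univ.filter fun s => T.children s = ∅

theorem lt_of_mem_children {T : GameTree} {s c : T.Node} (h : c ∈ T.children s) : s < c := by
  have h' := (Finset.mem_filter.mp h).2
  exact h'.2 ▸ T.parent_lt c h'.1

/-- The number of edges between the root and `s`. -/
def depthOf (s : T.Node) : ℕ :=
  if h : s = 0 then 0 else depthOf (T.parent s) + 1
termination_by s.val
decreasing_by exact T.parent_lt s h

/-- The depth `D` of the tree. -/
def depth : ℕ := Finset.univ.sup T.depthOf

/-- The maximum number `K` of children of a node. -/
def maxBranching : ℕ := Finset.univ.sup fun s => (T.children s).card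

/-- The minimax value `V_s(μ)`; only the entries of `μ` at leaves matter. -/
noncomputable def value (μ : T.Node → ℝ) (s : T.Node) : ℝ :=
  if h : (T.children s).Nonempty then
    if T.isMax s then
      (T.children s).attach.sup' (Finset.attach_nonempty_iff.mpr h) fun c => value μ c.1
    else
      (T.children s).attach.inf' (Finset.attach_nonempty_iff.mpr h) fun c => value μ c.1
  else μ s
termination_by T.n - s.val
decreasing_by
  all_goals
    have h1 := lt_of_mem_children c.2
    have h2 := c.1.isLt
    simp only [Fin.lt_def] at h1
    omega

/-- The answer `a_{s₀}(μ)` is "win", for the threshold `θ`. -/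
def Win (θ : ℝ) (μ : T.Node → ℝ) : Prop := θ ≤ T.value μ 0

/-- The simplex over the leaves. -/
def simplex : Set (T.Node → ℝ) :=
  {w | (∀ l ∈ T.leaves, 0 ≤ w l) ∧ ∑ l ∈ T.leaves, w l = 1}

end GameTree

/-! ### Optimal weights, GLR statistic, threshold -/

section Statistics

variable (E : ExpFamily) (T : GameTree) (θ : ℝ)

/-- `Alt(μ)`: the mean vectors whose answer differs from that of `μ`. -/
def Alt (μ : T.Node → ℝ) : Set (T.Node → ℝ) :=
  {lam | (∀ l ∈ T.leaves, lam l ∈ E.X) ∧ ¬(T.Win θ lam ↔ T.Win θ μ)}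

/-- `inf_{λ ∈ Alt(μ)} ∑_ℓ w_ℓ d(μ_ℓ, λ_ℓ)`. -/
noncomputable def altInf (μ w : T.Node → ℝ) : ℝ≥0∞ :=
  ⨅ lam ∈ Alt E T θ μ, ∑ l ∈ T.leaves, ENNReal.ofReal (w l) * E.d (μ l) (lam l)

/-- `w` is an optimal proportion for `μ`, that is, a maximizer of `altInf` over the simplex. -/
def IsOptimalWeight (μ w : T.Node → ℝ) : Prop :=
  IsMaxOn (altInf E T θ μ) T.simplex w ∧ w ∈ T.simplex

/-- `N_ℓ`: the number of draws of leaf `l` in the list `log` of draws (in order of time). -/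
def numPulls (log : List ℕ) (l : T.Node) : ℕ := log.count l.val

/-- The sample mean of leaf `l`, where `r k` is the reward observed at draw number `k + 1`. -/
noncomputable def empMean (r : ℕ → ℝ) (log : List ℕ) (l : T.Node) : ℝ :=
  (∑ k ∈ Finset.range log.length, if log[k]? = some l.val then r k else 0) / numPulls T log l

/-- The GLR statistic of the root. -/
noncomputable def glr (r : ℕ → ℝ) (log : List ℕ) : ℝ≥0∞ :=
  altInf E T θ (empMean T r log) fun l => (numPulls T log l : ℝ)

end Statistics

/-- `h(x) = x - ln x`. -/
noncomputable def hFun (x : ℝ) : ℝ := x - Real.log x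

/-- The inverse of `h : [1, ∞) → [1, ∞)`. -/
noncomputable def hInv (y : ℝ) : ℝ := Function.invFunOn hFun (Set.Ici 1) y

noncomputable def hTilde (x : ℝ) : ℝ :=
  if hFun (1 / Real.log (3 / 2)) ≤ x then Real.exp (1 / hInv x) * hInv x
  else 3 / 2 * (x - Real.log (Real.log (3 / 2)))

noncomputable def Cexp (x : ℝ) : ℝ :=
  2 * hTilde ((hInv (1 + x) + Real.log (Real.pi ^ 2 / 3)) / 2)

/-- The stopping threshold `β(t, δ)`, after the draws in `log`. -/
noncomputable def beta (T : GameTree) (δ : ℝ) (log : List ℕ) : ℝ :=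
  3 * ∑ l ∈ T.leaves, Real.log (1 + Real.log (numPulls T log l)) +
    T.leaves.card * Cexp (Real.log (1 / δ) / T.leaves.card)

/-- The ratio-based sampling rule: after the draws in `log`, leaf `l` may be drawn in the next
round, whose number is `t = log.length + 1`. -/
def MaySample (E : ExpFamily) (T : GameTree) (θ : ℝ) (r : ℕ → ℝ) (log : List ℕ)
    (l : T.Node) : Prop :=
  l ∈ T.leaves ∧
    ((∃ l' ∈ T.leaves,
        (numPulls T log l' : ℝ) < √((log.length : ℝ) + 1) - (T.leaves.card : ℝ) / 2) →
      ∀ l' ∈ T.leaves, numPulls T log l ≤ numPulls T log l') ∧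
    ((¬∃ l' ∈ T.leaves,
        (numPulls T log l' : ℝ) < √((log.length : ℝ) + 1) - (T.leaves.card : ℝ) / 2) →
      ∃ w, IsOptimalWeight E T θ (empMean T r log) w ∧
        ∀ l' ∈ T.leaves, w l' / numPulls T log l' ≤ w l / numPulls T log l)

/-- The stopping rule, after the draws in `log`. -/
def Stops (E : ExpFamily) (T : GameTree) (θ δ : ℝ) (r : ℕ → ℝ) (log : List ℕ) : Prop :=
  ENNReal.ofReal (beta T δ log) ≤ glr E T θ r log

/-! ### The machine model: a real RAM with a structured instruction set

The memory consists of arrays of natural numbers and arrays of reals. Array names are constants of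
the program, indices are computed. Every operation on naturals and reals, every comparison, every
memory access and every evaluation of one of the functions `√`, `log`, `exp`, `hInv` and
`d(·, θ)` takes one time unit. There is no rounding of reals to naturals. -/

structure State where
  nat : ℕ → ℕ → ℕ
  real : ℕ → ℕ → ℝ
  /-- the leaves drawn so far, in order of time -/
  log : List ℕ
  /-- the answer, if one was returned (`true` is "win") -/
  out : Option Bool

/-- What a program interacts with: the function `d(·, θ)` and the rewards. -/
structure Env where
  kl : ℝ → ℝ
  /-- `reward k` is the reward observed at draw number `k + 1` -/
  reward : ℕ → ℝ

inductive NExp : Type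
  | lit (k : ℕ)
  | get (a : ℕ) (i : NExp)
  | add (x y : NExp)
  | sub (x y : NExp)
  | half (x : NExp)

inductive RExp : Type
  | lit (c : ℝ)
  | get (a : ℕ) (i : NExp)
  | ofNat (x : NExp)
  | add (x y : RExp)
  | sub (x y : RExp)
  | mul (x y : RExp)
  | div (x y : RExp)
  | sqrt (x : RExp)
  | log (x : RExp)
  | exp (x : RExp)
  | hInv (x : RExp)
  | kl (x : RExp)

inductive BExp : Type
  | natEq (x y : NExp)
  | natLt (x y : NExp)
  | realEq (x y : RExp)
  | realLt (x y : RExp)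
  | not (b : BExp)
  | and (b c : BExp)

inductive Cmd : Type
  | skip
  | setNat (a : ℕ) (i e : NExp)
  | setReal (a : ℕ) (i : NExp) (e : RExp)
  /-- draw leaf `i` and store the observed reward in cell `0` of the real array `a` -/
  | draw (i : NExp) (a : ℕ)
  /-- return the answer `b` -/
  | ret (b : BExp)
  | seq (c d : Cmd)
  | ite (b : BExp) (c d : Cmd)
  | while (b : BExp) (c : Cmd)

def NExp.eval (σ : State) : NExp → ℕ
  | .lit k => k
  | .get a i => σ.nat a (i.eval σ)
  | .add x y => x.eval σ + y.eval σ
  | .sub x y => x.eval σ - y.eval σ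
  | .half x => x.eval σ / 2

noncomputable def RExp.eval (env : Env) (σ : State) : RExp → ℝ
  | .lit c => c
  | .get a i => σ.real a (i.eval σ)
  | .ofNat x => (x.eval σ : ℝ)
  | .add x y => x.eval env σ + y.eval env σ
  | .sub x y => x.eval env σ - y.eval env σ
  | .mul x y => x.eval env σ * y.eval env σ
  | .div x y => x.eval env σ / y.eval env σ
  | .sqrt x => √(x.eval env σ)
  | .log x => Real.log (x.eval env σ)
  | .exp x => Real.exp (x.eval env σ)
  | .hInv x => TMCTS.hInv (x.eval env σ)
  | .kl x => env.kl (x.eval env σ)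

noncomputable def BExp.eval (env : Env) (σ : State) : BExp → Bool
  | .natEq x y => decide (x.eval σ = y.eval σ)
  | .natLt x y => decide (x.eval σ < y.eval σ)
  | .realEq x y => decide (x.eval env σ = y.eval env σ)
  | .realLt x y => decide (x.eval env σ < y.eval env σ)
  | .not b => !(b.eval env σ)
  | .and b c => b.eval env σ && c.eval env σ

/-- The time needed to evaluate an expression: the number of its operations. -/
def NExp.cost : NExp → ℕ
  | .lit _ => 1
  | .get _ i => 1 + i.cost
  | .add x y => 1 + x.cost + y.cost
  | .sub x y => 1 + x.cost + y.cost
  | .half x => 1 + x.cost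

def RExp.cost : RExp → ℕ
  | .lit _ => 1
  | .get _ i => 1 + i.cost
  | .ofNat x => 1 + x.cost
  | .add x y => 1 + x.cost + y.cost
  | .sub x y => 1 + x.cost + y.cost
  | .mul x y => 1 + x.cost + y.cost
  | .div x y => 1 + x.cost + y.cost
  | .sqrt x => 1 + x.cost
  | .log x => 1 + x.cost
  | .exp x => 1 + x.cost
  | .hInv x => 1 + x.cost
  | .kl x => 1 + x.cost

def BExp.cost : BExp → ℕ
  | .natEq x y => 1 + x.cost + y.cost
  | .natLt x y => 1 + x.cost + y.cost
  | .realEq x y => 1 + x.cost + y.cost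
  | .realLt x y => 1 + x.cost + y.cost
  | .not b => 1 + b.cost
  | .and b c => 1 + b.cost + c.cost

def State.setNat (σ : State) (a i v : ℕ) : State :=
  { σ with nat := Function.update σ.nat a (Function.update (σ.nat a) i v) }

noncomputable def State.setReal (σ : State) (a i : ℕ) (v : ℝ) : State :=
  { σ with real := Function.update σ.real a (Function.update (σ.real a) i v) }

/-- `Exec env c σ σ' n`: started in state `σ`, the command `c` terminates in state `σ'` after
exactly `n` time units. -/
inductive Exec (env : Env) : Cmd → State → State → ℕ → Prop
  | skip (σ : State) : Exec env .skip σ σ 1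
  | setNat (a : ℕ) (i e : NExp) (σ : State) :
      Exec env (.setNat a i e) σ (σ.setNat a (i.eval σ) (e.eval σ)) (1 + i.cost + e.cost)
  | setReal (a : ℕ) (i : NExp) (e : RExp) (σ : State) :
      Exec env (.setReal a i e) σ (σ.setReal a (i.eval σ) (e.eval env σ)) (1 + i.cost + e.cost)
  | draw (i : NExp) (a : ℕ) (σ : State) :
      Exec env (.draw i a) σ
        { σ.setReal a 0 (env.reward σ.log.length) with log := σ.log ++ [i.eval σ] } (1 + i.cost)
  | ret (b : BExp) (σ : State) :
      Exec env (.ret b) σ { σ with out := some (b.eval env σ) } (1 + b.cost)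
  | seq {c d : Cmd} {σ σ' σ'' : State} {m n : ℕ} :
      Exec env c σ σ' m → Exec env d σ' σ'' n → Exec env (.seq c d) σ σ'' (m + n)
  | iteTrue {b : BExp} {c d : Cmd} {σ σ' : State} {n : ℕ} :
      b.eval env σ = true → Exec env c σ σ' n → Exec env (.ite b c d) σ σ' (1 + b.cost + n)
  | iteFalse {b : BExp} {c d : Cmd} {σ σ' : State} {n : ℕ} :
      b.eval env σ = false → Exec env d σ σ' n → Exec env (.ite b c d) σ σ' (1 + b.cost + n)
  | whileTrue {b : BExp} {c : Cmd} {σ σ' σ'' : State} {m n : ℕ} :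
      b.eval env σ = true → Exec env c σ σ' m → Exec env (.while b c) σ' σ'' n →
        Exec env (.while b c) σ σ'' (1 + b.cost + m + n)
  | whileFalse {b : BExp} {c : Cmd} {σ : State} :
      b.eval env σ = false → Exec env (.while b c) σ σ (1 + b.cost)

/-- A sequential sampling program: `init` is executed once, then `round` is executed again and
again until an answer has been returned. -/
structure Prog where
  init : Cmd
  round : Cmd

/-- The initial memory holds the input and is `0` elsewhere: the number of nodes in cell `0` of the
array `0`, the parents in array `1`, the labels in array `2` (`1` for MAX, `0` for MIN), and
`θ`, `δ` in cells `0`, `1` of the real array `0`. -/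
noncomputable def input (T : GameTree) (θ δ : ℝ) : State where
  nat a i :=
    if a = 0 ∧ i = 0 then T.n + 1
    else if h : i < T.n + 1 then
      if a = 1 then (T.parent ⟨i, h⟩).val
      else if a = 2 then (if T.isMax ⟨i, h⟩ then 1 else 0)
      else 0
    else 0
  real a i := if a = 0 ∧ i = 0 then θ else if a = 0 ∧ i = 1 then δ else 0
  log := []
  out := none

/-- The step from `σ` to `σ'` is a correct round of RD-Tracking-TMCTS: exactly one leaf is drawn,
following the sampling rule, and afterwards the answer is returned iff the stopping rule says so. -/
def CorrectRound (E : ExpFamily) (T : GameTree) (θ δ : ℝ) (r : ℕ → ℝ) (σ σ' : State) : Prop :=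
  (∃ l : T.Node, MaySample E T θ r σ.log l ∧ σ'.log = σ.log ++ [l.val]) ∧
    (¬Stops E T θ δ r σ'.log → σ'.out = none) ∧
    (Stops E T θ δ r σ'.log → T.Win θ (empMean T r σ'.log) → σ'.out = some true) ∧
    (Stops E T θ δ r σ'.log → ¬T.Win θ (empMean T r σ'.log) → σ'.out = some false)

/-- On the given instance and with the rewards `r`, the program `p` performs RD-Tracking-TMCTS
(it draws each leaf once, and then executes correct rounds until one of them returns an answer),
and each round takes at most `B` time units. -/
def RunsWithin (p : Prog) (E : ExpFamily) (T : GameTree) (θ δ : ℝ) (r : ℕ → ℝ) (B : ℝ) : Prop :=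
  let env : Env := ⟨fun x => (E.d x θ).toReal, r⟩
  ∃ run : ℕ → State,
    (∃ n, Exec env p.init (input T θ δ) (run 0) n) ∧
    ((run 0).log.Nodup ∧ ∀ i, i ∈ (run 0).log ↔ ∃ l ∈ T.leaves, l.val = i) ∧
    (run 0).out = none ∧
    ∀ k, (run k).out = none →
      ∃ n : ℕ, Exec env p.round (run k) (run (k + 1)) n ∧
        CorrectRound E T θ δ r (run k) (run (k + 1)) ∧ (n : ℝ) ≤ B

end TMCTS

namespace TMCTS

/-! ### Divergences in an exponential family -/

theorem klDiv_tilted_right {P ν : Measure ℝ} [IsProbabilityMeasure P] [IsProbabilityMeasure ν]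
    (hi : Integrable (fun r => r) P) (hl : klDiv P ν ≠ ⊤) {ζ : ℝ}
    (hζ : Integrable (fun r => Real.exp (ζ * r)) ν) :
    klDiv P (ν.tilted fun r => ζ * r) ≠ ⊤ ∧
      (klDiv P (ν.tilted fun r => ζ * r)).toReal =
        (klDiv P ν).toReal - ζ * ∫ r, r ∂P + Real.log (∫ r, Real.exp (ζ * r) ∂ν) := by
  obtain ⟨h1, h2⟩ := klDiv_ne_top_iff.mp hl
  have hac := h1.trans (absolutelyContinuous_tilted hζ)
  have := isProbabilityMeasure_tilted hζ
  have hf : Integrable (fun r => ζ * r) P := hi.const_mul ζ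
  refine ⟨klDiv_ne_top hac (integrable_llr_tilted_right h1 hf h2 hζ), ?_⟩
  rw [toReal_klDiv_of_measure_eq hac (by simp), toReal_klDiv_of_measure_eq h1 (by simp),
    integral_llr_tilted_right h1 hf hζ h2, integral_const_mul]

theorem klDiv_tilted_left_ne_top {ν : Measure ℝ} [IsProbabilityMeasure ν] {ζ : ℝ}
    (hζ : Integrable (fun r => Real.exp (ζ * r)) ν)
    (hi : Integrable (fun r => r) (ν.tilted fun r => ζ * r)) :
    klDiv (ν.tilted fun r => ζ * r) ν ≠ ⊤ := by
  have := isProbabilityMeasure_tilted hζ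
  have h1 : Integrable (fun r => Real.exp (-ζ * r)) (ν.tilted fun r => ζ * r) := by
    rw [integrable_tilted_iff hζ]
    simp [← Real.exp_add]
  have h2 := (klDiv_tilted_right (P := ν.tilted fun r => ζ * r) hi (by simp [klDiv_self]) h1).1
  convert h2 using 1
  rw [show (fun r => -ζ * r) = -fun r => ζ * r by ext r; simp]
  exact congrArg _ (tilted_neg_same hζ).symm

/-- `∫ r dQ`, the log-partition function and Gibbs' inequality for a tilted measure. -/
theorem toReal_klDiv_tilted_left {ν : Measure ℝ} [IsProbabilityMeasure ν] {ζ : ℝ}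
    (hζ : Integrable (fun r => Real.exp (ζ * r)) ν)
    (hi : Integrable (fun r => r) (ν.tilted fun r => ζ * r)) :
    (klDiv (ν.tilted fun r => ζ * r) ν).toReal =
      ζ * (∫ r, r ∂(ν.tilted fun r => ζ * r)) - Real.log (∫ r, Real.exp (ζ * r) ∂ν) := by
  have : IsProbabilityMeasure (ν.tilted fun r => ζ * r) := isProbabilityMeasure_tilted hζ
  have h := (klDiv_tilted_right hi (klDiv_tilted_left_ne_top hζ hi) hζ).2
  rw [klDiv_self, ENNReal.toReal_zero] at h
  linarith

/-- The symmetrized divergence of two tilted measures. -/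
theorem symm_klDiv_tilted {ν : Measure ℝ} [IsProbabilityMeasure ν] {ζ ξ : ℝ}
    (hζ : Integrable (fun r => Real.exp (ζ * r)) ν)
    (hi : Integrable (fun r => r) (ν.tilted fun r => ζ * r))
    (hξ : Integrable (fun r => Real.exp (ξ * r)) ν)
    (hj : Integrable (fun r => r) (ν.tilted fun r => ξ * r)) :
    (klDiv (ν.tilted fun r => ζ * r) (ν.tilted fun r => ξ * r)).toReal +
      (klDiv (ν.tilted fun r => ξ * r) (ν.tilted fun r => ζ * r)).toReal =
      (ζ - ξ) * ((∫ r, r ∂(ν.tilted fun r => ζ * r)) - ∫ r, r ∂(ν.tilted fun r => ξ * r)) := by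
  have := isProbabilityMeasure_tilted hζ
  have := isProbabilityMeasure_tilted hξ
  rw [(klDiv_tilted_right hi (klDiv_tilted_left_ne_top hζ hi) hξ).2,
    (klDiv_tilted_right hj (klDiv_tilted_left_ne_top hξ hj) hζ).2,
    toReal_klDiv_tilted_left hζ hi, toReal_klDiv_tilted_left hξ hj]
  ring

namespace ExpFamily

variable (E : ExpFamily) {x y θ : ℝ}

theorem d_self (hx : x ∈ E.X) : E.d x x = 0 := by
  have := E.isProb x hx
  exact klDiv_self _

theorem eq_of_d_eq_zero (hx : x ∈ E.X) (hy : y ∈ E.X) (h : E.d x y = 0) : x = y := by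
  have := E.isProb x hx
  have := E.isProb y hy
  have h' : E.P x = E.P y := klDiv_eq_zero_iff.mp h
  rw [← E.mean x hx, ← E.mean y hy, h']

theorem integrable_exp (hθ : θ ∈ interior E.X) {η : ℝ}
    (h : E.P θ = E.base.tilted fun r => η * r) :
    Integrable (fun r => Real.exp (η * r)) E.base := by
  by_contra hn
  have := E.isProb θ (interior_subset hθ)
  rw [tilted_of_not_integrable hn] at h
  exact IsProbabilityMeasure.ne_zero _ h

theorem ac (hθ : θ ∈ interior E.X) (hx : x ∈ E.X) : E.P x ≪ E.P θ := by
  obtain ⟨η, h⟩ := E.tilted θ hθ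
  refine (E.dominated x hx).trans ?_
  have := absolutelyContinuous_tilted (E.integrable_exp hθ h)
  rwa [h]

theorem exists_tilt (hθ : θ ∈ interior E.X) (hy : y ∈ interior E.X) :
    ∃ ζ : ℝ, E.P y = (E.P θ).tilted (fun r => ζ * r) ∧
      Integrable (fun r => Real.exp (ζ * r)) (E.P θ) := by
  obtain ⟨η, h⟩ := E.tilted θ hθ
  obtain ⟨ξ, h'⟩ := E.tilted y hy
  have h1 := E.integrable_exp hθ h
  have h2 := E.integrable_exp hy h'
  refine ⟨ξ - η, ?_, ?_⟩
  · rw [h', h, tilted_tilted h1]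
    congr 1
    ext r
    simp only [Pi.add_apply]
    ring
  · rw [h, integrable_tilted_iff h1]
    convert h2 using 2 with r
    simp only [smul_eq_mul]
    rw [← Real.exp_add]
    congr 1
    ring

theorem mem_interior_of_lt_of_lt {a b : ℝ} (ha : a ∈ E.X) (hb : b ∈ E.X) (h1 : a < x)
    (h2 : x < b) : x ∈ interior E.X :=
  interior_mono ((Set.Ioo_subset_Icc_self).trans (E.ordConnected.out ha hb))
    (by rw [interior_Ioo]; exact ⟨h1, h2⟩)

theorem ae_eq_of_notMem_interior (hx : x ∈ E.X) (hx' : x ∉ interior E.X) :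
    ∀ᵐ r ∂(E.P x), r = x := by
  have := E.isProb x hx
  have hc : (∀ a ∈ E.X, x ≤ a) ∨ ∀ b ∈ E.X, b ≤ x := by
    by_contra! hc
    obtain ⟨⟨a, ha, ha'⟩, b, hb, hb'⟩ := hc
    exact hx' (E.mem_interior_of_lt_of_lt ha hb ha' hb')
  have hint : Integrable (fun r => r - x) (E.P x) := (E.integrable x hx).sub (integrable_const _)
  have h0 : ∫ r, (r - x) ∂(E.P x) = 0 := by
    rw [integral_sub (E.integrable x hx) (integrable_const _), E.mean x hx]
    simp
  rcases hc with hc | hc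
  · have h1 : 0 ≤ᵐ[E.P x] fun r => r - x := by
      filter_upwards [E.supported x hx] with r hr
      simpa using hc r hr
    filter_upwards [(integral_eq_zero_iff_of_nonneg_ae h1 hint).mp h0] with r hr
    simpa [sub_eq_zero] using hr
  · have h1 : 0 ≤ᵐ[E.P x] fun r => -(r - x) := by
      filter_upwards [E.supported x hx] with r hr
      simpa using hc r hr
    have h2 : ∫ r, -(r - x) ∂(E.P x) = 0 := by rw [integral_neg, h0, neg_zero]
    filter_upwards [(integral_eq_zero_iff_of_nonneg_ae h1 hint.neg).mp h2] with r hr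
    simp only [Pi.zero_apply] at hr
    linarith

theorem d_ne_top (hθ : θ ∈ interior E.X) (hx : x ∈ E.X) : E.d x θ ≠ ⊤ := by
  have := E.isProb x hx
  have := E.isProb θ (interior_subset hθ)
  by_cases hx' : x ∈ interior E.X
  · obtain ⟨ζ, h, hζ⟩ := E.exists_tilt hθ hx'
    have := klDiv_tilted_left_ne_top hζ (h ▸ E.integrable x hx)
    rwa [← h] at this
  · refine klDiv_ne_top (E.ac hθ hx) ?_
    refine (integrable_const (llr (E.P x) (E.P θ) x)).congr ?_
    filter_upwards [E.ae_eq_of_notMem_interior hx hx'] with r hr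
    rw [hr]

theorem d_tilted (hθ : θ ∈ interior E.X) (hx : x ∈ E.X) {ζ : ℝ}
    (hζ : Integrable (fun r => Real.exp (ζ * r)) (E.P θ)) :
    klDiv (E.P x) ((E.P θ).tilted fun r => ζ * r) ≠ ⊤ ∧
      (klDiv (E.P x) ((E.P θ).tilted fun r => ζ * r)).toReal =
        (E.d x θ).toReal - ζ * x + Real.log (∫ r, Real.exp (ζ * r) ∂(E.P θ)) := by
  have := E.isProb x hx
  have := E.isProb θ (interior_subset hθ)
  have h := klDiv_tilted_right (E.integrable x hx) (E.d_ne_top hθ hx) hζ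
  rwa [E.mean x hx] at h

theorem tilt_mul_le (hθ : θ ∈ interior E.X) {ζ : ℝ}
    (hζ : Integrable (fun r => Real.exp (ζ * r)) (E.P θ)) :
    ζ * θ ≤ Real.log (∫ r, Real.exp (ζ * r) ∂(E.P θ)) := by
  have h := (E.d_tilted hθ (interior_subset hθ) hζ).2
  rw [E.d_self (interior_subset hθ)] at h
  have := ENNReal.toReal_nonneg (a := klDiv (E.P θ) ((E.P θ).tilted fun r => ζ * r))
  simp only [ENNReal.toReal_zero] at h
  linarith

theorem le_tilt_mul (hθ : θ ∈ interior E.X) {ζ : ℝ}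
    (hζ : Integrable (fun r => Real.exp (ζ * r)) (E.P θ))
    (hi : Integrable (fun r => r) ((E.P θ).tilted fun r => ζ * r)) :
    Real.log (∫ r, Real.exp (ζ * r) ∂(E.P θ)) ≤
      ζ * ∫ r, r ∂((E.P θ).tilted fun r => ζ * r) := by
  have := E.isProb θ (interior_subset hθ)
  have h := toReal_klDiv_tilted_left hζ hi
  have := ENNReal.toReal_nonneg (a := klDiv ((E.P θ).tilted fun r => ζ * r) (E.P θ))
  linarith

/-- The divergence grows when the second argument moves beyond `θ`. -/
theorem d_le_d (hθ : θ ∈ interior E.X) (hx : x ∈ E.X) (hy : y ∈ E.X)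
    (h : 0 ≤ (x - θ) * (θ - y)) : E.d x θ ≤ E.d x y := by
  have := E.isProb x hx
  rcases eq_or_ne y θ with rfl | hne
  · exact le_rfl
  by_cases hy' : y ∈ interior E.X
  · obtain ⟨ζ, hζ, hint⟩ := E.exists_tilt hθ hy'
    have h1 := E.d_tilted hθ hx hint
    have h2 := E.tilt_mul_le hθ hint
    have h3 := E.le_tilt_mul hθ hint (hζ ▸ E.integrable y hy)
    rw [← hζ, E.mean y hy] at h3
    rw [← hζ] at h1
    refine (ENNReal.toReal_le_toReal (E.d_ne_top hθ hx) h1.1).mp ?_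
    rw [h1.2]
    have h4 : 0 ≤ ζ * (y - θ) := by linarith
    have h5 : 0 ≤ ζ * (θ - x) := by
      rcases lt_or_gt_of_ne hne with hlt | hlt
      · have : ζ ≤ 0 := by nlinarith
        have : 0 ≤ x - θ := by nlinarith
        nlinarith
      · have : 0 ≤ ζ := by nlinarith
        have : x - θ ≤ 0 := by nlinarith
        nlinarith
    linarith
  · have htop : E.d x y = ⊤ := by
      refine klDiv_of_not_ac fun hac => ?_
      have h1 : ∀ᵐ r ∂(E.P x), r = y := hac.ae_le (E.ae_eq_of_notMem_interior hy hy')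
      have h2 : x = y := by
        rw [← E.mean x hx, integral_congr_ae h1]
        simp
      subst h2
      have : (x - θ) * (θ - x) = -(x - θ) ^ 2 := by ring
      have h3 : 0 < (x - θ) ^ 2 := by
        have : x - θ ≠ 0 := sub_ne_zero.mpr hne
        positivity
      linarith
    rw [htop]
    exact le_top

theorem exists_lt_d_le (hθ : θ ∈ interior E.X) (hx : x ∈ E.X) (hxθ : θ ≤ x) {ε : ℝ}
    (hε : 0 < ε) : ∃ y ∈ E.X, y < θ ∧ E.d x y ≤ ENNReal.ofReal ((E.d x θ).toReal + ε) := by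
  have hθX := interior_subset hθ
  have := E.isProb x hx
  have := E.isProb θ hθX
  obtain ⟨a, ha, ha'⟩ : ∃ a ∈ interior E.X, a < θ := by
    have h1 : interior E.X ∈ nhds θ := isOpen_interior.mem_nhds hθ
    obtain ⟨l, u, hl, hu⟩ := mem_nhds_iff_exists_Ioo_subset.mp h1
    obtain ⟨a, h2, h3⟩ := exists_between hl.1
    exact ⟨a, hu ⟨h2, h3.trans hl.2⟩, h3⟩
  have haX := interior_subset ha
  obtain ⟨ζ, hζ, hint⟩ := E.exists_tilt hθ ha
  have hai : Integrable (fun r => r) ((E.P θ).tilted fun r => ζ * r) := hζ ▸ E.integrable a haX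
  have hζ0 : ζ < 0 := by
    have h2 := E.tilt_mul_le hθ hint
    have h3 := E.le_tilt_mul hθ hint hai
    rw [← hζ, E.mean a haX] at h3
    have h4 : ζ * (θ - a) ≤ 0 := by linarith
    have h5 : ζ ≤ 0 := by nlinarith
    refine lt_of_le_of_ne h5 fun h0 => ?_
    rw [h0] at hζ
    simp only [zero_mul, tilted_const] at hζ
    have := E.mean a haX
    rw [hζ, E.mean θ hθX] at this
    linarith
  obtain ⟨s, hs0, hs1, hsε⟩ : ∃ s : ℝ, 0 < s ∧ s < 1 ∧ s * (-ζ * (x - a)) ≤ ε := by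
    have hp : 0 < -ζ * (x - a) := mul_pos (by linarith) (by linarith)
    refine ⟨min (1 / 2) (ε / (-ζ * (x - a))), by positivity, ?_, ?_⟩
    · exact (min_le_left _ _).trans_lt (by norm_num)
    · calc _ ≤ ε / (-ζ * (x - a)) * (-ζ * (x - a)) := by gcongr; exact min_le_right _ _
        _ = ε := div_mul_cancel₀ _ hp.ne'
  set ξ := s * ζ with hξ
  have hexp : ∀ r : ℝ, Real.exp (ξ * r) ≤ 1 + Real.exp (ζ * r) := fun r => by
    rcases le_or_gt 0 (ζ * r) with h | h
    · have : Real.exp (ξ * r) ≤ Real.exp (ζ * r) := by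
        apply Real.exp_le_exp.mpr
        rw [hξ]
        nlinarith
      linarith
    · have : Real.exp (ξ * r) ≤ 1 := by
        apply Real.exp_le_one_iff.mpr
        rw [hξ]
        nlinarith
      linarith [Real.exp_pos (ζ * r)]
  have hξint : Integrable (fun r => Real.exp (ξ * r)) (E.P θ) := by
    refine ((integrable_const 1).add hint).mono' (by fun_prop) (Filter.Eventually.of_forall fun r => ?_)
    rw [Real.norm_of_nonneg (Real.exp_pos _).le]
    exact hexp r
  have hξi : Integrable (fun r => r) ((E.P θ).tilted fun r => ξ * r) := by
    rw [integrable_tilted_iff hint] at hai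
    rw [integrable_tilted_iff hξint]
    have h1 := (E.integrable θ hθX).norm.add hai.norm
    refine h1.mono' (by fun_prop) (Filter.Eventually.of_forall fun r => ?_)
    simp only [smul_eq_mul, norm_mul, Pi.add_apply]
    rw [Real.norm_of_nonneg (Real.exp_pos _).le, Real.norm_of_nonneg (Real.exp_pos _).le]
    nlinarith [hexp r, norm_nonneg r]
  have := isProbabilityMeasure_tilted hξint
  set Q := (E.P θ).tilted fun r => ξ * r with hQ
  set y := ∫ r, r ∂Q with hy
  have hξ0 : ξ < 0 := by rw [hξ]; nlinarith
  have hAle := E.tilt_mul_le hθ hξint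
  have hAge := E.le_tilt_mul hθ hξint hξi
  have hyθ : y < θ := by
    have h1 : y ≤ θ := by
      have : ξ * (θ - y) ≤ 0 := by linarith
      nlinarith
    refine lt_of_le_of_ne h1 fun h2 => ?_
    have h3 : Real.log (∫ r, Real.exp (ξ * r) ∂(E.P θ)) = ξ * θ := by
      refine le_antisymm ?_ hAle
      exact hAge.trans_eq (congrArg (ξ * ·) h2)
    have h4 := (E.d_tilted hθ hθX hξint).2
    rw [E.d_self hθX, h3] at h4
    have h5 : klDiv (E.P θ) Q = 0 :=
      ((ENNReal.toReal_eq_zero_iff _).mp (by simpa using h4)).resolve_right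
        (E.d_tilted hθ hθX hξint).1
    have h6 : E.P θ = Q := klDiv_eq_zero_iff.mp h5
    have h7 := (E.d_tilted hθ haX hξint).2
    rw [← hQ, ← h6, h3] at h7
    have h8 : (klDiv (E.P a) (E.P θ)).toReal = (E.d a θ).toReal := rfl
    rw [h8] at h7
    have h9 : ξ * (θ - a) = 0 := by linarith
    rcases mul_eq_zero.mp h9 with h | h <;> linarith
  have hay : a ≤ y := by
    have := isProbabilityMeasure_tilted hint
    have h1 := symm_klDiv_tilted hint hai hξint hξi
    rw [← hζ, E.mean a haX] at h1
    have h2 : 0 ≤ (ζ - ξ) * (a - y) := by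
      rw [← h1]
      positivity
    have h3 : ζ - ξ < 0 := by rw [hξ]; nlinarith
    nlinarith
  have hyX : y ∈ interior E.X := by
    rcases eq_or_lt_of_le hay with h | h
    · exact h ▸ ha
    · exact E.mem_interior_of_lt_of_lt haX hθX h hyθ
  have hPy : E.P y = Q := by
    obtain ⟨χ, hχ, hχint⟩ := E.exists_tilt hθ hyX
    have h1 := symm_klDiv_tilted hχint (hχ ▸ E.integrable y (interior_subset hyX)) hξint hξi
    rw [← hχ, E.mean y (interior_subset hyX), ← hQ, ← hy, sub_self, mul_zero] at h1
    have h2 : (klDiv (E.P y) Q).toReal = 0 :=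
      le_antisymm (by linarith [ENNReal.toReal_nonneg (a := klDiv Q (E.P y))]) ENNReal.toReal_nonneg
    have := E.isProb y (interior_subset hyX)
    exact klDiv_eq_zero_iff.mp (((ENNReal.toReal_eq_zero_iff _).mp h2).resolve_right
      (E.d_tilted hθ (interior_subset hyX) hξint).1)
  refine ⟨y, interior_subset hyX, hyθ, ?_⟩
  have h1 := E.d_tilted hθ hx hξint
  rw [← hQ, ← hPy] at h1
  change klDiv (E.P x) (E.P y) ≤ _
  rw [← ENNReal.ofReal_toReal h1.1, h1.2]
  apply ENNReal.ofReal_le_ofReal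
  have h2 : ξ * (y - x) ≤ s * (-ζ * (x - a)) := by
    rw [hξ]
    have : s * ζ * (y - x) = s * (-ζ * (x - y)) := by ring
    rw [this]
    have : 0 ≤ -ζ := by linarith
    gcongr
  linarith

end ExpFamily

/-! ### Binary trees and the statistics kept at their nodes -/

/-- A binary tree with labelled leaves; the inner nodes are MAX (`true`) or MIN (`false`) nodes. -/
inductive BT (α : Type*) : Type _
  | leaf (l : α)
  | node (k : Bool) (a b : BT α)

/-- The statistics for one of the two answers: the optimal value `f` of the game, the GLR `g`, and a
leaf `sel` that minimizes the leaf GLR among the leaves of positive optimal weight, with its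
GLR `m`. -/
@[ext] structure Agg where
  f : ℝ
  g : ℝ
  m : ℝ
  sel : ℕ

/-- The statistics of a node from those of its children; `add` tells whether both children have to
be changed in order to change the node. -/
noncomputable def Agg.join (add : Bool) (x y : Agg) : Agg :=
  if add then
    if x.f < y.f then ⟨y.f, x.g + y.g, y.m, y.sel⟩ else ⟨x.f, x.g + y.g, x.m, x.sel⟩
  else
    ⟨x.f * y.f / (x.f + y.f), if y.g < x.g then y.g else x.g, if y.m < x.m then y.m else x.m,
      if y.m < x.m then y.sel else x.sel⟩

section Join

variable (add : Bool) (x y : Agg)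

theorem Agg.join_f : (Agg.join add x y).f =
    if add then (if x.f < y.f then y.f else x.f) else x.f * y.f / (x.f + y.f) := by
  unfold Agg.join
  split_ifs <;> rfl

theorem Agg.join_g : (Agg.join add x y).g =
    if add then x.g + y.g else if y.g < x.g then y.g else x.g := by
  unfold Agg.join
  split_ifs <;> rfl

theorem Agg.join_m : (Agg.join add x y).m =
    if add then (if x.f < y.f then y.m else x.m) else if y.m < x.m then y.m else x.m := by
  unfold Agg.join
  split_ifs <;> rfl

theorem Agg.join_sel : (Agg.join add x y).sel =
    if add then (if x.f < y.f then y.sel else x.sel)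
    else if y.m < x.m then y.sel else x.sel := by
  unfold Agg.join
  split_ifs <;> rfl

end Join

/-- All statistics of a node. `agg true` belongs to the answer "win", `agg false` to "lose". -/
@[ext] structure Rec where
  agg : Bool → Agg
  cnt : ℝ
  lsum : ℝ
  nmin : ℝ
  nsel : ℕ

noncomputable def Rec.join (k : Bool) (x y : Rec) : Rec where
  agg dir := (x.agg dir).join (k == dir) (y.agg dir)
  cnt := x.cnt + y.cnt
  lsum := x.lsum + y.lsum
  nmin := if y.nmin < x.nmin then y.nmin else x.nmin
  nsel := if y.nmin < x.nmin then y.nsel else x.nsel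

namespace BT

variable {α : Type*}

def leaves : BT α → Multiset α
  | leaf l => {l}
  | node _ a b => a.leaves + b.leaves

def height : BT α → ℕ
  | leaf _ => 0
  | node _ a b => max a.height b.height + 1

/-- Whether the answer opposite to `dir` is reached, if `p` tells at which leaves it is. -/
def Holds (dir : Bool) (p : α → Prop) : BT α → Prop
  | leaf l => p l
  | node k a b => if k = dir then a.Holds dir p ∧ b.Holds dir p else a.Holds dir p ∨ b.Holds dir p

/-- The minimal cost of reaching the answer opposite to `dir`, if `c` is the cost at the leaves. -/
noncomputable def cost (dir : Bool) (c : α → ℝ) : BT α → ℝ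
  | leaf l => c l
  | node k a b =>
    if k = dir then a.cost dir c + b.cost dir c else min (a.cost dir c) (b.cost dir c)

noncomputable def fold (ρ : α → Rec) : BT α → Rec
  | leaf l => ρ l
  | node k a b => (a.fold ρ).join k (b.fold ρ)

theorem holds_mono {dir : Bool} {p q : α → Prop} (h : ∀ l, p l → q l) (t : BT α) :
    t.Holds dir p → t.Holds dir q := by
  induction t with
  | leaf l => exact h l
  | node k a b iha ihb =>
    simp only [Holds]
    split_ifs
    · exact And.imp iha ihb
    · exact Or.imp iha ihb

theorem holds_congr {dir : Bool} {p q : α → Prop} {t : BT α} (h : ∀ l ∈ t.leaves, p l ↔ q l) :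
    t.Holds dir p ↔ t.Holds dir q := by
  induction t with
  | leaf l => exact h l (by simp [leaves])
  | node k a b iha ihb =>
    simp only [Holds]
    rw [iha fun l hl => h l (by simp [leaves, hl]), ihb fun l hl => h l (by simp [leaves, hl])]

theorem holds_not {dir : Bool} {p : α → Prop} (t : BT α) :
    t.Holds (!dir) (fun l => ¬p l) ↔ ¬t.Holds dir p := by
  induction t with
  | leaf l => exact Iff.rfl
  | node k a b iha ihb =>
    simp only [Holds, iha, ihb]
    cases k <;> cases dir <;> simp [imp_iff_not_or]

theorem sum_leaves_nonneg {c : α → ℝ} (hc : ∀ l, 0 ≤ c l) (t : BT α) :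
    0 ≤ (t.leaves.map c).sum := by
  apply Multiset.sum_nonneg
  simp only [Multiset.mem_map]
  rintro _ ⟨l, -, rfl⟩
  exact hc l

theorem cost_nonneg {dir : Bool} {c : α → ℝ} (hc : ∀ l, 0 ≤ c l) (t : BT α) :
    0 ≤ t.cost dir c := by
  induction t with
  | leaf l => exact hc l
  | node k a b iha ihb =>
    simp only [cost]
    split_ifs
    · positivity
    · exact le_min iha ihb

theorem cost_mul {dir : Bool} {c : α → ℝ} {x : ℝ} (hx : 0 ≤ x) (t : BT α) :
    t.cost dir (fun l => x * c l) = x * t.cost dir c := by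
  induction t with
  | leaf l => rfl
  | node k a b iha ihb =>
    simp only [cost, iha, ihb]
    split_ifs
    · ring
    · exact (mul_min_of_nonneg _ _ hx).symm

theorem cost_congr {dir : Bool} {c c' : α → ℝ} {t : BT α} (h : ∀ l ∈ t.leaves, c l = c' l) :
    t.cost dir c = t.cost dir c' := by
  induction t with
  | leaf l => exact h l (by simp [leaves])
  | node k a b iha ihb =>
    simp only [cost]
    rw [iha fun l hl => h l (by simp [leaves, hl]), ihb fun l hl => h l (by simp [leaves, hl])]

theorem cost_add_le {dir : Bool} {c w : α → ℝ} (hw : ∀ l, 0 ≤ w l) (t : BT α) :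
    t.cost dir (fun l => c l + w l) ≤ t.cost dir c + (t.leaves.map w).sum := by
  induction t with
  | leaf l => simp [cost, leaves]
  | node k a b iha ihb =>
    have h1 := sum_leaves_nonneg hw a
    have h2 := sum_leaves_nonneg hw b
    simp only [cost, leaves, Multiset.map_add, Multiset.sum_add]
    split_ifs
    · linarith
    · rw [← min_add_add_right]
      exact min_le_min (by linarith) (by linarith)

/-- A cheapest set of leaves that reaches the opposite answer. -/
theorem exists_attack [DecidableEq α] (dir : Bool) {c : α → ℝ} (hc : ∀ l, 0 ≤ c l) (t : BT α) :
    ∃ S : Finset α, (∀ l ∈ S, l ∈ t.leaves) ∧ t.Holds dir (· ∈ S) ∧ ∑ l ∈ S, c l ≤ t.cost dir c := by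
  induction t with
  | leaf l => exact ⟨{l}, by simp [leaves], by simp [Holds], by simp [cost]⟩
  | node k a b iha ihb =>
    obtain ⟨Sa, ha, ha', ha''⟩ := iha
    obtain ⟨Sb, hb, hb', hb''⟩ := ihb
    simp only [cost, leaves, Holds, Multiset.mem_add]
    split_ifs
    · refine ⟨Sa ∪ Sb, fun l hl => ?_, ⟨holds_mono (fun l hl => ?_) _ ha',
        holds_mono (fun l hl => ?_) _ hb'⟩, ?_⟩
      · exact (Finset.mem_union.mp hl).imp (ha l) (hb l)
      · exact Finset.mem_union_left _ hl
      · exact Finset.mem_union_right _ hl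
      · have h := Finset.sum_union_inter (s₁ := Sa) (s₂ := Sb) (f := c)
        have := Finset.sum_nonneg fun l (_ : l ∈ Sa ∩ Sb) => hc l
        linarith
    · rcases min_cases (a.cost dir c) (b.cost dir c) with ⟨h, -⟩ | ⟨h, -⟩ <;> rw [h]
      · exact ⟨Sa, fun l hl => Or.inl (ha l hl), Or.inl ha', ha''⟩
      · exact ⟨Sb, fun l hl => Or.inr (hb l hl), Or.inr hb', hb''⟩

theorem ofReal_cost_le {dir : Bool} {c : α → ℝ} (hc : ∀ l, 0 ≤ c l) {p : α → Prop}
    {ψ : α → ℝ≥0∞} {t : BT α} (h : ∀ l ∈ t.leaves, p l → ENNReal.ofReal (c l) ≤ ψ l)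
    (ht : t.Holds dir p) : ENNReal.ofReal (t.cost dir c) ≤ (t.leaves.map ψ).sum := by
  induction t with
  | leaf l => simpa [leaves, cost] using h l (by simp [leaves]) ht
  | node k a b iha ihb =>
    have iha := iha fun l hl => h l (by simp [leaves, hl])
    have ihb := ihb fun l hl => h l (by simp [leaves, hl])
    simp only [cost, leaves, Holds, Multiset.map_add, Multiset.sum_add] at ht ⊢
    split_ifs at ht ⊢
    · rw [ENNReal.ofReal_add (cost_nonneg hc a) (cost_nonneg hc b)]
      exact add_le_add (iha ht.1) (ihb ht.2)
    · rcases ht with ht | ht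
      · exact (ENNReal.ofReal_le_ofReal (min_le_left _ _)).trans ((iha ht).trans le_self_add)
      · exact (ENNReal.ofReal_le_ofReal (min_le_right _ _)).trans ((ihb ht).trans le_add_self)

section Fold

variable {ρ : α → Rec} {dir : Bool}

theorem fold_cnt (t : BT α) : (t.fold ρ).cnt = (t.leaves.map fun l => (ρ l).cnt).sum := by
  induction t with
  | leaf l => simp [fold, leaves]
  | node k a b iha ihb => simp [fold, leaves, Rec.join, iha, ihb]

theorem fold_lsum (t : BT α) : (t.fold ρ).lsum = (t.leaves.map fun l => (ρ l).lsum).sum := by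
  induction t with
  | leaf l => simp [fold, leaves]
  | node k a b iha ihb => simp [fold, leaves, Rec.join, iha, ihb]

theorem fold_nmin (t : BT α) :
    (∃ l ∈ t.leaves, (t.fold ρ).nsel = (ρ l).nsel ∧ (t.fold ρ).nmin = (ρ l).nmin) ∧
      ∀ l ∈ t.leaves, (t.fold ρ).nmin ≤ (ρ l).nmin := by
  induction t with
  | leaf l => simp [fold, leaves]
  | node k a b iha ihb =>
    obtain ⟨⟨la, hla, h1, h2⟩, h3⟩ := iha
    obtain ⟨⟨lb, hlb, h4, h5⟩, h6⟩ := ihb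
    simp only [fold, leaves, Rec.join, Multiset.mem_add]
    split_ifs with h
    · refine ⟨⟨lb, Or.inr hlb, h4, h5⟩, ?_⟩
      rintro l (hl | hl)
      · exact h.le.trans (h3 l hl)
      · exact h6 l hl
    · refine ⟨⟨la, Or.inl hla, h1, h2⟩, ?_⟩
      rintro l (hl | hl)
      · exact h3 l hl
      · exact (not_lt.mp h).trans (h6 l hl)

theorem fold_g (t : BT α) :
    ((t.fold ρ).agg dir).g = t.cost dir fun l => ((ρ l).agg dir).g := by
  induction t with
  | leaf l => rfl
  | node k a b iha ihb =>
    simp only [fold, Rec.join, Agg.join_g, cost, ← iha, ← ihb, beq_iff_eq]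
    split_ifs with h1 h2
    · rfl
    · exact (min_eq_right h2.le).symm
    · exact (min_eq_left (not_lt.mp h2)).symm

theorem exists_fold_sel (t : BT α) :
    ∃ l ∈ t.leaves, ((t.fold ρ).agg dir).sel = ((ρ l).agg dir).sel := by
  induction t with
  | leaf l => exact ⟨l, by simp [leaves], rfl⟩
  | node k a b iha ihb =>
    obtain ⟨la, hla, h1⟩ := iha
    obtain ⟨lb, hlb, h2⟩ := ihb
    have h3 : ((node k a b).fold ρ |>.agg dir).sel = ((a.fold ρ).agg dir).sel ∨
        ((node k a b).fold ρ |>.agg dir).sel = ((b.fold ρ).agg dir).sel := by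
      simp only [fold, Rec.join, Agg.join_sel]
      split_ifs <;> simp
    simp only [leaves, Multiset.mem_add]
    rcases h3 with h3 | h3
    · exact ⟨la, Or.inl hla, h3.trans h1⟩
    · exact ⟨lb, Or.inr hlb, h3.trans h2⟩

variable (hf : ∀ l, 0 ≤ ((ρ l).agg dir).f)
include hf

theorem fold_f_nonneg (t : BT α) : 0 ≤ ((t.fold ρ).agg dir).f := by
  induction t with
  | leaf l => exact hf l
  | node k a b iha ihb =>
    simp only [fold, Rec.join, Agg.join_f]
    split_ifs
    · exact ihb
    · exact iha
    · positivity

theorem fold_f_eq_zero_iff (t : BT α) :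
    ((t.fold ρ).agg dir).f = 0 ↔ t.Holds dir fun l => ((ρ l).agg dir).f = 0 := by
  induction t with
  | leaf l => exact Iff.rfl
  | node k a b iha ihb =>
    have h1 := fold_f_nonneg hf a
    have h2 := fold_f_nonneg hf b
    simp only [Holds, ← iha, ← ihb, fold, Rec.join, Agg.join_f, beq_iff_eq]
    split_ifs with h3 h4
    · exact ⟨fun h => by linarith, fun h => h.2⟩
    · exact ⟨fun h => ⟨h, by linarith⟩, fun h => h.1⟩
    · simp only [div_eq_zero_iff, mul_eq_zero]
      constructor
      · rintro (h | h)
        · exact h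
        · exact Or.inl (by linarith)
      · exact Or.inl

theorem cost_le_fold_f_mul {w : α → ℝ} (hw : ∀ l, 0 ≤ w l) (t : BT α) :
    t.cost dir (fun l => w l * ((ρ l).agg dir).f) ≤
      ((t.fold ρ).agg dir).f * (t.leaves.map w).sum := by
  induction t with
  | leaf l => simp [fold, cost, leaves, mul_comm]
  | node k a b iha ihb =>
    have ha := fold_f_nonneg hf a
    have hb := fold_f_nonneg hf b
    have hwa := sum_leaves_nonneg hw a
    have hwb := sum_leaves_nonneg hw b
    simp only [fold, cost, leaves, Rec.join, Agg.join_f, Multiset.map_add, Multiset.sum_add,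
      beq_iff_eq]
    set fa := ((a.fold ρ).agg dir).f
    set fb := ((b.fold ρ).agg dir).f
    split_ifs with h1 h2
    · nlinarith
    · nlinarith
    · rcases eq_or_lt_of_le (add_nonneg ha hb) with h | h
      · have h0 : fa = 0 := by linarith
        rw [h0] at iha ⊢
        refine (min_le_left _ _).trans (iha.trans ?_)
        simp
      · rw [div_mul_eq_mul_div, le_div_iff₀ h]
        set x := min (a.cost dir fun l => w l * ((ρ l).agg dir).f)
          (b.cost dir fun l => w l * ((ρ l).agg dir).f)
        have h3 : x ≤ fa * (a.leaves.map w).sum := (min_le_left _ _).trans iha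
        have h4 : x ≤ fb * (b.leaves.map w).sum := (min_le_right _ _).trans ihb
        nlinarith

/-- Optimal weights, up to normalization. -/
theorem exists_weights {N : α → ℝ} (hm : ∀ l, ((ρ l).agg dir).m = N l * ((ρ l).agg dir).f)
    (t : BT α) (hN : ∀ l ∈ t.leaves, 0 < N l) (ht : t.leaves.Nodup)
    (hpos : 0 < ((t.fold ρ).agg dir).f) :
    ∃ u : α → ℝ, (∀ l, 0 ≤ u l) ∧ (∀ l, l ∉ t.leaves → u l = 0) ∧
      (t.leaves.map u).sum = 1 / ((t.fold ρ).agg dir).f ∧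
      1 ≤ t.cost dir (fun l => u l * ((ρ l).agg dir).f) ∧
      0 < ((t.fold ρ).agg dir).m ∧
      (∀ l ∈ t.leaves, u l / N l ≤ 1 / ((t.fold ρ).agg dir).m) ∧
      ∃ l ∈ t.leaves, ((t.fold ρ).agg dir).sel = ((ρ l).agg dir).sel ∧
        u l / N l = 1 / ((t.fold ρ).agg dir).m := by
  classical
  induction t with
  | leaf l =>
    simp only [fold] at hpos
    simp only [fold, leaves, cost, Multiset.mem_singleton, Multiset.map_singleton,
      Multiset.sum_singleton, forall_eq, exists_eq_left, hm, true_and]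
    have := hN l (by simp [leaves])
    refine ⟨fun l' => if l' = l then 1 / ((ρ l).agg dir).f else 0, fun l' => ?_, fun l' hl' => ?_,
      ?_, ?_, ?_, ?_, ?_⟩
    · dsimp only
      split_ifs <;> positivity
    · simp [hl']
    · simp
    · simp [hpos.ne']
    · positivity
    · simp only [if_true]
      rw [div_div, mul_comm]
    · simp only [if_true]
      rw [div_div, mul_comm]
  | node k a b iha ihb =>
    simp only [leaves, Multiset.nodup_add] at ht
    obtain ⟨hta, htb, hdisj⟩ := ht
    have hdisj' : ∀ l ∈ a.leaves, l ∉ b.leaves := fun l hl hl' =>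
      Multiset.disjoint_left.mp hdisj hl hl'
    have iha := iha (fun l hl => hN l (by simp [leaves, hl])) hta
    have ihb := ihb (fun l hl => hN l (by simp [leaves, hl])) htb
    have ha := fold_f_nonneg hf a
    have hb := fold_f_nonneg hf b
    simp only [fold, cost, leaves, Rec.join, Agg.join_f, Agg.join_m, Agg.join_sel, Multiset.map_add, Multiset.sum_add,
      beq_iff_eq, Multiset.mem_add, not_or] at hpos ⊢
    by_cases h1 : k = dir
    · simp only [h1, if_true] at hpos ⊢
      have key : ∀ (p q : BT α), (∀ l ∈ p.leaves, l ∉ q.leaves) → ∀ u : α → ℝ,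
          (∀ l, l ∉ p.leaves → u l = 0) → (q.leaves.map u).sum = 0 := by
        intro p q hpq u hu
        rw [Multiset.map_congr rfl (g := fun _ => (0 : ℝ)) fun l hl => hu l fun h => hpq l h hl]
        simp
      by_cases h2 : ((a.fold ρ).agg dir).f < ((b.fold ρ).agg dir).f
      · simp only [h2, if_true] at hpos ⊢
        obtain ⟨u, u1, u2, u3, u4, u5, u6, l, hl, u7, u8⟩ := ihb hpos
        refine ⟨u, u1, fun l hl => u2 l hl.2, ?_, ?_, u5, ?_, l, Or.inr hl, u7, u8⟩
        · rw [key b a (fun l hl hl' => hdisj' l hl' hl) u u2, u3, zero_add]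
        · have := cost_nonneg (dir := dir) (fun l => mul_nonneg (u1 l) (hf l)) a
          linarith
        · rintro l (hl | hl)
          · rw [u2 l (hdisj' l hl)]
            simp only [zero_div]
            positivity
          · exact u6 l hl
      · simp only [h2, if_false] at hpos ⊢
        obtain ⟨u, u1, u2, u3, u4, u5, u6, l, hl, u7, u8⟩ := iha hpos
        refine ⟨u, u1, fun l hl => u2 l hl.1, ?_, ?_, u5, ?_, l, Or.inl hl, u7, u8⟩
        · rw [key a b hdisj' u u2, u3, add_zero]
        · have := cost_nonneg (dir := dir) (fun l => mul_nonneg (u1 l) (hf l)) b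
          linarith
        · rintro l (hl | hl)
          · exact u6 l hl
          · rw [u2 l (fun h => hdisj' l h hl)]
            simp only [zero_div]
            positivity
    · simp only [h1, if_false] at hpos ⊢
      have hfa : 0 < ((a.fold ρ).agg dir).f := by
        refine lt_of_le_of_ne ha fun h => ?_
        rw [← h] at hpos
        simp at hpos
      have hfb : 0 < ((b.fold ρ).agg dir).f := by
        refine lt_of_le_of_ne hb fun h => ?_
        rw [← h] at hpos
        simp at hpos
      obtain ⟨u, u1, u2, u3, u4, u5, u6, l, hl, u7, u8⟩ := iha hfa
      obtain ⟨v, v1, v2, v3, v4, v5, v6, l', hl', v7, v8⟩ := ihb hfb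
      have hu : ∀ i ∈ a.leaves, u i + v i = u i := fun i hi => by rw [v2 i (hdisj' i hi), add_zero]
      have hv : ∀ i ∈ b.leaves, u i + v i = v i := fun i hi => by
        rw [u2 i (fun h => hdisj' i h hi), zero_add]
      refine ⟨fun i => u i + v i, fun i => add_nonneg (u1 i) (v1 i), fun i hi => ?_, ?_, ?_, ?_, ?_,
        ?_⟩
      · simp only [u2 i hi.1, v2 i hi.2, add_zero]
      · rw [Multiset.map_congr rfl hu, Multiset.map_congr rfl hv, u3, v3]
        field_simp
        ring
      · refine le_min ?_ ?_
        · rwa [cost_congr fun i hi => by simp only [hu i hi]; rfl]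
        · rwa [cost_congr fun i hi => by simp only [hv i hi]; rfl]
      · split_ifs
        · exact v5
        · exact u5
      · rintro i (hi | hi)
        · simp only [hu i hi]
          refine (u6 i hi).trans ?_
          split_ifs with h
          · exact one_div_le_one_div_of_le v5 h.le
          · exact le_rfl
        · simp only [hv i hi]
          refine (v6 i hi).trans ?_
          split_ifs with h
          · exact le_rfl
          · exact one_div_le_one_div_of_le u5 (not_lt.mp h)
      · split_ifs with h
        · exact ⟨l', Or.inr hl', v7, by simp only [hv l' hl', v8]⟩
        · exact ⟨l, Or.inl hl, u7, by simp only [hu l hl, u8]⟩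

end Fold

/-! ### Balanced merging -/

/-- `Merges k L t`: `t` results from the queue `L` of trees by merging the two first trees and
appending the result until one tree is left. -/
inductive Merges (k : Bool) : List (BT α) → BT α → Prop
  | single (t : BT α) : Merges k [t] t
  | step {a b t : BT α} {L : List (BT α)} : Merges k (L ++ [node k a b]) t → Merges k (a :: b :: L) t

theorem Merges.leaves_eq {k : Bool} {L : List (BT α)} {t : BT α} (h : Merges k L t) :
    t.leaves = (L.map leaves).sum := by
  induction h with
  | single t => simp
  | step h ih =>
    rw [ih]
    simp only [List.map_append, List.sum_append, List.map_cons, List.map_nil, List.sum_cons,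
      List.sum_nil, leaves, add_zero]
    abel

theorem Merges.holds_iff {k : Bool} {L : List (BT α)} {t : BT α} (h : Merges k L t) {dir : Bool}
    {p : α → Prop} :
    t.Holds dir p ↔ if k = dir then ∀ x ∈ L, x.Holds dir p else ∃ x ∈ L, x.Holds dir p := by
  induction h with
  | single t => simp
  | step h ih =>
    rw [ih]
    split_ifs with hk
    · simp only [List.mem_append, or_imp, forall_and, forall_eq, Holds, hk,
        if_true, List.mem_cons]
      tauto
    · simp only [List.mem_append, or_and_right, exists_or, exists_eq_left, Holds,
        hk, if_false, List.mem_cons, List.not_mem_nil, or_false]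
      exact or_comm.trans or_assoc

theorem Merges.height_le {k : Bool} {L : List (BT α)} {t : BT α} (h : Merges k L t) {N c : ℕ}
    (hL : L.length ≤ N) (hc : ∀ i e, (hi : i < L.length) → N ≤ (2 * L.length - 1 - i) * 2 ^ e →
      (L[i]).height ≤ c + e) {e : ℕ} (he : N ≤ 2 ^ e) : t.height ≤ c + e := by
  induction h with
  | single t => simpa using hc 0 e (by simp) (by simpa using he)
  | @step a b t L h ih =>
    simp only [List.length_cons] at hL hc
    refine ih (by simp; omega) fun i e' hi he' => ?_
    simp only [List.length_append, List.length_singleton] at hi he'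
    rcases Nat.lt_or_ge i L.length with h1 | h1
    · rw [List.getElem_append_left h1]
      have := hc (i + 2) e' (by omega) (by
        rw [show 2 * (L.length + 1 + 1) - 1 - (i + 2) = 2 * (L.length + 1) - 1 - i by omega]
        exact he')
      simpa using this
    · have h2 : i = L.length := by omega
      subst h2
      simp only [List.getElem_append_right le_rfl, Nat.sub_self, List.getElem_cons_zero, height]
      rw [show 2 * (L.length + 1) - 1 - L.length = L.length + 1 by omega] at he'
      obtain ⟨e, rfl⟩ : ∃ e, e' = e + 1 := by
        refine Nat.exists_eq_succ_of_ne_zero fun h0 => ?_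
        subst h0
        omega
      rw [pow_succ] at he'
      have ha := hc 0 e (by omega) (by
        rw [show 2 * (L.length + 1 + 1) - 1 - 0 = 2 * (L.length + 1) + 1 by omega]
        nlinarith)
      have hb := hc 1 e (by omega) (by
        rw [show 2 * (L.length + 1 + 1) - 1 - 1 = 2 * (L.length + 1) by omega]
        nlinarith)
      simp only [List.getElem_cons_zero, List.getElem_cons_succ] at ha hb
      have := max_le ha hb
      omega

end BT

/-! ### Game trees and their binary refinements -/

namespace GameTree

variable {T : GameTree}

theorem mem_children {s c : T.Node} : c ∈ T.children s ↔ c ≠ 0 ∧ T.parent c = s := by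
  simp [children]

theorem mem_leaves {s : T.Node} : s ∈ T.leaves ↔ T.children s = ∅ := by
  simp [leaves]

theorem induction_children {P : T.Node → Prop} (h : ∀ s, (∀ c ∈ T.children s, P c) → P s)
    (s : T.Node) : P s := by
  induction s using WellFoundedGT.induction with
  | ind s ih => exact h s fun c hc => ih c (lt_of_mem_children hc)

theorem le_value_iff {θ : ℝ} {μ : T.Node → ℝ} {s : T.Node} :
    θ ≤ T.value μ s ↔
      if T.children s = ∅ then θ ≤ μ s
      else if T.isMax s then ∃ c ∈ T.children s, θ ≤ T.value μ c
      else ∀ c ∈ T.children s, θ ≤ T.value μ c := by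
  rw [value]
  by_cases h : (T.children s).Nonempty
  · have h' := h.ne_empty
    simp only [h, h', dif_pos, if_false]
    split_ifs with hm
    · simp [Finset.le_sup'_iff]
    · simp [Finset.le_inf'_iff]
  · simp [Finset.not_nonempty_iff_eq_empty.mp h]

theorem depthOf_children {s c : T.Node} (h : c ∈ T.children s) :
    T.depthOf c = T.depthOf s + 1 := by
  obtain ⟨h1, h2⟩ := mem_children.mp h
  rw [depthOf, dif_neg h1, h2]

theorem depthOf_zero : T.depthOf 0 = 0 := by
  rw [depthOf, dif_pos rfl]

theorem depthOf_le (s : T.Node) : T.depthOf s ≤ T.depth :=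
  Finset.le_sup (f := T.depthOf) (Finset.mem_univ s)

theorem card_children_le (s : T.Node) : (T.children s).card ≤ T.maxBranching :=
  Finset.le_sup (f := fun s => (T.children s).card) (Finset.mem_univ s)

/-- `τ s` is a balanced binary refinement of the subtree of `s`, for every node `s`. -/
structure Binarizes (T : GameTree) (τ : T.Node → BT T.Node) : Prop where
  leaf : ∀ s, T.children s = ∅ → τ s = .leaf s
  node : ∀ s, T.children s ≠ ∅ → ∃ l : List T.Node, (l : Multiset T.Node) = (T.children s).val ∧
    BT.Merges (T.isMax s) (l.map τ) (τ s)

namespace Binarizes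

variable {τ : T.Node → BT T.Node} (h : T.Binarizes τ)
include h

theorem holds_iff (θ : ℝ) (μ : T.Node → ℝ) (s : T.Node) :
    (τ s).Holds false (fun l => θ ≤ μ l) ↔ θ ≤ T.value μ s := by
  induction s using induction_children with
  | h s ih =>
    rw [le_value_iff]
    split_ifs with h1 h2
    · rw [h.leaf s h1]
      rfl
    · obtain ⟨l, hl, hm⟩ := h.node s h1
      rw [hm.holds_iff, if_neg (by simp [h2])]
      have hl' : ∀ c, c ∈ l ↔ c ∈ T.children s := fun c => by
        rw [← Finset.mem_val, ← hl, Multiset.mem_coe]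
      simp only [List.mem_map, exists_exists_and_eq_and, hl']
      exact exists_congr fun c => and_congr_right fun hc => ih c hc
    · obtain ⟨l, hl, hm⟩ := h.node s h1
      rw [hm.holds_iff, if_pos (by simpa using h2)]
      have hl' : ∀ c, c ∈ l ↔ c ∈ T.children s := fun c => by
        rw [← Finset.mem_val, ← hl, Multiset.mem_coe]
      simp only [List.mem_map, forall_exists_index, and_imp, forall_apply_eq_imp_iff₂, hl']
      exact forall₂_congr fun c hc => ih c hc

theorem win_iff (θ : ℝ) (μ : T.Node → ℝ) :
    (τ 0).Holds false (fun l => θ ≤ μ l) ↔ T.Win θ μ :=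
  h.holds_iff θ μ 0

theorem leaves_eq_sum {s : T.Node} (hs : T.children s ≠ ∅) :
    (τ s).leaves = ∑ c ∈ T.children s, (τ c).leaves := by
  obtain ⟨l, hl, hm⟩ := h.node s hs
  rw [hm.leaves_eq, Finset.sum, ← hl, Multiset.map_coe, Multiset.sum_coe, List.map_map]
  rfl

theorem leaves_eq : (τ 0).leaves = T.leaves.val := by
  have key : ∀ i : ℕ, i ≤ T.n + 1 →
      ∑ c ∈ Finset.univ.filter (fun c : T.Node => i ≤ c.val ∧ (c = 0 ∨ (T.parent c).val < i)),
        (τ c).leaves + (T.leaves.filter fun l => l.val < i).val = (τ 0).leaves := by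
    intro i hi
    induction i with
    | zero =>
      have : (Finset.univ.filter fun c : T.Node => 0 ≤ c.val ∧ (c = 0 ∨ (T.parent c).val < 0)) =
          {0} := by ext; simp
      rw [this]
      simp
    | succ i ih =>
      rw [← ih (by omega)]
      set s : T.Node := ⟨i, by omega⟩ with hs
      have hp : s ≠ 0 → (T.parent s).val < i := fun h0 => T.parent_lt s h0
      set A := Finset.univ.filter fun c : T.Node =>
        i ≤ c.val ∧ (c = 0 ∨ (T.parent c).val < i) with hA
      have h1 : s ∈ A := by
        simp only [hA, Finset.mem_filter, Finset.mem_univ, true_and]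
        refine ⟨le_rfl, ?_⟩
        by_cases h0 : s = 0
        · exact Or.inl h0
        · exact Or.inr (hp h0)
      have h2 : (Finset.univ.filter fun c : T.Node =>
          i + 1 ≤ c.val ∧ (c = 0 ∨ (T.parent c).val < i + 1)) = (A.erase s) ∪ T.children s := by
        ext c
        simp only [hA, Finset.mem_filter, Finset.mem_univ, true_and, Finset.mem_union,
          Finset.mem_erase, mem_children, Fin.ext_iff, ne_eq, hs, Fin.val_zero]
        have hc : c.val ≠ 0 → (T.parent c).val < c.val := fun h0 =>
          T.parent_lt c fun h => h0 (by simp [h])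
        omega
      have h3 : Disjoint (A.erase s) (T.children s) := by
        rw [Finset.disjoint_left]
        intro c hc hc'
        simp only [hA, Finset.mem_filter, Finset.mem_univ, true_and, Finset.mem_erase,
          mem_children, Fin.ext_iff, ne_eq, hs, Fin.val_zero] at hc hc'
        omega
      rw [h2, Finset.sum_union h3, ← Finset.add_sum_erase _ _ h1]
      by_cases hl : T.children s = ∅
      · have h4 : (T.leaves.filter fun l => l.val < i + 1) =
            Finset.cons s (T.leaves.filter fun l => l.val < i) (by simp [hs]) := by
          ext l
          simp only [Finset.mem_filter, Finset.mem_cons]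
          constructor
          · rintro ⟨h5, h6⟩
            rcases Nat.lt_succ_iff_lt_or_eq.mp h6 with h7 | h7
            · exact Or.inr ⟨h5, h7⟩
            · exact Or.inl (Fin.ext h7)
          · rintro (rfl | ⟨h5, h6⟩)
            · exact ⟨mem_leaves.mpr hl, Nat.lt_succ_self _⟩
            · exact ⟨h5, by omega⟩
        rw [h4, hl, Finset.sum_empty, add_zero, Finset.cons_val, h.leaf s hl, BT.leaves,
          ← Multiset.singleton_add]
        abel
      · have h4 : (T.leaves.filter fun l => l.val < i + 1) =
            (T.leaves.filter fun l => l.val < i) := by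
          refine Finset.filter_congr fun l h5 => ?_
          refine ⟨fun h6 => ?_, fun h6 => by omega⟩
          rcases Nat.lt_succ_iff_lt_or_eq.mp h6 with h7 | h7
          · exact h7
          · have : l = s := Fin.ext h7
            exact absurd (mem_leaves.mp (this ▸ h5)) hl
        rw [h4, h.leaves_eq_sum hl]
        abel
  have h1 := key (T.n + 1) le_rfl
  rw [← h1]
  have h2 : (Finset.univ.filter fun c : T.Node =>
      T.n + 1 ≤ c.val ∧ (c = 0 ∨ (T.parent c).val < T.n + 1)) = ∅ := by
    ext c
    have := c.isLt
    simp only [Finset.mem_filter, Finset.mem_univ, true_and, Finset.notMem_empty, iff_false]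
    omega
  rw [h2, Finset.filter_true_of_mem fun l _ => l.isLt]
  simp

theorem nodup : (τ 0).leaves.Nodup := h.leaves_eq ▸ T.leaves.nodup

theorem mem_leaves_iff {l : T.Node} : l ∈ (τ 0).leaves ↔ l ∈ T.leaves := by
  rw [h.leaves_eq, Finset.mem_val]

theorem sum_leaves {M : Type*} [AddCommMonoid M] (f : T.Node → M) :
    ((τ 0).leaves.map f).sum = ∑ l ∈ T.leaves, f l := by
  rw [h.leaves_eq]
  rfl

theorem height_add_le {e : ℕ} (he : T.maxBranching ≤ 2 ^ e) (s : T.Node) :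
    (τ s).height + T.depthOf s * e ≤ T.depth * e := by
  induction s using induction_children with
  | h s ih =>
    by_cases hs : T.children s = ∅
    · rw [h.leaf s hs, BT.height, zero_add]
      exact Nat.mul_le_mul_right e (depthOf_le s)
    · obtain ⟨l, hl, hm⟩ := h.node s hs
      have hl' : ∀ c, c ∈ l ↔ c ∈ T.children s := fun c => by
        rw [← Finset.mem_val, ← hl, Multiset.mem_coe]
      have hlen : l.length = (T.children s).card := by
        rw [Finset.card, ← hl, Multiset.coe_card]
      obtain ⟨c, hc⟩ := Finset.nonempty_iff_ne_empty.mpr hs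
      have hlt : T.depthOf s + 1 ≤ T.depth := depthOf_children hc ▸ depthOf_le c
      obtain ⟨k, hk⟩ := Nat.exists_eq_add_of_le hlt
      have h1 := hm.height_le (N := T.maxBranching) (c := k * e) (e := e)
        (by rw [List.length_map, hlen]; exact card_children_le s) (fun i e' hi _ => by
          rw [List.getElem_map]
          simp only [List.length_map] at hi
          have h2 := (hl' l[i]).mp (List.getElem_mem hi)
          have h3 := ih _ h2
          rw [depthOf_children h2, hk, add_mul (T.depthOf s + 1)] at h3
          omega) he
      rw [hk]
      nlinarith

theorem height_le {e : ℕ} (he : T.maxBranching ≤ 2 ^ e) : (τ 0).height ≤ T.depth * e := by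
  simpa [depthOf_zero] using h.height_add_le he 0

end Binarizes

end GameTree

/-! ### The optimization problems of the stopping and sampling rules -/

/-- The cost of moving a leaf of mean `x` to the answer opposite to `dir`. -/
noncomputable def leafCost (kl : ℝ → ℝ) (θ : ℝ) (dir : Bool) (x : ℝ) : ℝ :=
  if decide (x < θ) = dir then 0 else kl x

section Alternatives

variable {E : ExpFamily} {T : GameTree} {θ : ℝ} {τ : T.Node → BT T.Node}

theorem leafCost_nonneg (dir : Bool) (x : ℝ) :
    0 ≤ leafCost (fun x => (E.d x θ).toReal) θ dir x := by
  unfold leafCost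
  split_ifs
  · exact le_rfl
  · exact ENNReal.toReal_nonneg

theorem leafCost_false_eq_zero_iff (hθ : θ ∈ interior E.X) {x : ℝ} (hx : x ∈ E.X) :
    leafCost (fun x => (E.d x θ).toReal) θ false x = 0 ↔ θ ≤ x := by
  unfold leafCost
  split_ifs with h
  · simpa using h
  · simp only [decide_eq_false_iff_not, not_not] at h
    refine ⟨fun h0 => ?_, fun h0 => absurd h (not_lt.mpr h0)⟩
    have h1 := ((ENNReal.toReal_eq_zero_iff _).mp h0).resolve_right (E.d_ne_top hθ hx)
    exact (E.eq_of_d_eq_zero hx (interior_subset hθ) h1).ge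

theorem leafCost_le (hθ : θ ∈ interior E.X) {dir : Bool} {x y : ℝ} (hx : x ∈ E.X) (hy : y ∈ E.X)
    (h : decide (y < θ) = dir) :
    ENNReal.ofReal (leafCost (fun x => (E.d x θ).toReal) θ dir x) ≤ E.d x y := by
  unfold leafCost
  split_ifs with h1
  · simp
  · rw [ENNReal.ofReal_toReal (E.d_ne_top hθ hx)]
    refine E.d_le_d hθ hx hy ?_
    subst h
    by_cases h2 : y < θ
    · have h3 : ¬x < θ := by simpa [h2] using h1
      nlinarith
    · have h3 : x < θ := by simpa [h2] using h1
      nlinarith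

theorem exists_le_leafCost (hθ : θ ∈ interior E.X) (dir : Bool) {x : ℝ} (hx : x ∈ E.X) {ε : ℝ}
    (hε : 0 < ε) : ∃ y ∈ E.X, decide (y < θ) = dir ∧
      E.d x y ≤ ENNReal.ofReal (leafCost (fun x => (E.d x θ).toReal) θ dir x + ε) := by
  by_cases h1 : decide (x < θ) = dir
  · exact ⟨x, hx, h1, by simp [E.d_self hx]⟩
  · rw [leafCost, if_neg h1]
    cases dir
    · refine ⟨θ, interior_subset hθ, by simp, ?_⟩
      conv_lhs => rw [← ENNReal.ofReal_toReal (E.d_ne_top hθ hx)]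
      exact ENNReal.ofReal_le_ofReal (by linarith)
    · obtain ⟨y, h2, h3, h4⟩ := E.exists_lt_d_le hθ hx (by simpa using h1) hε
      exact ⟨y, h2, by simpa using h3, h4⟩

theorem mem_Alt_iff (h : T.Binarizes τ) {μ lam : T.Node → ℝ} {dir : Bool}
    (hdir : dir = true ↔ T.Win θ μ) :
    lam ∈ Alt E T θ μ ↔ (∀ l ∈ T.leaves, lam l ∈ E.X) ∧
      (τ 0).Holds dir fun l => decide (lam l < θ) = dir := by
  refine and_congr_right fun _ => ?_
  rw [← hdir, ← h.win_iff θ lam]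
  cases dir
  · simp
  · simpa using (BT.holds_not (dir := false) (p := fun l => θ ≤ lam l) (τ 0)).symm

theorem altInf_eq (hθ : θ ∈ interior E.X) (h : T.Binarizes τ) {μ w : T.Node → ℝ} {dir : Bool}
    (hdir : dir = true ↔ T.Win θ μ) (hμ : ∀ l ∈ T.leaves, μ l ∈ E.X) (hw : ∀ l, 0 ≤ w l) :
    altInf E T θ μ w = ENNReal.ofReal ((τ 0).cost dir fun l =>
      w l * leafCost (fun x => (E.d x θ).toReal) θ dir (μ l)) := by
  classical
  set f : T.Node → ℝ := fun l => leafCost (fun x => (E.d x θ).toReal) θ dir (μ l) with hf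
  have hf0 : ∀ l, 0 ≤ f l := fun l => leafCost_nonneg dir (μ l)
  apply le_antisymm
  · refine ENNReal.le_of_forall_pos_le_add fun ε hε _ => ?_
    set W := ((τ 0).leaves.map w).sum with hW
    have hW0 : 0 ≤ W := BT.sum_leaves_nonneg hw _
    set δ : ℝ := ε / (W + 1) with hδ
    have hδ0 : 0 < δ := by positivity
    have hy : ∀ l, ∃ y, l ∈ T.leaves → y ∈ E.X ∧ decide (y < θ) = dir ∧
        E.d (μ l) y ≤ ENNReal.ofReal (f l + δ) := fun l => by
      by_cases hl : l ∈ T.leaves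
      · obtain ⟨y, h1, h2, h3⟩ := exists_le_leafCost hθ dir (hμ l hl) hδ0
        exact ⟨y, fun _ => ⟨h1, h2, h3⟩⟩
      · exact ⟨0, fun h => absurd h hl⟩
    choose y hy using hy
    obtain ⟨S, hS1, hS2, hS3⟩ := BT.exists_attack dir (c := fun l => w l * (f l + δ))
      (fun l => mul_nonneg (hw l) (by have := hf0 l; positivity)) (τ 0)
    have hS1' : ∀ l ∈ S, l ∈ T.leaves := fun l hl => h.mem_leaves_iff.mp (hS1 l hl)
    have hmem : (fun l => if l ∈ S then y l else μ l) ∈ Alt E T θ μ := by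
      rw [mem_Alt_iff h hdir]
      refine ⟨fun l hl => ?_, BT.holds_mono (fun l hl => ?_) _ hS2⟩
      · split_ifs
        · exact (hy l hl).1
        · exact hμ l hl
      · rw [if_pos hl]
        exact (hy l (hS1' l hl)).2.1
    calc altInf E T θ μ w
        ≤ ∑ l ∈ T.leaves, ENNReal.ofReal (w l) * E.d (μ l) (if l ∈ S then y l else μ l) :=
          iInf₂_le _ hmem
      _ = ∑ l ∈ S, ENNReal.ofReal (w l) * E.d (μ l) (if l ∈ S then y l else μ l) := by
          refine (Finset.sum_subset hS1' fun l hl hl' => ?_).symm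
          rw [if_neg hl', E.d_self (hμ l hl), mul_zero]
      _ ≤ ∑ l ∈ S, ENNReal.ofReal (w l * (f l + δ)) := by
          refine Finset.sum_le_sum fun l hl => ?_
          rw [if_pos hl, ENNReal.ofReal_mul (hw l)]
          gcongr
          exact (hy l (hS1' l hl)).2.2
      _ = ENNReal.ofReal (∑ l ∈ S, w l * (f l + δ)) :=
          (ENNReal.ofReal_sum_of_nonneg fun l _ =>
            mul_nonneg (hw l) (by have := hf0 l; positivity)).symm
      _ ≤ ENNReal.ofReal (((τ 0).cost dir fun l => w l * f l) + ε) := by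
          apply ENNReal.ofReal_le_ofReal
          refine hS3.trans ?_
          have h1 := BT.cost_add_le (dir := dir) (c := fun l => w l * f l)
            (w := fun l => w l * δ) (fun l => mul_nonneg (hw l) hδ0.le) (τ 0)
          rw [Multiset.sum_map_mul_right, ← hW] at h1
          simp only [mul_add]
          refine h1.trans (add_le_add le_rfl ?_)
          rw [hδ, mul_div_assoc', div_le_iff₀ (by positivity)]
          nlinarith [ε.coe_nonneg]
      _ = _ := by
          rw [ENNReal.ofReal_add (BT.cost_nonneg (fun l => mul_nonneg (hw l) (hf0 l)) _)
            ε.coe_nonneg, ENNReal.ofReal_coe_nnreal]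
  · refine le_iInf₂ fun lam hlam => ?_
    rw [mem_Alt_iff h hdir] at hlam
    rw [← h.sum_leaves]
    refine BT.ofReal_cost_le (fun l => mul_nonneg (hw l) (hf0 l)) (fun l hl hp => ?_) hlam.2
    have hl' := h.mem_leaves_iff.mp hl
    rw [ENNReal.ofReal_mul (hw l)]
    gcongr
    exact leafCost_le hθ (hμ l hl') (hlam.1 l hl') hp

theorem altInf_max_zero (μ w : T.Node → ℝ) :
    altInf E T θ μ (fun l => max (w l) 0) = altInf E T θ μ w := by
  simp [altInf, ENNReal.ofReal_max]

variable {ρ : T.Node → Rec}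

/-- The selected leaf may be drawn in a round without forced exploration. -/
theorem exists_isOptimalWeight (hθ : θ ∈ interior E.X) (h : T.Binarizes τ) {μ N : T.Node → ℝ}
    {dir : Bool} (hdir : dir = true ↔ T.Win θ μ) (hμ : ∀ l ∈ T.leaves, μ l ∈ E.X)
    (hN : ∀ l ∈ T.leaves, 0 < N l)
    (hf : ∀ l, ((ρ l).agg dir).f = leafCost (fun x => (E.d x θ).toReal) θ dir (μ l))
    (hm : ∀ l, ((ρ l).agg dir).m = N l * ((ρ l).agg dir).f) :
    ∃ l ∈ T.leaves, (((τ 0).fold ρ).agg dir).sel = ((ρ l).agg dir).sel ∧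
      ∃ w, IsOptimalWeight E T θ μ w ∧ ∀ l' ∈ T.leaves, w l' / N l' ≤ w l / N l := by
  classical
  have hf0 : ∀ l, 0 ≤ ((ρ l).agg dir).f := fun l => hf l ▸ leafCost_nonneg dir (μ l)
  set F := (((τ 0).fold ρ).agg dir).f with hF
  have hF0 : 0 ≤ F := BT.fold_f_nonneg hf0 _
  have hup : ∀ w ∈ T.simplex, altInf E T θ μ w ≤ ENNReal.ofReal F := by
    intro w hw
    rw [← altInf_max_zero, altInf_eq hθ h hdir hμ fun l => le_max_right _ _]
    apply ENNReal.ofReal_le_ofReal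
    have h1 := BT.cost_le_fold_f_mul hf0 (w := fun l => max (w l) 0) (fun l => le_max_right _ _)
      (τ 0)
    simp only [hf] at h1
    refine h1.trans_eq ?_
    rw [h.sum_leaves, Finset.sum_congr rfl fun l hl => max_eq_left (hw.1 l hl), hw.2, mul_one]
  rcases hF0.eq_or_lt with hF1 | hF1
  · obtain ⟨l, hl, hsel⟩ := BT.exists_fold_sel (ρ := ρ) (dir := dir) (τ 0)
    have hl := h.mem_leaves_iff.mp hl
    refine ⟨l, hl, hsel, Pi.single l 1, ⟨fun w hw => ?_, fun i _ => ?_, ?_⟩, fun l' hl' => ?_⟩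
    · have h1 := hup w hw
      rw [← hF1, ENNReal.ofReal_zero] at h1
      exact h1.trans zero_le
    · by_cases hi : i = l
      · simp [hi]
      · simp [hi]
    · rw [Finset.sum_pi_single', if_pos hl]
    · have := hN l hl
      by_cases hi : l' = l
      · rw [hi]
      · rw [Pi.single_eq_of_ne hi, Pi.single_eq_same, zero_div]
        positivity
  · obtain ⟨u, u1, u2, u3, u4, u5, u6, l, hl, u7, u8⟩ := BT.exists_weights hf0 hm (τ 0)
      (fun l hl => hN l (h.mem_leaves_iff.mp hl)) h.nodup hF1
    refine ⟨l, h.mem_leaves_iff.mp hl, u7, fun l => F * u l, ⟨fun w hw => ?_, fun i _ => ?_, ?_⟩,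
      fun l' hl' => ?_⟩
    · refine (hup w hw).trans ?_
      change _ ≤ altInf E T θ μ _
      rw [altInf_eq hθ h hdir hμ fun l => mul_nonneg hF0 (u1 l)]
      apply ENNReal.ofReal_le_ofReal
      simp only [mul_assoc, ← hf]
      rw [BT.cost_mul hF0]
      exact le_mul_of_one_le_right hF0 u4
    · exact mul_nonneg hF0 (u1 i)
    · rw [← Finset.mul_sum, ← h.sum_leaves, u3, mul_one_div_cancel hF1.ne']
    · simp only [mul_div_assoc]
      rw [u8]
      exact mul_le_mul_of_nonneg_left (u6 l' (h.mem_leaves_iff.mpr hl')) hF0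

end Alternatives

/-! ### The statistics of a history -/

section History

variable {T : GameTree}

/-- The sum of the rewards observed at leaf `l`. -/
noncomputable def rewardSum (r : ℕ → ℝ) (log : List ℕ) (l : ℕ) : ℝ :=
  ∑ k ∈ Finset.range log.length, if log[k]? = some l then r k else 0

theorem empMean_eq (r : ℕ → ℝ) (log : List ℕ) (l : T.Node) :
    empMean T r log l = rewardSum r log l / log.count l.val := rfl

theorem rewardSum_append (r : ℕ → ℝ) (log : List ℕ) (i l : ℕ) :
    rewardSum r (log ++ [i]) l = rewardSum r log l + if i = l then r log.length else 0 := by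
  rw [rewardSum, List.length_append, List.length_singleton, Finset.sum_range_succ, rewardSum]
  congr 1
  · refine Finset.sum_congr rfl fun k hk => ?_
    rw [List.getElem?_append_left (Finset.mem_range.mp hk)]
  · simp

theorem count_append_singleton (log : List ℕ) (i l : ℕ) :
    (log ++ [i]).count l = log.count l + if i = l then 1 else 0 := by
  rw [List.count_append, List.count_singleton]
  simp only [beq_iff_eq]

theorem empMean_mem {E : ExpFamily} {r : ℕ → ℝ} (hr : ∀ k, r k ∈ E.X) {log : List ℕ} {l : T.Node}
    (h : 0 < log.count l.val) : empMean T r log l ∈ E.X := by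
  rw [empMean_eq]
  induction log using List.reverseRecOn with
  | nil => simp at h
  | append_singleton log i ih =>
    rw [count_append_singleton, rewardSum_append] at *
    split_ifs at * with hi
    · rcases Nat.eq_zero_or_pos (log.count l.val) with h0 | h0
      · have h1 : rewardSum r log l.val = 0 := by
          refine Finset.sum_eq_zero fun k _ => if_neg fun hk => ?_
          exact List.count_eq_zero.mp h0 (List.mem_of_getElem? hk)
        simpa [h0, h1] using hr _
      · have hN : (0 : ℝ) < log.count l.val := by exact_mod_cast h0
        have hc : Convex ℝ E.X := E.ordConnected.convex
        have := hc (ih h0) (hr log.length) (a := log.count l.val / (log.count l.val + 1))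
          (b := 1 / (log.count l.val + 1)) (by positivity) (by positivity) (by field_simp)
        convert this using 1
        push_cast
        simp only [smul_eq_mul]
        field_simp
    · simpa using ih (by simpa using h)

/-- The statistics of leaf `l` after `N` draws of mean `x`. -/
noncomputable def leafRec (kl : ℝ → ℝ) (θ N x : ℝ) (l : ℕ) : Rec where
  agg dir := ⟨leafCost kl θ dir x, N * leafCost kl θ dir x, N * leafCost kl θ dir x, l⟩
  cnt := 1
  lsum := Real.log (1 + Real.log N)
  nmin := N
  nsel := l

/-- The statistics of the root after the draws in `log`. -/
noncomputable def rootRec (E : ExpFamily) (θ : ℝ) (τ : T.Node → BT T.Node) (r : ℕ → ℝ)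
    (log : List ℕ) : Rec :=
  (τ 0).fold fun l => leafRec (fun x => (E.d x θ).toReal) θ (log.count l.val)
    (empMean T r log l) l

variable {E : ExpFamily} {θ : ℝ} {τ : T.Node → BT T.Node} {r : ℕ → ℝ} {log : List ℕ}

theorem win_iff_rootRec (hθ : θ ∈ interior E.X) (h : T.Binarizes τ) (hr : ∀ k, r k ∈ E.X)
    (hlog : ∀ l ∈ T.leaves, 0 < log.count l.val) :
    T.Win θ (empMean T r log) ↔ ((rootRec E θ τ r log).agg false).f = 0 := by
  rw [rootRec, BT.fold_f_eq_zero_iff fun l => leafCost_nonneg _ _, ← h.win_iff]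
  exact BT.holds_congr fun l hl => (leafCost_false_eq_zero_iff hθ
    (empMean_mem hr (hlog l (h.mem_leaves_iff.mp hl)))).symm

theorem rootRec_cnt (h : T.Binarizes τ) : (rootRec E θ τ r log).cnt = T.leaves.card := by
  rw [rootRec, BT.fold_cnt, h.sum_leaves]
  simp [leafRec]

theorem beta_eq_rootRec (h : T.Binarizes τ) (δ : ℝ) :
    beta T δ log = 3 * (rootRec E θ τ r log).lsum + (rootRec E θ τ r log).cnt *
      Cexp (Real.log (1 / δ) / (rootRec E θ τ r log).cnt) := by
  rw [rootRec_cnt h, beta, rootRec, BT.fold_lsum, h.sum_leaves]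
  rfl

theorem glr_eq_rootRec (hθ : θ ∈ interior E.X) (h : T.Binarizes τ) (hr : ∀ k, r k ∈ E.X)
    (hlog : ∀ l ∈ T.leaves, 0 < log.count l.val) {dir : Bool}
    (hdir : dir = true ↔ T.Win θ (empMean T r log)) :
    glr E T θ r log = ENNReal.ofReal ((rootRec E θ τ r log).agg dir).g := by
  rw [glr, altInf_eq hθ h hdir (fun l hl => empMean_mem hr (hlog l hl))
    fun l => Nat.cast_nonneg _, rootRec, BT.fold_g]
  rfl

theorem stops_iff_rootRec (hθ : θ ∈ interior E.X) (h : T.Binarizes τ) (hr : ∀ k, r k ∈ E.X)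
    (hlog : ∀ l ∈ T.leaves, 0 < log.count l.val) {dir : Bool}
    (hdir : dir = true ↔ T.Win θ (empMean T r log)) (δ : ℝ) :
    Stops E T θ δ r log ↔ beta T δ log ≤ ((rootRec E θ τ r log).agg dir).g := by
  rw [Stops, glr_eq_rootRec hθ h hr hlog hdir, ENNReal.ofReal_le_ofReal_iff]
  rw [rootRec, BT.fold_g]
  exact BT.cost_nonneg (fun l => mul_nonneg (Nat.cast_nonneg _) (leafCost_nonneg _ _)) _

/-- The leaf to be drawn in the next round. -/
noncomputable def nextLeaf (R : Rec) (t : ℕ) : ℕ :=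
  if R.nmin < √((t : ℝ) + 1) - R.cnt / 2 then R.nsel
  else if (R.agg false).f = 0 then (R.agg true).sel else (R.agg false).sel

theorem maySample_nextLeaf (hθ : θ ∈ interior E.X) (h : T.Binarizes τ) (hr : ∀ k, r k ∈ E.X)
    (hlog : ∀ l ∈ T.leaves, 0 < log.count l.val) :
    ∃ l : T.Node, MaySample E T θ r log l ∧
      l.val = nextLeaf (rootRec E θ τ r log) log.length := by
  classical
  obtain ⟨⟨l, hl, h1, h2⟩, h3⟩ := BT.fold_nmin (ρ := fun l : T.Node =>
    leafRec (fun x => (E.d x θ).toReal) θ (log.count l.val) (empMean T r log l) l) (τ 0)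
  simp only [h.mem_leaves_iff] at hl h3
  change (rootRec E θ τ r log).nsel = l.val at h1
  change (rootRec E θ τ r log).nmin = (log.count l.val : ℝ) at h2
  change ∀ l : T.Node, l ∈ T.leaves → (rootRec E θ τ r log).nmin ≤ (log.count l.val : ℝ) at h3
  have hforced : (∃ l' ∈ T.leaves,
      (numPulls T log l' : ℝ) < √((log.length : ℝ) + 1) - (T.leaves.card : ℝ) / 2) ↔
      (rootRec E θ τ r log).nmin < √((log.length : ℝ) + 1) - (rootRec E θ τ r log).cnt / 2 := by
    rw [rootRec_cnt h]
    refine ⟨fun ⟨l', h4, h5⟩ => (h3 l' h4).trans_lt h5, fun h4 => ⟨l, hl, ?_⟩⟩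
    rw [h2] at h4
    exact h4
  unfold nextLeaf
  by_cases hc : (rootRec E θ τ r log).nmin < √((log.length : ℝ) + 1) -
      (rootRec E θ τ r log).cnt / 2
  · rw [if_pos hc, h1]
    refine ⟨l, ⟨hl, fun _ l' hl' => ?_, fun hn => absurd (hforced.mpr hc) hn⟩, rfl⟩
    have h4 := h3 l' hl'
    rw [h2] at h4
    exact_mod_cast h4
  · rw [if_neg hc]
    have hdir : decide (T.Win θ (empMean T r log)) = true ↔ T.Win θ (empMean T r log) :=
      decide_eq_true_iff
    obtain ⟨l, hl, h4, w, hw, h5⟩ := exists_isOptimalWeight (N := fun l => log.count l.val)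
      (ρ := fun l : T.Node =>
        leafRec (fun x => (E.d x θ).toReal) θ (log.count l.val) (empMean T r log l) l)
      hθ h hdir (fun l hl => empMean_mem hr (hlog l hl))
      (fun l hl => by exact_mod_cast hlog l hl) (fun l => rfl) (fun l => rfl)
    refine ⟨l, ⟨hl, fun hn => absurd (hforced.mp hn) hc, fun _ => ⟨w, hw, h5⟩⟩, ?_⟩
    have h6 : ((rootRec E θ τ r log).agg (decide (T.Win θ (empMean T r log)))).sel = l.val := h4
    rw [← h6, win_iff_rootRec hθ h hr hlog]
    by_cases h0 : ((rootRec E θ τ r log).agg false).f = 0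
    · simp [h0]
    · simp [h0]

end History

/-! ### Execution of commands -/

section Machine

theorem State.setNat_nat (σ : State) (a i v b : ℕ) :
    (σ.setNat a i v).nat b = if b = a then Function.update (σ.nat a) i v else σ.nat b := by
  simp only [State.setNat, Function.update_apply]

theorem State.setReal_real (σ : State) (a i : ℕ) (v : ℝ) (b : ℕ) :
    (σ.setReal a i v).real b = if b = a then Function.update (σ.real a) i v else σ.real b := by
  simp only [State.setReal, Function.update_apply]

@[simp] theorem State.setNat_real (σ : State) (a i v : ℕ) : (σ.setNat a i v).real = σ.real := rfl
@[simp] theorem State.setNat_log (σ : State) (a i v : ℕ) : (σ.setNat a i v).log = σ.log := rfl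
@[simp] theorem State.setNat_out (σ : State) (a i v : ℕ) : (σ.setNat a i v).out = σ.out := rfl

@[simp] theorem State.setReal_nat (σ : State) (a i : ℕ) (v : ℝ) :
    (σ.setReal a i v).nat = σ.nat := rfl

/-- The final state of a command without loops. -/
noncomputable def Cmd.run (env : Env) : Cmd → State → State
  | .skip, σ => σ
  | .setNat a i e, σ => σ.setNat a (i.eval σ) (e.eval σ)
  | .setReal a i e, σ => σ.setReal a (i.eval σ) (e.eval env σ)
  | .draw i a, σ =>
    { σ.setReal a 0 (env.reward σ.log.length) with log := σ.log ++ [i.eval σ] }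
  | .ret b, σ => { σ with out := some (b.eval env σ) }
  | .seq c d, σ => d.run env (c.run env σ)
  | .ite b c d, σ => if b.eval env σ then c.run env σ else d.run env σ
  | .while _ _, σ => σ

def Cmd.LoopFree : Cmd → Prop
  | .seq c d => c.LoopFree ∧ d.LoopFree
  | .ite _ c d => c.LoopFree ∧ d.LoopFree
  | .while _ _ => False
  | _ => True

/-- A bound for the time needed by a command without loops. -/
def Cmd.maxCost : Cmd → ℕ
  | .skip => 1
  | .setNat _ i e => 1 + i.cost + e.cost
  | .setReal _ i e => 1 + i.cost + e.cost
  | .draw i _ => 1 + i.cost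
  | .ret b => 1 + b.cost
  | .seq c d => c.maxCost + d.maxCost
  | .ite b c d => 1 + b.cost + (c.maxCost + d.maxCost)
  | .while _ _ => 0

theorem Cmd.exec_run (env : Env) {c : Cmd} (h : c.LoopFree) (σ : State) :
    ∃ n ≤ c.maxCost, Exec env c σ (c.run env σ) n := by
  induction c generalizing σ with
  | skip => exact ⟨_, le_rfl, .skip σ⟩
  | setNat a i e => exact ⟨_, le_rfl, .setNat a i e σ⟩
  | setReal a i e => exact ⟨_, le_rfl, .setReal a i e σ⟩
  | draw i a => exact ⟨_, le_rfl, .draw i a σ⟩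
  | ret b => exact ⟨_, le_rfl, .ret b σ⟩
  | seq c d ihc ihd =>
    obtain ⟨m, hm, h1⟩ := ihc h.1 σ
    obtain ⟨n, hn, h2⟩ := ihd h.2 (c.run env σ)
    exact ⟨m + n, add_le_add hm hn, .seq h1 h2⟩
  | ite b c d ihc ihd =>
    by_cases hb : b.eval env σ = true
    · obtain ⟨m, hm, h1⟩ := ihc h.1 σ
      refine ⟨1 + b.cost + m, by simp only [Cmd.maxCost]; omega, ?_⟩
      rw [Cmd.run, if_pos hb]
      exact .iteTrue hb h1
    · obtain ⟨m, hm, h1⟩ := ihd h.2 σ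
      refine ⟨1 + b.cost + m, by simp only [Cmd.maxCost]; omega, ?_⟩
      rw [Cmd.run, if_neg hb]
      exact .iteFalse (by simpa using hb) h1
  | _ => exact h.elim

/-- A loop whose body preserves `I` and decreases `meas`. -/
theorem Exec.exists_while {env : Env} {b : BExp} {c : Cmd} (I : State → Prop) (meas : State → ℕ)
    (hc : ∀ σ, I σ → b.eval env σ = true → ∃ σ' n, Exec env c σ σ' n ∧ I σ' ∧ meas σ' < meas σ)
    {σ : State} (hσ : I σ) :
    ∃ σ' n, Exec env (.while b c) σ σ' n ∧ I σ' ∧ b.eval env σ' = false := by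
  induction hm : meas σ using Nat.strong_induction_on generalizing σ with
  | _ m ih =>
    by_cases hb : b.eval env σ = true
    · obtain ⟨σ₁, n₁, h1, h2, h3⟩ := hc σ hσ hb
      obtain ⟨σ₂, n₂, h4, h5, h6⟩ := ih _ (hm ▸ h3) h2 rfl
      exact ⟨σ₂, _, .whileTrue hb h1 h4, h5, h6⟩
    · have hb : b.eval env σ = false := by simpa using hb
      exact ⟨σ, _, .whileFalse hb, hσ, hb⟩

/-- A loop whose body takes at most `B` time units, preserves `I` and decreases `meas`. -/
theorem Exec.exists_while_le {env : Env} {b : BExp} {c : Cmd} (I : State → Prop)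
    (meas : State → ℕ) (B : ℕ)
    (hc : ∀ σ, I σ → b.eval env σ = true →
      ∃ σ', ∃ n ≤ B, Exec env c σ σ' n ∧ I σ' ∧ meas σ' < meas σ)
    {σ : State} (hσ : I σ) :
    ∃ σ', ∃ n ≤ (meas σ + 1) * (1 + b.cost + B), Exec env (.while b c) σ σ' n ∧ I σ' ∧
      b.eval env σ' = false := by
  induction hm : meas σ using Nat.strong_induction_on generalizing σ with
  | _ m ih =>
    by_cases hb : b.eval env σ = true
    · obtain ⟨σ₁, n₁, hn₁, h1, h2, h3⟩ := hc σ hσ hb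
      obtain ⟨σ₂, n₂, hn₂, h4, h5, h6⟩ := ih _ (hm ▸ h3) h2 rfl
      refine ⟨σ₂, _, ?_, .whileTrue hb h1 h4, h5, h6⟩
      have h7 : meas σ₁ + 1 ≤ m := hm ▸ h3
      nlinarith
    · have hb : b.eval env σ = false := by simpa using hb
      exact ⟨σ, _, by nlinarith, .whileFalse hb, hσ, hb⟩

/-- `σ'` differs from `σ` at most in the cells `v` of the arrays in `N` and `R`. -/
structure OnlyAt (N R : List ℕ) (v : ℕ) (σ σ' : State) : Prop where
  nat : ∀ a i, (a ∈ N → i ≠ v) → σ'.nat a i = σ.nat a i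
  real : ∀ a i, (a ∈ R → i ≠ v) → σ'.real a i = σ.real a i
  log : σ'.log = σ.log
  out : σ'.out = σ.out

theorem OnlyAt.trans {N R : List ℕ} {v : ℕ} {σ σ' σ'' : State} (h : OnlyAt N R v σ σ')
    (h' : OnlyAt N R v σ' σ'') : OnlyAt N R v σ σ'' where
  nat a i hi := (h'.nat a i hi).trans (h.nat a i hi)
  real a i hi := (h'.real a i hi).trans (h.real a i hi)
  log := h'.log.trans h.log
  out := h'.out.trans h.out

theorem OnlyAt.nat_eq {N R : List ℕ} {v : ℕ} {σ σ' : State} (h : OnlyAt N R v σ σ') {a : ℕ}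
    (ha : a ∉ N) : σ'.nat a = σ.nat a :=
  funext fun i => h.nat a i fun h => absurd h ha

theorem OnlyAt.real_eq {N R : List ℕ} {v : ℕ} {σ σ' : State} (h : OnlyAt N R v σ σ') {a : ℕ}
    (ha : a ∉ R) : σ'.real a = σ.real a :=
  funext fun i => h.real a i fun h => absurd h ha

/-- `c` has no loops and writes only to the cells `x` of the arrays in `N` and `R`. -/
def Cmd.WritesAt (x : NExp) (N R : List ℕ) : Cmd → Prop
  | .skip => True
  | .setNat a i _ => i = x ∧ a ∈ N
  | .setReal a i _ => i = x ∧ a ∈ R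
  | .seq c d => c.WritesAt x N R ∧ d.WritesAt x N R
  | .ite _ c d => c.WritesAt x N R ∧ d.WritesAt x N R
  | _ => False

theorem Cmd.WritesAt.loopFree {x : NExp} {N R : List ℕ} {c : Cmd} (h : c.WritesAt x N R) :
    c.LoopFree := by
  induction c with
  | seq c d ihc ihd => exact ⟨ihc h.1, ihd h.2⟩
  | ite b c d ihc ihd => exact ⟨ihc h.1, ihd h.2⟩
  | _ => trivial

/-- The variable stored in cell `0` of the array `a`. -/
abbrev NExp.var (a : ℕ) : NExp := .get a (.lit 0)

theorem Cmd.WritesAt.onlyAt {env : Env} {a : ℕ} {N R : List ℕ} (ha : a ∉ N) {c : Cmd}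
    (h : c.WritesAt (.var a) N R) (σ : State) : OnlyAt N R (σ.nat a 0) σ (c.run env σ) := by
  have hrefl : ∀ σ, OnlyAt N R (σ.nat a 0) σ σ := fun σ =>
    ⟨fun _ _ _ => rfl, fun _ _ _ => rfl, rfl, rfl⟩
  induction c generalizing σ with
  | skip => exact hrefl σ
  | setNat b i e =>
    obtain ⟨rfl, hb⟩ := h
    refine ⟨fun a' i' h' => ?_, fun _ _ _ => rfl, rfl, rfl⟩
    simp only [Cmd.run, State.setNat_nat]
    split_ifs with h1
    · subst h1
      exact Function.update_of_ne (h' hb) _ _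
    · rfl
  | setReal b i e =>
    obtain ⟨rfl, hb⟩ := h
    refine ⟨fun _ _ _ => rfl, fun a' i' h' => ?_, rfl, rfl⟩
    simp only [Cmd.run, State.setReal_real]
    split_ifs with h1
    · subst h1
      exact Function.update_of_ne (h' hb) _ _
    · rfl
  | seq c d ihc ihd =>
    have h1 := ihc h.1 σ
    have h2 := ihd h.2 (c.run env σ)
    rw [h1.nat_eq ha] at h2
    exact h1.trans h2
  | ite b c d ihc ihd =>
    rw [Cmd.run]
    split_ifs
    · exact ihc h.1 σ
    · exact ihd h.2 σ
  | _ => exact h.elim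

end Machine

/-! ### Updating the statistics of a node

Arrays of naturals: `0` size, `1` parents and `2` labels of the game tree, `3` root of the binary
tree of a game tree node, `4`, `5` children, `6` parent and `7` label of a binary node, `8` queue,
`9`, `10` selected leaf for the answers "win" and "lose", `11` leaf drawn least; variables: `12`
current node, `13` game tree node, `14` number of its children, `15`, `16` counters, `17` number of
draws, `18` first unused binary node. Arrays of reals: `0` input, `1` reward, `2` sums of rewards,
`3`-`5` and `6`-`8` the fields `f`, `g`, `m` for "win" and "lose", `9` number of leaves, `10` sum
for the threshold, `11` least number of draws, `12` mean of a leaf, `13` scratch. -/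

def State.record (σ : State) (v : ℕ) : Rec where
  agg dir := ⟨σ.real (bif dir then 3 else 6) v, σ.real (bif dir then 4 else 7) v,
    σ.real (bif dir then 5 else 8) v, σ.nat (bif dir then 9 else 10) v⟩
  cnt := σ.real 9 v
  lsum := σ.real 10 v
  nmin := σ.real 11 v
  nsel := σ.nat 11 v

abbrev NExp.cur : NExp := .var 12

abbrev NExp.left : NExp := .get 4 .cur

abbrev NExp.right : NExp := .get 5 .cur

/-- Recompute the fields `f`, `g`, `m`, `sel` of the current node, which adds if `b` holds. -/
def aggCmd (b : BExp) (f g m sel : ℕ) : Cmd :=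
  .ite b
    (.seq (.setReal g .cur (.add (.get g .left) (.get g .right)))
      (.ite (.realLt (.get f .left) (.get f .right))
        (.seq (.setReal f .cur (.get f .right))
          (.seq (.setReal m .cur (.get m .right)) (.setNat sel .cur (.get sel .right))))
        (.seq (.setReal f .cur (.get f .left))
          (.seq (.setReal m .cur (.get m .left)) (.setNat sel .cur (.get sel .left))))))
    (.seq (.setReal f .cur (.div (.mul (.get f .left) (.get f .right))
        (.add (.get f .left) (.get f .right))))
      (.seq
        (.ite (.realLt (.get g .right) (.get g .left))
          (.setReal g .cur (.get g .right)) (.setReal g .cur (.get g .left)))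
        (.ite (.realLt (.get m .right) (.get m .left))
          (.seq (.setReal m .cur (.get m .right)) (.setNat sel .cur (.get sel .right)))
          (.seq (.setReal m .cur (.get m .left)) (.setNat sel .cur (.get sel .left))))))

def countCmd : Cmd :=
  .seq (.setReal 9 .cur (.add (.get 9 .left) (.get 9 .right)))
    (.seq (.setReal 10 .cur (.add (.get 10 .left) (.get 10 .right)))
      (.ite (.realLt (.get 11 .right) (.get 11 .left))
        (.seq (.setReal 11 .cur (.get 11 .right)) (.setNat 11 .cur (.get 11 .right)))
        (.seq (.setReal 11 .cur (.get 11 .left)) (.setNat 11 .cur (.get 11 .left)))))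

/-- Recompute the statistics of the current node. -/
def updateCmd : Cmd :=
  .seq (aggCmd (.natEq (.get 7 .cur) (.lit 1)) 3 4 5 9)
    (.seq (aggCmd (.not (.natEq (.get 7 .cur) (.lit 1))) 6 7 8 10) countCmd)

section Update

variable {env : Env} {σ : State} {v : ℕ}

theorem aggCmd_true (hv : σ.nat 12 0 = v) (ha : σ.nat 4 v ≠ v) (hb : σ.nat 5 v ≠ v) :
    (((aggCmd (.natEq (.get 7 .cur) (.lit 1)) 3 4 5 9).run env σ).record v).agg true =
      ((σ.record (σ.nat 4 v)).agg true).join (decide (σ.nat 7 v = 1) == true)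
        ((σ.record (σ.nat 5 v)).agg true) := by
  ext <;>
  simp only [Agg.join_f, Agg.join_g, Agg.join_m, Agg.join_sel] <;>
  simp only [aggCmd, Cmd.run, NExp.eval, BExp.eval, hv, State.record, cond_true,
    decide_eq_true_eq] <;>
  split_ifs <;>
  simp_all [State.setNat_nat, State.setReal_real, NExp.eval, RExp.eval, -not_lt]

theorem aggCmd_false (hv : σ.nat 12 0 = v) (ha : σ.nat 4 v ≠ v) (hb : σ.nat 5 v ≠ v) :
    (((aggCmd (.not (.natEq (.get 7 .cur) (.lit 1))) 6 7 8 10).run env σ).record v).agg false =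
      ((σ.record (σ.nat 4 v)).agg false).join (decide (σ.nat 7 v = 1) == false)
        ((σ.record (σ.nat 5 v)).agg false) := by
  ext <;>
  simp only [Agg.join_f, Agg.join_g, Agg.join_m, Agg.join_sel] <;>
  simp only [aggCmd, Cmd.run, NExp.eval, BExp.eval, hv, State.record, cond_false,
    decide_eq_true_eq] <;>
  split_ifs <;>
  simp_all [State.setNat_nat, State.setReal_real, NExp.eval, RExp.eval, -not_lt]

theorem countCmd_record (hv : σ.nat 12 0 = v) (ha : σ.nat 4 v ≠ v) (hb : σ.nat 5 v ≠ v) :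
    (countCmd.run env σ).record v =
      { Rec.join (decide (σ.nat 7 v = 1)) (σ.record (σ.nat 4 v)) (σ.record (σ.nat 5 v)) with
        agg := (σ.record v).agg } := by
  have w : OnlyAt [11] [9, 10, 11] v σ (countCmd.run env σ) := hv ▸ Cmd.WritesAt.onlyAt (by simp)
    (by simp [countCmd, Cmd.WritesAt]) σ
  refine Rec.ext ?_ ?_ ?_ ?_ ?_
  · funext dir
    cases dir <;> simp [State.record, w.real_eq, w.nat_eq]
  all_goals
    simp only [countCmd, Cmd.run, NExp.eval, hv, State.record, Rec.join]
    split_ifs <;>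
    simp_all [State.setNat_nat, State.setReal_real, NExp.eval, RExp.eval, BExp.eval,
      -not_lt]

theorem updateCmd_writesAt : updateCmd.WritesAt .cur [9, 10, 11] [3, 4, 5, 6, 7, 8, 9, 10, 11] := by
  simp [updateCmd, aggCmd, countCmd, Cmd.WritesAt]

theorem updateCmd_onlyAt (hv : σ.nat 12 0 = v) :
    OnlyAt [9, 10, 11] [3, 4, 5, 6, 7, 8, 9, 10, 11] v σ (updateCmd.run env σ) :=
  hv ▸ updateCmd_writesAt.onlyAt (by simp) σ

theorem updateCmd_record (hv : σ.nat 12 0 = v) (ha : σ.nat 4 v ≠ v) (hb : σ.nat 5 v ≠ v) :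
    (updateCmd.run env σ).record v = Rec.join (decide (σ.nat 7 v = 1))
      (σ.record (σ.nat 4 v)) (σ.record (σ.nat 5 v)) := by
  rw [updateCmd, Cmd.run, Cmd.run]
  set σ₁ := (aggCmd (.natEq (.get 7 .cur) (.lit 1)) 3 4 5 9).run env σ with h₁
  set σ₂ := (aggCmd (.not (.natEq (.get 7 .cur) (.lit 1))) 6 7 8 10).run env σ₁ with h₂
  have w₁ : OnlyAt [9] [3, 4, 5] v σ σ₁ := hv ▸ Cmd.WritesAt.onlyAt (by simp)
    (by simp [aggCmd, Cmd.WritesAt]) σ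
  have hv₁ : σ₁.nat 12 0 = v := by rw [w₁.nat_eq (by simp), hv]
  have w₂ : OnlyAt [10] [6, 7, 8] v σ₁ σ₂ := hv₁ ▸ Cmd.WritesAt.onlyAt (by simp)
    (by simp [aggCmd, Cmd.WritesAt]) σ₁
  have hv₂ : σ₂.nat 12 0 = v := by rw [w₂.nat_eq (by simp), hv₁]
  have e4 : σ₁.nat 4 = σ.nat 4 := w₁.nat_eq (by simp)
  have e5 : σ₁.nat 5 = σ.nat 5 := w₁.nat_eq (by simp)
  have e7 : σ₁.nat 7 = σ.nat 7 := w₁.nat_eq (by simp)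
  have e4' : σ₂.nat 4 = σ.nat 4 := (w₂.nat_eq (by simp)).trans e4
  have e5' : σ₂.nat 5 = σ.nat 5 := (w₂.nat_eq (by simp)).trans e5
  have hT := aggCmd_true (env := env) hv ha hb
  have hF := aggCmd_false (env := env) (σ := σ₁) hv₁ (by rwa [e4]) (by rwa [e5])
  rw [countCmd_record hv₂ (by rwa [e4']) (by rwa [e5']), e4', e5']
  have hagg : (σ₂.record v).agg = fun dir => ((σ.record (σ.nat 4 v)).agg dir).join
      (decide (σ.nat 7 v = 1) == dir) ((σ.record (σ.nat 5 v)).agg dir) := by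
    funext dir
    cases dir
    · rw [h₂, hF, e4, e5, e7]
      simp [State.record, w₁.real_eq, w₁.nat_eq]
    · rw [← hT, ← h₁]
      simp [State.record, w₂.real_eq, w₂.nat_eq]
  rw [hagg]
  simp only [State.record, Rec.join, w₂.real_eq (a := 9) (by simp),
    w₂.real_eq (a := 10) (by simp), w₂.real_eq (a := 11) (by simp), w₂.nat_eq (a := 11) (by simp),
    w₁.real_eq (a := 9) (by simp), w₁.real_eq (a := 10) (by simp), w₁.real_eq (a := 11) (by simp),
    w₁.nat_eq (a := 11) (by simp)]
  refine Rec.ext rfl rfl rfl ?_ ?_ <;> congr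

theorem OnlyAt.record_eq {N R : List ℕ} {v i : ℕ} {σ σ' : State} (h : OnlyAt N R v σ σ')
    (hi : i ≠ v) : σ'.record i = σ.record i := by
  simp only [State.record]
  rw [h.real 9 i fun _ => hi, h.real 10 i fun _ => hi, h.real 11 i fun _ => hi,
    h.nat 11 i fun _ => hi]
  congr 1
  funext dir
  rw [h.real _ i fun _ => hi, h.real _ i fun _ => hi, h.real _ i fun _ => hi,
    h.nat _ i fun _ => hi]

end Update

/-- Compute the mean and the fields `f` of the current leaf, which has just been drawn. -/
def leafMeanCmd : Cmd :=
  .seq (.setReal 2 .cur (.add (.get 2 .cur) (.get 1 (.lit 0))))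
  (.seq (.setReal 11 .cur (.add (.get 11 .cur) (.lit 1)))
  (.seq (.setReal 12 .cur (.div (.get 2 .cur) (.get 11 .cur)))
    (.ite (.realLt (.get 12 .cur) (.get 0 (.lit 0)))
      (.seq (.setReal 3 .cur (.lit 0)) (.setReal 6 .cur (.kl (.get 12 .cur))))
      (.seq (.setReal 3 .cur (.kl (.get 12 .cur))) (.setReal 6 .cur (.lit 0))))))

/-- Compute the other statistics of the current leaf. -/
def leafStatCmd : Cmd :=
  .seq (.setReal 4 .cur (.mul (.get 11 .cur) (.get 3 .cur)))
  (.seq (.setReal 5 .cur (.get 4 .cur))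
  (.seq (.setReal 7 .cur (.mul (.get 11 .cur) (.get 6 .cur)))
  (.seq (.setReal 8 .cur (.get 7 .cur))
  (.seq (.setReal 9 .cur (.lit 1))
  (.seq (.setReal 10 .cur (.log (.add (.lit 1) (.log (.get 11 .cur)))))
  (.seq (.setNat 9 .cur .cur)
  (.seq (.setNat 10 .cur .cur)
    (.setNat 11 .cur .cur))))))))

/-- Draw the current leaf. -/
def drawCmd : Cmd :=
  .seq (.draw .cur 1)
    (.seq (.setNat 17 (.lit 0) (.add (.var 17) (.lit 1))) (.seq leafMeanCmd leafStatCmd))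

section Leaf

variable {env : Env} {σ : State} {v : ℕ}

theorem leafMeanCmd_writesAt : leafMeanCmd.WritesAt .cur [] [2, 3, 6, 11, 12] := by
  simp [leafMeanCmd, Cmd.WritesAt]

theorem leafStatCmd_writesAt : leafStatCmd.WritesAt .cur [9, 10, 11] [4, 5, 7, 8, 9, 10] := by
  simp [leafStatCmd, Cmd.WritesAt]

theorem drawCmd_loopFree : drawCmd.LoopFree :=
  ⟨trivial, trivial, leafMeanCmd_writesAt.loopFree, leafStatCmd_writesAt.loopFree⟩

theorem leafMeanCmd_real (hv : σ.nat 12 0 = v) :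
    let σ' := leafMeanCmd.run env σ
    σ'.real 2 v = σ.real 2 v + σ.real 1 0 ∧ σ'.real 11 v = σ.real 11 v + 1 ∧
    σ'.real 3 v = leafCost env.kl (σ.real 0 0) true
      ((σ.real 2 v + σ.real 1 0) / (σ.real 11 v + 1)) ∧
    σ'.real 6 v = leafCost env.kl (σ.real 0 0) false
      ((σ.real 2 v + σ.real 1 0) / (σ.real 11 v + 1)) := by
  simp only [leafMeanCmd, Cmd.run, leafCost]
  split_ifs with h <;>
  simp_all [State.setReal_real, NExp.eval, RExp.eval, BExp.eval, -not_lt]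

theorem leafStatCmd_record (hv : σ.nat 12 0 = v) :
    (leafStatCmd.run env σ).record v =
      { agg := fun dir => ⟨σ.real (bif dir then 3 else 6) v,
          σ.real 11 v * σ.real (bif dir then 3 else 6) v,
          σ.real 11 v * σ.real (bif dir then 3 else 6) v, v⟩
        cnt := 1
        lsum := Real.log (1 + Real.log (σ.real 11 v))
        nmin := σ.real 11 v
        nsel := v } := by
  refine Rec.ext (funext fun dir => ?_) ?_ ?_ ?_ ?_
  · cases dir <;>
    simp [leafStatCmd, Cmd.run, State.setNat_nat, State.setReal_real, NExp.eval, RExp.eval, hv,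
      State.record]
  all_goals
    simp [leafStatCmd, Cmd.run, State.setNat_nat, State.setReal_real, NExp.eval, RExp.eval, hv,
      State.record]

/-- What `drawCmd` does. -/
structure Draws (env : Env) (v : ℕ) (σ σ' : State) : Prop where
  nat : ∀ a, a ≠ 9 → a ≠ 10 → a ≠ 11 → a ≠ 17 → σ'.nat a = σ.nat a
  count : σ'.nat 17 0 = σ.nat 17 0 + 1
  input : σ'.real 0 = σ.real 0
  sum : σ'.real 2 = Function.update (σ.real 2) v (σ.real 2 v + env.reward σ.log.length)
  record_ne : ∀ i, i ≠ v → σ'.record i = σ.record i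
  record_eq : σ'.record v = leafRec env.kl (σ.real 0 0) (σ.real 11 v + 1)
    ((σ.real 2 v + env.reward σ.log.length) / (σ.real 11 v + 1)) v
  log : σ'.log = σ.log ++ [v]
  out : σ'.out = σ.out

theorem drawCmd_run (hv : σ.nat 12 0 = v) : Draws env v σ (drawCmd.run env σ) := by
  rw [show drawCmd.run env σ = leafStatCmd.run env (leafMeanCmd.run env
    ((Cmd.setNat 17 (.lit 0) (.add (.var 17) (.lit 1))).run env
      ((Cmd.draw .cur 1).run env σ))) from rfl]
  set σ₁ := (Cmd.setNat 17 (.lit 0) (.add (.var 17) (.lit 1))).run env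
    ((Cmd.draw .cur 1).run env σ) with h₁
  have hnat : ∀ a, a ≠ 17 → σ₁.nat a = σ.nat a := fun a ha => by
    simp [h₁, Cmd.run, State.setNat_nat, ha]
  have hreal : ∀ a, a ≠ 1 → σ₁.real a = σ.real a := fun a ha => by
    simp [h₁, Cmd.run, State.setReal_real, ha]
  have hrew : σ₁.real 1 0 = env.reward σ.log.length := by
    simp [h₁, Cmd.run, State.setReal_real]
  have hv₁ : σ₁.nat 12 0 = v := by rw [hnat _ (by simp), hv]
  set σ₂ := leafMeanCmd.run env σ₁ with h₂
  have w₂ : OnlyAt [] [2, 3, 6, 11, 12] v σ₁ σ₂ :=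
    hv₁ ▸ leafMeanCmd_writesAt.onlyAt (by simp) σ₁
  have hv₂ : σ₂.nat 12 0 = v := by rw [w₂.nat_eq (by simp), hv₁]
  set σ₃ := leafStatCmd.run env σ₂ with h₃
  have w₃ : OnlyAt [9, 10, 11] [4, 5, 7, 8, 9, 10] v σ₂ σ₃ :=
    hv₂ ▸ leafStatCmd_writesAt.onlyAt (by simp) σ₂
  obtain ⟨h4, h5, h6, h7⟩ := leafMeanCmd_real (env := env) hv₁
  rw [← h₂] at h4 h5 h6 h7
  rw [hreal 2 (by simp), hrew] at h4 h6 h7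
  rw [hreal 11 (by simp)] at h5 h6 h7
  rw [hreal 0 (by simp)] at h6 h7
  constructor
  · intro a h9 h10 h11 h17
    rw [w₃.nat_eq (by simp [h9, h10, h11]), w₂.nat_eq (by simp), hnat a h17]
  · rw [w₃.nat_eq (by simp), w₂.nat_eq (by simp)]
    simp [h₁, Cmd.run, State.setNat_nat, NExp.eval]
  · rw [w₃.real_eq (by simp), w₂.real_eq (by simp), hreal 0 (by simp)]
  · rw [w₃.real_eq (by simp)]
    funext i
    by_cases hi : i = v
    · rw [hi, h4, Function.update_self]
    · rw [w₂.real 2 i fun _ => hi, hreal 2 (by simp), Function.update_of_ne hi]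
  · intro i hi
    rw [w₃.record_eq hi, w₂.record_eq hi]
    simp only [State.record]
    rw [hreal 9 (by simp), hreal 10 (by simp), hreal 11 (by simp), hnat 11 (by simp)]
    congr 1
    funext dir
    cases dir <;> simp [hreal, hnat]
  · rw [h₃, leafStatCmd_record hv₂, h5, leafRec]
    congr 1
    funext dir
    cases dir <;> simp [h6, h7]
  · rw [w₃.log, w₂.log]
    simp [h₁, Cmd.run, NExp.eval, hv]
  · rw [w₃.out, w₂.out]
    rfl

end Leaf

/-! ### Binary trees in memory -/

section Shape

variable {T : GameTree}

/-- `v` is a leaf `≥ i` of the game tree or a binary node that has been created. -/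
def Valid (T : GameTree) (i M v : ℕ) : Prop :=
  (∃ l ∈ T.leaves, i ≤ l.val ∧ l.val = v) ∨ (T.n + 1 ≤ v ∧ v < M)

theorem Valid.lt {i M v : ℕ} (h : Valid T i M v) (hM : T.n + 1 ≤ M) : v < M := by
  rcases h with ⟨l, -, -, rfl⟩ | h
  · exact l.isLt.trans_le hM
  · exact h.2

theorem Valid.mono {i M M' v : ℕ} (h : Valid T i M v) (hM : M ≤ M') : Valid T i M' v :=
  h.imp_right fun h => ⟨h.1, h.2.trans_le hM⟩

theorem valid_congr {i i' : ℕ} (h : ∀ l ∈ T.leaves, i' ≤ l.val ↔ i ≤ l.val) :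
    Valid T i' = Valid T i := by
  funext M v
  simp only [Valid]
  refine propext (or_congr_left (exists_congr fun l => and_congr_right fun hl => ?_))
  rw [h l hl]

theorem valid_leaf_iff {s : T.Node} (hs : s ∈ T.leaves) {M v : ℕ} :
    Valid T s M v ↔ v = s.val ∨ Valid T (s.val + 1) M v := by
  simp only [Valid, ← or_assoc]
  refine or_congr_left ⟨?_, ?_⟩
  · rintro ⟨l, hl, h1, rfl⟩
    rcases h1.eq_or_lt with h2 | h2
    · exact Or.inl h2.symm
    · exact Or.inr ⟨l, hl, h2, rfl⟩
  · rintro (rfl | ⟨l, hl, h1, rfl⟩)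
    · exact ⟨s, hs, le_rfl, rfl⟩
    · exact ⟨l, hl, by omega, rfl⟩

/-- The arrays `L`, `R`, `up`, `kind` describe the binary trees `bt v` of the binary nodes
`v < M` that have been created. -/
structure Shape (T : GameTree) (i M : ℕ) (bt : ℕ → BT T.Node) (L R up kind : ℕ → ℕ) : Prop where
  le : T.n + 1 ≤ M
  validL : ∀ v, T.n + 1 ≤ v → v < M → Valid T i M (L v)
  validR : ∀ v, T.n + 1 ≤ v → v < M → Valid T i M (R v)
  ltL : ∀ v, T.n + 1 ≤ v → v < M → L v < v
  ltR : ∀ v, T.n + 1 ≤ v → v < M → R v < v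
  upL : ∀ v, T.n + 1 ≤ v → v < M → up (L v) = v
  upR : ∀ v, T.n + 1 ≤ v → v < M → up (R v) = v
  node : ∀ v, T.n + 1 ≤ v → v < M → bt v = .node (decide (kind v = 1)) (bt (L v)) (bt (R v))
  up : ∀ v, up v ≠ 0 → T.n + 1 ≤ up v ∧ up v < M ∧ (L (up v) = v ∨ R (up v) = v)
  leaf : ∀ l ∈ T.leaves, i ≤ l.val → bt l.val = .leaf l

namespace Shape

variable {i M : ℕ} {bt : ℕ → BT T.Node} {L R up kind : ℕ → ℕ} (h : Shape T i M bt L R up kind)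
include h

theorem valid_of_up_ne_zero {v : ℕ} (hv : up v ≠ 0) : Valid T i M v := by
  obtain ⟨h1, h2, h3 | h3⟩ := h.up v hv
  · exact h3 ▸ h.validL _ h1 h2
  · exact h3 ▸ h.validR _ h1 h2

theorem up_eq_zero_of_le {v : ℕ} (hv : M ≤ v) : up v = 0 := by
  by_contra h0
  exact absurd ((h.valid_of_up_ne_zero h0).lt h.le) (not_lt.mpr hv)

theorem lt_up {v : ℕ} (hv : up v ≠ 0) : v < up v := by
  obtain ⟨h1, h2, h3 | h3⟩ := h.up v hv
  · exact h3.symm.trans_lt (h.ltL _ h1 h2)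
  · exact h3.symm.trans_lt (h.ltR _ h1 h2)

theorem height_lt_up {v : ℕ} (hv : up v ≠ 0) : (bt v).height < (bt (up v)).height := by
  obtain ⟨h1, h2, h3⟩ := h.up v hv
  rw [h.node _ h1 h2, BT.height]
  rcases h3 with h3 | h3
  · rw [h3]
    omega
  · rw [h3]
    omega

theorem merge {q₁ q₂ x : ℕ} (hv₁ : Valid T i M q₁) (hv₂ : Valid T i M q₂) (h₁ : up q₁ = 0)
    (h₂ : up q₂ = 0) :
    Shape T i (M + 1) (Function.update bt M (.node (decide (x = 1)) (bt q₁) (bt q₂)))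
      (Function.update L M q₁) (Function.update R M q₂)
      (Function.update (Function.update up q₁ M) q₂ M) (Function.update kind M x) := by
  have hlt₁ := hv₁.lt h.le
  have hlt₂ := hv₂.lt h.le
  have hn := h.le
  have hup : ∀ v, up v ≠ 0 → Function.update (Function.update up q₁ M) q₂ M v = up v := by
    intro v hv
    rw [Function.update_of_ne, Function.update_of_ne] <;> rintro rfl <;> contradiction
  have hcase : ∀ v, v < M + 1 → v ≠ M → v < M := fun v h1 h2 => by omega
  constructor
  · omega
  · intro v h1 h2
    rcases eq_or_ne v M with rfl | hne
    · simpa using hv₁.mono (Nat.le_succ _)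
    · rw [Function.update_of_ne hne]
      exact (h.validL v h1 (hcase v h2 hne)).mono (Nat.le_succ _)
  · intro v h1 h2
    rcases eq_or_ne v M with rfl | hne
    · simpa using hv₂.mono (Nat.le_succ _)
    · rw [Function.update_of_ne hne]
      exact (h.validR v h1 (hcase v h2 hne)).mono (Nat.le_succ _)
  · intro v h1 h2
    rcases eq_or_ne v M with rfl | hne
    · simpa using hlt₁
    · rw [Function.update_of_ne hne]
      exact h.ltL v h1 (hcase v h2 hne)
  · intro v h1 h2
    rcases eq_or_ne v M with rfl | hne
    · simpa using hlt₂
    · rw [Function.update_of_ne hne]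
      exact h.ltR v h1 (hcase v h2 hne)
  · intro v h1 h2
    rcases eq_or_ne v M with rfl | hne
    · rw [Function.update_self, Function.update_apply, Function.update_self, ite_self]
    · rw [Function.update_of_ne hne]
      have h3 := h.upL v h1 (hcase v h2 hne)
      rw [hup _ (by omega), h3]
  · intro v h1 h2
    rcases eq_or_ne v M with rfl | hne
    · rw [Function.update_self, Function.update_self]
    · rw [Function.update_of_ne hne]
      have h3 := h.upR v h1 (hcase v h2 hne)
      rw [hup _ (by omega), h3]
  · intro v h1 h2
    rcases eq_or_ne v M with rfl | hne
    · simp [Function.update_of_ne hlt₁.ne, Function.update_of_ne hlt₂.ne]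
    · have h3 := hcase v h2 hne
      have h4 := h.ltL v h1 h3
      have h5 := h.ltR v h1 h3
      simp only [Function.update_of_ne hne]
      rw [Function.update_of_ne (by omega), Function.update_of_ne (by omega)]
      exact h.node v h1 h3
  · intro v hv
    by_cases hq₂ : v = q₂
    · subst hq₂
      simp [hn]
    · by_cases hq₁ : v = q₁
      · subst hq₁
        simp [Function.update_of_ne hq₂, hn]
      · rw [Function.update_of_ne hq₂, Function.update_of_ne hq₁] at hv ⊢
        obtain ⟨h1, h2, h3⟩ := h.up v hv
        rw [Function.update_of_ne h2.ne, Function.update_of_ne h2.ne]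
        exact ⟨h1, by omega, h3⟩
  · intro l hl hi
    rw [Function.update_of_ne (l.isLt.trans_le hn).ne]
    exact h.leaf l hl hi

theorem addLeaf {s : T.Node} (hs : s ∈ T.leaves) (hi : i = s.val + 1) :
    Shape T s.val M (Function.update bt s.val (.leaf s)) L R up kind := by
  subst hi
  have hv : ∀ v, Valid T (s.val + 1) M v → v ≠ s.val := by
    rintro _ (⟨l, -, h1, rfl⟩ | h1) h2
    · omega
    · have := s.isLt
      omega
  have hns : ∀ v, T.n + 1 ≤ v → v ≠ s.val := fun v h1 => by
    have := s.isLt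
    omega
  refine ⟨h.le, fun v h1 h2 => (valid_leaf_iff hs).mpr (Or.inr (h.validL v h1 h2)),
    fun v h1 h2 => (valid_leaf_iff hs).mpr (Or.inr (h.validR v h1 h2)), h.ltL, h.ltR, h.upL, h.upR,
    fun v h1 h2 => ?_, h.up, fun l hl hi => ?_⟩
  · rw [Function.update_of_ne (hns v h1), Function.update_of_ne (hv _ (h.validL v h1 h2)),
      Function.update_of_ne (hv _ (h.validR v h1 h2))]
    exact h.node v h1 h2
  · rcases eq_or_ne l s with rfl | hne
    · simp
    · have h1 : l.val ≠ s.val := fun h => hne (Fin.ext h)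
      rw [Function.update_of_ne h1]
      exact h.leaf l hl (by omega)

end Shape

/-- The binary nodes without parent are the queue `Q` and the roots `rt c` for `c` in `P`. -/
structure Active (T : GameTree) (i M : ℕ) (up rt : ℕ → ℕ) (P : T.Node → Prop) (Q : List ℕ) :
    Prop where
  nodup : Q.Nodup
  queue : ∀ q ∈ Q, Valid T i M q ∧ up q = 0 ∧ ∀ c, P c → rt c.val ≠ q
  root : ∀ c, P c → Valid T i M (rt c.val) ∧ up (rt c.val) = 0
  inj : ∀ c c', P c → P c' → rt c.val = rt c'.val → c = c'
  cover : ∀ v, Valid T i M v → up v = 0 → v ∈ Q ∨ ∃ c, P c ∧ rt c.val = v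

namespace Active

variable {i M : ℕ} {bt : ℕ → BT T.Node} {L R up kind rt : ℕ → ℕ} {P P' : T.Node → Prop}
  {Q : List ℕ}

theorem merge {q₁ q₂ : ℕ} (h : Active T i M up rt P (q₁ :: q₂ :: Q))
    (hS : Shape T i M bt L R up kind) :
    Active T i (M + 1) (Function.update (Function.update up q₁ M) q₂ M) rt P (Q ++ [M]) := by
  have hM : M ≠ 0 := by have := hS.le; omega
  have hnd := h.nodup
  simp only [List.nodup_cons, List.mem_cons, not_or] at hnd
  obtain ⟨⟨h12, h1Q⟩, h2Q, hQ⟩ := hnd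
  obtain ⟨hv₁, -, hr₁⟩ := h.queue q₁ (by simp)
  obtain ⟨hv₂, -, hr₂⟩ := h.queue q₂ (by simp)
  have hq : ∀ q ∈ Q, Valid T i M q ∧ up q = 0 ∧ ∀ c, P c → rt c.val ≠ q :=
    fun q hq => h.queue q (by simp [hq])
  have hMQ : M ∉ Q := fun hmem => absurd ((hq M hmem).1.lt hS.le) (lt_irrefl M)
  have hup : ∀ v, v ≠ q₁ → v ≠ q₂ → Function.update (Function.update up q₁ M) q₂ M v = up v :=
    fun v h1 h2 => by rw [Function.update_of_ne h2, Function.update_of_ne h1]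
  refine ⟨?_, ?_, fun c hc => ?_, h.inj, fun v hv hv0 => ?_⟩
  · rw [List.nodup_append]
    refine ⟨hQ, by simp, ?_⟩
    rintro a ha b hb rfl
    exact hMQ (by simpa using (List.mem_singleton.mp hb) ▸ ha)
  · intro q hmem
    rcases List.mem_append.mp hmem with hmem | hmem
    · obtain ⟨h1, h2, h3⟩ := hq q hmem
      refine ⟨h1.mono (Nat.le_succ _), ?_, h3⟩
      rw [hup q (fun h => h1Q (h ▸ hmem)) (fun h => h2Q (h ▸ hmem)), h2]
    · rw [List.mem_singleton.mp hmem]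
      refine ⟨Or.inr ⟨hS.le, Nat.lt_succ_self M⟩, ?_, fun c hc => ((h.root c hc).1.lt hS.le).ne⟩
      rw [hup M (hv₁.lt hS.le).ne' (hv₂.lt hS.le).ne', hS.up_eq_zero_of_le le_rfl]
  · obtain ⟨h1, h2⟩ := h.root c hc
    exact ⟨h1.mono (Nat.le_succ _), by rw [hup _ (hr₁ c hc) (hr₂ c hc), h2]⟩
  · by_cases hvM : v = M
    · exact Or.inl (by simp [hvM])
    · have hv' : Valid T i M v := hv.imp_right fun h => ⟨h.1, by omega⟩
      have hv₂' : v ≠ q₂ := by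
        rintro rfl
        exact hM (by simpa using hv0)
      have hv₁' : v ≠ q₁ := by
        rintro rfl
        exact hM (by simpa [Function.update_of_ne hv₂'] using hv0)
      rw [hup v hv₁' hv₂'] at hv0
      rcases h.cover v hv' hv0 with h3 | h3
      · left
        simpa [hv₁', hv₂', hvM] using h3
      · exact Or.inr h3

theorem toQueue (h : Active T i M up rt P []) {l : List T.Node} (hl : l.Nodup)
    (hP : ∀ c, P c ↔ P' c ∨ c ∈ l) (hd : ∀ c, P' c → c ∉ l) :
    Active T i M up rt P' (l.map fun c => rt c.val) := by
  refine ⟨?_, ?_, fun c hc => h.root c ((hP c).mpr (Or.inl hc)), fun c c' hc hc' =>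
    h.inj c c' ((hP c).mpr (Or.inl hc)) ((hP c').mpr (Or.inl hc')), fun v hv hv0 => ?_⟩
  · refine List.Nodup.map_on (fun c hc c' hc' heq => ?_) hl
    exact h.inj c c' ((hP c).mpr (Or.inr hc)) ((hP c').mpr (Or.inr hc')) heq
  · intro q hq
    obtain ⟨c, hc, rfl⟩ := List.mem_map.mp hq
    obtain ⟨h1, h2⟩ := h.root c ((hP c).mpr (Or.inr hc))
    refine ⟨h1, h2, fun c' hc' heq => hd c' hc' ?_⟩
    rwa [h.inj c' c ((hP c').mpr (Or.inl hc')) ((hP c).mpr (Or.inr hc)) heq]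
  · rcases h.cover v hv hv0 with h1 | ⟨c, hc, rfl⟩
    · simp at h1
    · rcases (hP c).mp hc with h2 | h2
      · exact Or.inr ⟨c, h2, rfl⟩
      · exact Or.inl (List.mem_map.mpr ⟨c, h2, rfl⟩)

theorem ofQueue {q : ℕ} (h : Active T i M up rt P' [q]) {s : T.Node} (hs : ¬P' s)
    (hP : ∀ c, P c ↔ c = s ∨ P' c) : Active T i M up (Function.update rt s.val q) P [] := by
  obtain ⟨h1, h2, h3⟩ := h.queue q (by simp)
  have hrt : ∀ c, P' c → Function.update rt s.val q c.val = rt c.val := fun c hc => by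
    rw [Function.update_of_ne]
    intro heq
    exact hs (Fin.ext heq ▸ hc)
  refine ⟨by simp, by simp, fun c hc => ?_, fun c c' hc hc' heq => ?_, fun v hv hv0 => ?_⟩
  · rcases (hP c).mp hc with rfl | hc
    · simpa using ⟨h1, h2⟩
    · rw [hrt c hc]
      exact h.root c hc
  · rcases (hP c).mp hc with rfl | hc <;> rcases (hP c').mp hc' with rfl | hc'
    · rfl
    · rw [Function.update_self, hrt c' hc'] at heq
      exact absurd heq.symm (h3 c' hc')
    · rw [Function.update_self, hrt c hc] at heq
      exact absurd heq (h3 c hc)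
    · rw [hrt c hc, hrt c' hc'] at heq
      exact h.inj c c' hc hc' heq
  · rcases h.cover v hv hv0 with h4 | ⟨c, hc, rfl⟩
    · exact Or.inr ⟨s, (hP s).mpr (Or.inl rfl), by simpa using (List.mem_singleton.mp h4).symm⟩
    · exact Or.inr ⟨c, (hP c).mpr (Or.inr hc), hrt c hc⟩

theorem addLeaf {s : T.Node} (hs : s ∈ T.leaves) (h : Active T (s.val + 1) M up rt P [])
    (hS : Shape T (s.val + 1) M bt L R up kind) : Active T s.val M up rt P [s.val] := by
  have hv : ¬Valid T (s.val + 1) M s.val := by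
    rintro (⟨l, -, h1, h2⟩ | h1)
    · omega
    · have := s.isLt
      omega
  have hmono : ∀ v, Valid T (s.val + 1) M v → Valid T s.val M v :=
    fun v hv => (valid_leaf_iff hs).mpr (Or.inr hv)
  refine ⟨by simp, ?_, fun c hc => ⟨hmono _ (h.root c hc).1, (h.root c hc).2⟩, h.inj,
    fun v hv' hv0 => ?_⟩
  · simp only [List.mem_singleton, forall_eq]
    refine ⟨(valid_leaf_iff hs).mpr (Or.inl rfl), ?_, fun c hc heq => hv (heq ▸ (h.root c hc).1)⟩
    by_contra h0
    exact hv (hS.valid_of_up_ne_zero h0)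
  · rcases (valid_leaf_iff hs).mp hv' with rfl | h1
    · exact Or.inl (by simp)
    · exact Or.inr ((h.cover v h1 hv0).resolve_left (by simp))

end Active

/-- The game tree nodes `≥ i` whose parent is below `i`. -/
def Pending (T : GameTree) (i : ℕ) (c : T.Node) : Prop :=
  i ≤ c.val ∧ (c = 0 ∨ (T.parent c).val < i)

/-- The game tree nodes behind `s` whose parent is before `s`. -/
def Waiting (T : GameTree) (s : T.Node) (c : T.Node) : Prop :=
  s < c ∧ T.parent c < s

theorem pending_succ_iff (s c : T.Node) :
    Pending T (s.val + 1) c ↔ Waiting T s c ∨ c ∈ T.children s := by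
  have hc : c.val ≠ 0 → (T.parent c).val < c.val := fun h0 =>
    T.parent_lt c fun h => h0 (by simp [h])
  simp only [Pending, Waiting, GameTree.mem_children, Fin.ext_iff, Fin.lt_def, ne_eq,
    Fin.val_zero]
  omega

theorem pending_iff (s c : T.Node) : Pending T s.val c ↔ c = s ∨ Waiting T s c := by
  have hc : c.val ≠ 0 → (T.parent c).val < c.val := fun h0 =>
    T.parent_lt c fun h => h0 (by simp [h])
  simp only [Pending, Waiting, Fin.ext_iff, Fin.lt_def, Fin.val_zero]
  constructor
  · omega
  · rintro (h | h)
    · by_cases h0 : c.val = 0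
      · omega
      · have := hc h0
        omega
    · omega

/-- For the game tree nodes `s ≥ i`, the binary tree of `rt s` refines the subtree of `s`. -/
structure Roots (T : GameTree) (i M : ℕ) (bt : ℕ → BT T.Node) (rt : ℕ → ℕ) : Prop where
  valid : ∀ s : T.Node, i ≤ s.val → Valid T i M (rt s.val)
  leaf : ∀ s : T.Node, i ≤ s.val → T.children s = ∅ → bt (rt s.val) = .leaf s
  node : ∀ s : T.Node, i ≤ s.val → T.children s ≠ ∅ →
    ∃ l : List T.Node, (l : Multiset T.Node) = (T.children s).val ∧
      BT.Merges (T.isMax s) (l.map fun c => bt (rt c.val)) (bt (rt s.val))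

theorem Roots.binarizes {M : ℕ} {bt : ℕ → BT T.Node} {rt : ℕ → ℕ} (h : Roots T 0 M bt rt) :
    T.Binarizes fun s => bt (rt s.val) :=
  ⟨fun s => h.leaf s (Nat.zero_le _), fun s => h.node s (Nat.zero_le _)⟩

theorem Roots.mono {i M M' : ℕ} {bt bt' : ℕ → BT T.Node} {rt : ℕ → ℕ} (h : Roots T i M bt rt)
    (hM : M ≤ M') (hbt : ∀ v, Valid T i M v → bt' v = bt v) : Roots T i M' bt' rt := by
  refine ⟨fun s hs => (h.valid s hs).mono hM, fun s hs hl => ?_, fun s hs hl => ?_⟩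
  · rw [hbt _ (h.valid s hs), h.leaf s hs hl]
  · obtain ⟨l, h1, h2⟩ := h.node s hs hl
    refine ⟨l, h1, ?_⟩
    rw [hbt _ (h.valid s hs)]
    convert h2 using 1
    refine List.map_congr_left fun c hc => hbt _ (h.valid c ?_)
    have : c ∈ T.children s := by rwa [← Finset.mem_val, ← h1, Multiset.mem_coe]
    have := GameTree.lt_of_mem_children this
    exact hs.trans this.le

theorem Roots.add {s : T.Node} {M q : ℕ} {bt : ℕ → BT T.Node} {rt : ℕ → ℕ}
    (h : Roots T (s.val + 1) M bt rt) (hv : ∀ v, Valid T (s.val + 1) M v → Valid T s.val M v)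
    (hq : Valid T s.val M q) (hleaf : T.children s = ∅ → bt q = .leaf s)
    (hnode : T.children s ≠ ∅ → ∃ l : List T.Node, (l : Multiset T.Node) = (T.children s).val ∧
      BT.Merges (T.isMax s) (l.map fun c => bt (rt c.val)) (bt q)) :
    Roots T s.val M bt (Function.update rt s.val q) := by
  have hrt : ∀ c : T.Node, s.val < c.val → Function.update rt s.val q c.val = rt c.val :=
    fun c hc => Function.update_of_ne hc.ne' _ _
  have key : ∀ s' : T.Node, s.val ≤ s'.val → ∀ l : List T.Node,
      (l : Multiset T.Node) = (T.children s').val →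
      (l.map fun c => bt (Function.update rt s.val q c.val)) = l.map fun c => bt (rt c.val) := by
    intro s' hs' l hl
    refine List.map_congr_left fun c hc => ?_
    have : c ∈ T.children s' := by rwa [← Finset.mem_val, ← hl, Multiset.mem_coe]
    have := GameTree.lt_of_mem_children this
    rw [hrt c (hs'.trans_lt this)]
  refine ⟨fun s' hs' => ?_, fun s' hs' hl => ?_, fun s' hs' hl => ?_⟩
  · rcases eq_or_lt_of_le hs' with h1 | h1
    · rw [← h1, Function.update_self]
      exact hq
    · rw [hrt s' h1]
      exact hv _ (h.valid s' h1)
  · rcases eq_or_lt_of_le hs' with h1 | h1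
    · obtain rfl : s = s' := Fin.ext h1
      rw [Function.update_self]
      exact hleaf hl
    · rw [hrt s' h1]
      exact h.leaf s' h1 hl
  · rcases eq_or_lt_of_le hs' with h1 | h1
    · obtain rfl : s = s' := Fin.ext h1
      obtain ⟨l, h2, h3⟩ := hnode hl
      exact ⟨l, h2, by rw [Function.update_self, key s le_rfl l h2]; exact h3⟩
    · obtain ⟨l, h2, h3⟩ := h.node s' h1 hl
      exact ⟨l, h2, by rw [hrt s' h1, key s' hs' l h2]; exact h3⟩

end Shape

section Shape

variable {T : GameTree} {i i' M : ℕ} {bt : ℕ → BT T.Node} {L R up kind rt : ℕ → ℕ}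

theorem Shape.congr (h : Shape T i M bt L R up kind)
    (hi : ∀ l ∈ T.leaves, i' ≤ l.val ↔ i ≤ l.val) : Shape T i' M bt L R up kind := by
  have hV := valid_congr hi
  exact ⟨h.le, hV ▸ h.validL, hV ▸ h.validR, h.ltL, h.ltR, h.upL, h.upR, h.node, h.up,
    fun l hl hl' => h.leaf l hl ((hi l hl).mp hl')⟩

theorem Active.congr {P : T.Node → Prop} {Q : List ℕ} (h : Active T i M up rt P Q)
    (hi : ∀ l ∈ T.leaves, i' ≤ l.val ↔ i ≤ l.val) : Active T i' M up rt P Q := by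
  have hV := valid_congr hi
  exact ⟨h.nodup, hV ▸ h.queue, hV ▸ h.root, h.inj, hV ▸ h.cover⟩

theorem succ_le_iff_of_notMem_leaves {s : T.Node} (hs : s ∉ T.leaves) :
    ∀ l ∈ T.leaves, s.val ≤ l.val ↔ s.val + 1 ≤ l.val := by
  intro l hl
  have : l.val ≠ s.val := fun h => hs (Fin.ext h ▸ hl)
  omega

end Shape

/-! ### Memory contents between commands -/

section Memory

variable {T : GameTree} {env : Env} {θ δ : ℝ} {i M : ℕ} {bt : ℕ → BT T.Node} {σ σ' : State}

theorem State.record_congr (hreal : σ'.real = σ.real) (h9 : σ'.nat 9 = σ.nat 9)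
    (h10 : σ'.nat 10 = σ.nat 10) (h11 : σ'.nat 11 = σ.nat 11) : σ'.record = σ.record := by
  funext v
  simp only [State.record, hreal, h11]
  congr 1
  funext dir
  cases dir <;> simp [h9, h10]

/-- The statistics of the leaves `≥ i`, after the draws so far. -/
structure Data (T : GameTree) (env : Env) (θ δ : ℝ) (i : ℕ) (σ : State) : Prop where
  theta : σ.real 0 0 = θ
  delta : σ.real 0 1 = δ
  time : σ.nat 17 0 = σ.log.length
  sum : ∀ l : T.Node, σ.real 2 l.val = rewardSum env.reward σ.log l.val
  count : ∀ l : T.Node, σ.real 11 l.val = σ.log.count l.val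
  leaf : ∀ l ∈ T.leaves, i ≤ l.val → σ.record l.val =
    leafRec env.kl θ (σ.log.count l.val) (empMean T env.reward σ.log l) l.val

theorem Data.congr (h : Data T env θ δ i σ) (hreal : σ'.real = σ.real)
    (h9 : σ'.nat 9 = σ.nat 9) (h10 : σ'.nat 10 = σ.nat 10) (h11 : σ'.nat 11 = σ.nat 11)
    (h17 : σ'.nat 17 = σ.nat 17) (hlog : σ'.log = σ.log) : Data T env θ δ i σ' := by
  have hrec := State.record_congr hreal h9 h10 h11
  constructor <;> simp only [hreal, h17, hlog, hrec]
  exacts [h.theta, h.delta, h.time, h.sum, h.count, h.leaf]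

theorem Data.update {v : ℕ} (h : Data T env θ δ i σ) (hv : T.n + 1 ≤ v)
    (hu : OnlyAt [9, 10, 11] [3, 4, 5, 6, 7, 8, 9, 10, 11] v σ σ') : Data T env θ δ i σ' := by
  have hne : ∀ l : T.Node, l.val ≠ v := fun l => (l.isLt.trans_le hv).ne
  constructor
  · rw [hu.real_eq (by simp), h.theta]
  · rw [hu.real_eq (by simp), h.delta]
  · rw [hu.nat_eq (by simp), hu.log, h.time]
  · intro l
    rw [hu.real_eq (by simp), hu.log, h.sum l]
  · intro l
    rw [hu.real 11 l.val fun _ => hne l, hu.log, h.count l]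
  · intro l hl hi
    rw [hu.record_eq (hne l), hu.log, h.leaf l hl hi]

theorem Data.draw {s : T.Node} (h : Data T env θ δ i σ) (hd : Draws env s.val σ σ') {i' : ℕ}
    (hi : ∀ l ∈ T.leaves, i' ≤ l.val → l = s ∨ i ≤ l.val) : Data T env θ δ i' σ' := by
  have hcount : ∀ l : T.Node, σ'.real 11 l.val = σ'.log.count l.val := by
    intro l
    rw [show σ'.real 11 l.val = (σ'.record l.val).nmin from rfl, hd.log, count_append_singleton]
    rcases eq_or_ne l s with rfl | hne
    · rw [hd.record_eq, if_pos rfl]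
      simp [leafRec, h.count]
    · have hne' : l.val ≠ s.val := fun h => hne (Fin.ext h)
      rw [hd.record_ne _ hne', if_neg hne'.symm]
      exact h.count l
  have hsum : ∀ l : T.Node, σ'.real 2 l.val = rewardSum env.reward σ'.log l.val := by
    intro l
    rw [hd.sum, hd.log, rewardSum_append]
    rcases eq_or_ne l s with rfl | hne
    · simp [h.sum]
    · have hne' : l.val ≠ s.val := fun h => hne (Fin.ext h)
      rw [Function.update_of_ne hne', h.sum]
      simp [hne'.symm]
  refine ⟨by rw [hd.input, h.theta], by rw [hd.input, h.delta], ?_, hsum, hcount, ?_⟩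
  · rw [hd.count, hd.log, h.time]
    simp
  · intro l hl hil
    rcases eq_or_ne l s with rfl | hne
    · have h1 := hcount l
      have h2 := hsum l
      rw [show σ'.real 11 l.val = (σ'.record l.val).nmin from rfl, hd.record_eq] at h1
      rw [hd.sum, Function.update_self] at h2
      rw [hd.record_eq, empMean_eq, ← h1, ← h2, h.theta]
      rfl
    · have hne' : l.val ≠ s.val := fun h => hne (Fin.ext h)
      rw [hd.record_ne _ hne', h.leaf l hl ((hi l hl hil).resolve_left hne), hd.log,
        count_append_singleton, if_neg hne'.symm, add_zero, empMean_eq, empMean_eq,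
        rewardSum_append, count_append_singleton, if_neg hne'.symm]
      simp [hne'.symm]

/-- The record of the binary node `v` is obtained from those of its children. -/
def Joined (σ : State) (v : ℕ) : Prop :=
  σ.record v = Rec.join (decide (σ.nat 7 v = 1)) (σ.record (σ.nat 4 v)) (σ.record (σ.nat 5 v))

/-- The part of the memory that does not change while the nodes `≥ i` have been processed. -/
structure Base (T : GameTree) (env : Env) (θ δ : ℝ) (i M : ℕ) (bt : ℕ → BT T.Node)
    (σ : State) : Prop where
  size : σ.nat 0 0 = T.n + 1
  parent : ∀ s : T.Node, σ.nat 1 s.val = (T.parent s).val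
  label : ∀ s : T.Node, σ.nat 2 s.val = if T.isMax s then 1 else 0
  fresh : σ.nat 18 0 = M
  shape : Shape T i M bt (σ.nat 4) (σ.nat 5) (σ.nat 6) (σ.nat 7)
  joined : ∀ v, T.n + 1 ≤ v → v < M → Joined σ v
  data : Data T env θ δ i σ
  nodup : σ.log.Nodup
  mem_log : ∀ x, x ∈ σ.log ↔ ∃ l ∈ T.leaves, i ≤ l.val ∧ l.val = x
  out : σ.out = none

/-- `σ'` differs from `σ` at most in the queue and the variables. -/
structure Frame (σ σ' : State) : Prop where
  nat : ∀ a, a ∉ [8, 12, 13, 14, 15, 16] → σ'.nat a = σ.nat a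
  real : σ'.real = σ.real
  log : σ'.log = σ.log
  out : σ'.out = σ.out

theorem Frame.refl (σ : State) : Frame σ σ := ⟨fun _ _ => rfl, rfl, rfl, rfl⟩

theorem Frame.trans {σ'' : State} (h : Frame σ σ') (h' : Frame σ' σ'') : Frame σ σ'' :=
  ⟨fun a ha => (h'.nat a ha).trans (h.nat a ha), h'.real.trans h.real, h'.log.trans h.log,
    h'.out.trans h.out⟩

theorem Frame.setNat (σ : State) {a : ℕ} (ha : a ∈ [8, 12, 13, 14, 15, 16]) (j v : ℕ) :
    Frame σ (σ.setNat a j v) := by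
  refine ⟨fun b hb => ?_, rfl, rfl, rfl⟩
  rw [State.setNat_nat, if_neg]
  rintro rfl
  exact hb ha

theorem Frame.record (h : Frame σ σ') : σ'.record = σ.record :=
  State.record_congr h.real (h.nat _ (by simp)) (h.nat _ (by simp)) (h.nat _ (by simp))

theorem Frame.joined (h : Frame σ σ') {v : ℕ} : Joined σ' v ↔ Joined σ v := by
  simp only [Joined, h.record, h.nat 7 (by simp), h.nat 4 (by simp), h.nat 5 (by simp)]

theorem Base.frame (h : Base T env θ δ i M bt σ) (hf : Frame σ σ') :
    Base T env θ δ i M bt σ' where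
  size := by rw [hf.nat _ (by simp), h.size]
  parent s := by rw [hf.nat _ (by simp), h.parent]
  label s := by rw [hf.nat _ (by simp), h.label]
  fresh := by rw [hf.nat _ (by simp), h.fresh]
  shape := by
    rw [hf.nat 4 (by simp), hf.nat 5 (by simp), hf.nat 6 (by simp), hf.nat 7 (by simp)]
    exact h.shape
  joined v h1 h2 := hf.joined.mpr (h.joined v h1 h2)
  data := h.data.congr hf.real (hf.nat _ (by simp)) (hf.nat _ (by simp)) (hf.nat _ (by simp))
    (hf.nat _ (by simp)) hf.log
  nodup := hf.log ▸ h.nodup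
  mem_log := hf.log ▸ h.mem_log
  out := hf.out ▸ h.out

theorem Base.of_notMem_leaves {s : T.Node} (h : Base T env θ δ (s.val + 1) M bt σ)
    (hs : s ∉ T.leaves) : Base T env θ δ s.val M bt σ := by
  have hi := succ_le_iff_of_notMem_leaves hs
  exact ⟨h.size, h.parent, h.label, h.fresh, h.shape.congr hi, h.joined,
    ⟨h.data.theta, h.data.delta, h.data.time, h.data.sum, h.data.count,
      fun l hl hl' => h.data.leaf l hl ((hi l hl).mp hl')⟩, h.nodup,
    fun x => (h.mem_log x).trans (exists_congr fun l => and_congr_right fun hl => by rw [hi l hl]),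
    h.out⟩

/-- Change the root of the binary tree of a game tree node. -/
theorem Base.setRoot (h : Base T env θ δ i M bt σ) (s v : ℕ) :
    Base T env θ δ i M bt (σ.setNat 3 s v) := by
  have hn : ∀ a, a ≠ 3 → (σ.setNat 3 s v).nat a = σ.nat a := fun a ha => by
    rw [State.setNat_nat, if_neg ha]
  have hrec : (σ.setNat 3 s v).record = σ.record :=
    State.record_congr rfl (hn _ (by simp)) (hn _ (by simp)) (hn _ (by simp))
  constructor
  · rw [hn _ (by simp), h.size]
  · rw [hn _ (by simp)]; exact h.parent
  · rw [hn _ (by simp)]; exact h.label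
  · rw [hn _ (by simp), h.fresh]
  · rw [hn 4 (by simp), hn 5 (by simp), hn 6 (by simp), hn 7 (by simp)]
    exact h.shape
  · intro w h1 h2
    rw [Joined, hrec, hn 4 (by simp), hn 5 (by simp), hn 7 (by simp)]
    exact h.joined w h1 h2
  · exact h.data.congr rfl (hn _ (by simp)) (hn _ (by simp)) (hn _ (by simp)) (hn _ (by simp)) rfl
  · exact h.nodup
  · exact h.mem_log
  · exact h.out

theorem Base.drawLeaf {s : T.Node} (h : Base T env θ δ (s.val + 1) M bt σ) (hs : s ∈ T.leaves)
    (hd : Draws env s.val σ σ') :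
    Base T env θ δ s.val M (Function.update bt s.val (.leaf s)) σ' := by
  have hn : ∀ a, a ≠ 9 → a ≠ 10 → a ≠ 11 → a ≠ 17 → σ'.nat a = σ.nat a := hd.nat
  have hV : ∀ v, Valid T (s.val + 1) M v → v ≠ s.val := by
    rintro v (⟨l, -, h1, rfl⟩ | h1)
    · omega
    · have := s.isLt
      omega
  constructor
  · rw [hn _ (by simp) (by simp) (by simp) (by simp), h.size]
  · rw [hn _ (by simp) (by simp) (by simp) (by simp)]; exact h.parent
  · rw [hn _ (by simp) (by simp) (by simp) (by simp)]; exact h.label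
  · rw [hn _ (by simp) (by simp) (by simp) (by simp), h.fresh]
  · rw [hn 4 (by simp) (by simp) (by simp) (by simp), hn 5 (by simp) (by simp) (by simp) (by simp),
      hn 6 (by simp) (by simp) (by simp) (by simp), hn 7 (by simp) (by simp) (by simp) (by simp)]
    exact h.shape.addLeaf hs rfl
  · intro w h1 h2
    have := s.isLt
    rw [Joined, hn 4 (by simp) (by simp) (by simp) (by simp),
      hn 5 (by simp) (by simp) (by simp) (by simp), hn 7 (by simp) (by simp) (by simp) (by simp),
      hd.record_ne w (by omega), hd.record_ne _ (hV _ (h.shape.validL w h1 h2)),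
      hd.record_ne _ (hV _ (h.shape.validR w h1 h2))]
    exact h.joined w h1 h2
  · refine h.data.draw hd fun l _ hl => ?_
    rcases eq_or_ne l s with h1 | h1
    · exact Or.inl h1
    · have : l.val ≠ s.val := fun h => h1 (Fin.ext h)
      exact Or.inr (by omega)
  · rw [hd.log, List.nodup_append]
    refine ⟨h.nodup, by simp, ?_⟩
    rintro a ha b hb rfl
    obtain ⟨l, -, h1, rfl⟩ := (h.mem_log a).mp ha
    have := List.mem_singleton.mp hb
    omega
  · intro x
    rw [hd.log, List.mem_append, List.mem_singleton, h.mem_log]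
    constructor
    · rintro (⟨l, hl, h1, rfl⟩ | rfl)
      · exact ⟨l, hl, by omega, rfl⟩
      · exact ⟨s, hs, le_rfl, rfl⟩
    · rintro ⟨l, hl, h1, rfl⟩
      rcases h1.eq_or_lt with h2 | h2
      · exact Or.inr h2.symm
      · exact Or.inl ⟨l, hl, h2, rfl⟩
  · rw [hd.out, h.out]

end Memory

/-! ### The initialization -/

/-- Append the root of the node in question to the queue if it is a child of the current one. -/
def collectCmd : Cmd :=
  .seq (.ite (.natEq (.get 1 (.var 15)) (.var 13))
      (.seq (.setNat 8 (.var 14) (.get 3 (.var 15))) (.setNat 14 (.lit 0) (.add (.var 14) (.lit 1))))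
      .skip)
    (.setNat 15 (.lit 0) (.add (.var 15) (.lit 1)))

/-- Create a binary node with the first two nodes in the queue as children. -/
def linkCmd : Cmd :=
  .seq (.setNat 12 (.lit 0) (.var 18))
  (.seq (.setNat 4 .cur (.get 8 (.add (.var 16) (.var 16))))
  (.seq (.setNat 5 .cur (.get 8 (.add (.add (.var 16) (.var 16)) (.lit 1))))
  (.seq (.setNat 6 .left .cur)
  (.seq (.setNat 6 .right .cur)
    (.setNat 7 .cur (.get 2 (.var 13)))))))

/-- Append the current binary node to the queue. -/
def enqueueCmd : Cmd :=
  .seq (.setNat 8 (.add (.var 14) (.var 16)) .cur)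
  (.seq (.setNat 18 (.lit 0) (.add (.var 18) (.lit 1)))
    (.setNat 16 (.lit 0) (.add (.var 16) (.lit 1))))

def mergeCmd : Cmd := .seq linkCmd (.seq updateCmd enqueueCmd)

/-- Process the last unprocessed node of the game tree. -/
def nodeCmd : Cmd :=
  .seq (.seq (.setNat 13 (.lit 0) (.sub (.var 13) (.lit 1)))
    (.seq (.setNat 14 (.lit 0) (.lit 0)) (.setNat 15 (.lit 0) (.add (.var 13) (.lit 1)))))
  (.seq (.while (.natLt (.var 15) (.get 0 (.lit 0))) collectCmd)
    (.ite (.natEq (.var 14) (.lit 0))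
      (.seq (.setNat 12 (.lit 0) (.var 13)) (.seq drawCmd (.setNat 3 (.var 13) (.var 13))))
      (.seq (.setNat 16 (.lit 0) (.lit 0))
        (.seq (.while (.natLt (.add (.var 16) (.lit 1)) (.var 14)) mergeCmd)
          (.setNat 3 (.var 13) (.get 8 (.sub (.add (.var 14) (.var 16)) (.lit 1))))))))

def initCmd : Cmd :=
  .seq (.seq (.setNat 18 (.lit 0) (.get 0 (.lit 0))) (.setNat 13 (.lit 0) (.get 0 (.lit 0))))
    (.while (.natLt (.lit 0) (.var 13)) nodeCmd)

section Build

variable {T : GameTree} {env : Env} {θ δ : ℝ} {i M : ℕ} {bt : ℕ → BT T.Node} {σ σ' : State}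

/-- While the children of `s` are collected, `l` lists those found so far. -/
structure Collecting (T : GameTree) (s : T.Node) (σ σ' : State) (l : List T.Node) : Prop where
  frame : Frame σ σ'
  node : σ'.nat 13 0 = s.val
  length : σ'.nat 14 0 = l.length
  nodup : l.Nodup
  mem : ∀ x, x ∈ l ↔ x ∈ T.children s ∧ x.val < σ'.nat 15 0
  queue : (List.range' 0 l.length).map (σ'.nat 8) = l.map fun c => σ.nat 3 c.val

theorem collectCmd_run {s : T.Node} (hb : Base T env θ δ i M bt σ) {l : List T.Node}
    (h : Collecting T s σ σ' l) (hlt : σ'.nat 15 0 < T.n + 1) (hs : s.val < σ'.nat 15 0) :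
    ∃ l', Collecting T s σ (collectCmd.run env σ') l' ∧
      (collectCmd.run env σ').nat 15 0 = σ'.nat 15 0 + 1 := by
  obtain ⟨c, hc⟩ : ∃ c : T.Node, c.val = σ'.nat 15 0 := ⟨⟨_, hlt⟩, rfl⟩
  have hpar : σ'.nat 1 (σ'.nat 15 0) = (T.parent c).val := by
    rw [← hc, h.frame.nat 1 (by simp), hb.parent c]
  have hrt : σ'.nat 3 = σ.nat 3 := h.frame.nat 3 (by simp)
  have hchild : c ∈ T.children s ↔ T.parent c = s := by
    rw [GameTree.mem_children]
    refine and_iff_right fun h0 => ?_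
    rw [h0] at hc
    simp only [Fin.val_zero] at hc
    omega
  have hmem : ∀ x : T.Node, x.val < σ'.nat 15 0 + 1 ↔ x.val < σ'.nat 15 0 ∨ x = c := by
    intro x
    rw [Fin.ext_iff, hc]
    omega
  by_cases hp : T.parent c = s
  · have hrun : collectCmd.run env σ' = ((σ'.setNat 8 l.length (σ.nat 3 c.val)).setNat 14 0
        (l.length + 1)).setNat 15 0 (σ'.nat 15 0 + 1) := by
      rw [collectCmd, Cmd.run, Cmd.run, Cmd.run, if_pos (by simp [BExp.eval, NExp.eval, hpar, hp, h.node])]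
      simp [Cmd.run, NExp.eval, State.setNat_nat, h.length, hrt, hc]
    rw [hrun]
    have h8 : (((σ'.setNat 8 l.length (σ.nat 3 c.val)).setNat 14 0
        (l.length + 1)).setNat 15 0 (σ'.nat 15 0 + 1)).nat 8 =
        Function.update (σ'.nat 8) l.length (σ.nat 3 c.val) := by
      simp [State.setNat_nat]
    have hcl : c ∉ l := fun hcl => by
      have := ((h.mem c).mp hcl).2
      omega
    refine ⟨l ++ [c], ⟨?_, ?_, ?_, ?_, ?_, ?_⟩, by simp [State.setNat_nat]⟩
    · exact ((h.frame.trans (.setNat _ (by simp) _ _)).trans (.setNat _ (by simp) _ _)).trans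
        (.setNat _ (by simp) _ _)
    · simp [State.setNat_nat, h.node]
    · simp [State.setNat_nat]
    · rw [List.nodup_append]
      refine ⟨h.nodup, by simp, ?_⟩
      rintro a ha b hb rfl
      exact hcl (List.mem_singleton.mp hb ▸ ha)
    · intro x
      have h15 : (((σ'.setNat 8 l.length (σ.nat 3 c.val)).setNat 14 0
        (l.length + 1)).setNat 15 0 (σ'.nat 15 0 + 1)).nat 15 0 = σ'.nat 15 0 + 1 := by
        simp [State.setNat_nat]
      rw [h15, List.mem_append, List.mem_singleton, h.mem, hmem]
      constructor
      · rintro (h1 | rfl)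
        · exact ⟨h1.1, Or.inl h1.2⟩
        · exact ⟨hchild.mpr hp, Or.inr rfl⟩
      · rintro ⟨h1, h2 | h2⟩
        · exact Or.inl ⟨h1, h2⟩
        · exact Or.inr h2
    · rw [h8, List.length_append, List.length_singleton, List.range'_concat, List.map_append,
        List.map_append, ← h.queue]
      congr 1
      · refine List.map_congr_left fun j hj => Function.update_of_ne ?_ _ _
        simp only [List.mem_range'_1] at hj
        omega
      · simp
  · have hrun : collectCmd.run env σ' = σ'.setNat 15 0 (σ'.nat 15 0 + 1) := by
      rw [collectCmd, Cmd.run, Cmd.run, Cmd.run, if_neg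
        (by simpa [BExp.eval, NExp.eval, hpar, h.node, Fin.ext_iff] using hp)]
      simp [Cmd.run, NExp.eval]
    rw [hrun]
    refine ⟨l, ⟨h.frame.trans (.setNat _ (by simp) _ _), ?_, ?_, h.nodup, ?_, ?_⟩, ?_⟩
    · simp [State.setNat_nat, h.node]
    · simp [State.setNat_nat, h.length]
    · intro x
      rw [h.mem, State.setNat_nat, if_pos rfl, Function.update_self, hmem]
      refine and_congr_right fun hx => (or_iff_left ?_).symm
      rintro rfl
      exact hp (hchild.mp hx)
    · rw [← h.queue, State.setNat_nat, if_neg (by simp)]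
    · simp [State.setNat_nat]

theorem collect_loop {s : T.Node} (hb : Base T env θ δ i M bt σ) (h13 : σ.nat 13 0 = s.val)
    (h14 : σ.nat 14 0 = 0) (h15 : σ.nat 15 0 = s.val + 1) :
    ∃ σ' n, Exec env (.while (.natLt (.var 15) (.get 0 (.lit 0))) collectCmd) σ σ' n ∧
      Frame σ σ' ∧ σ'.nat 13 0 = s.val ∧ ∃ l : List T.Node,
        (l : Multiset T.Node) = (T.children s).val ∧ σ'.nat 14 0 = l.length ∧
        (List.range' 0 l.length).map (σ'.nat 8) = l.map fun c => σ.nat 3 c.val := by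
  let I : State → Prop := fun σ' => (∃ l, Collecting T s σ σ' l) ∧ s.val < σ'.nat 15 0
  have hstep : ∀ σ', I σ' → BExp.eval env σ' (.natLt (.var 15) (.get 0 (.lit 0))) = true →
      ∃ σ'' n, Exec env collectCmd σ' σ'' n ∧ I σ'' ∧
        T.n + 1 - σ''.nat 15 0 < T.n + 1 - σ'.nat 15 0 := by
    rintro σ' ⟨⟨l, hl⟩, hs⟩ hbv
    have hlt : σ'.nat 15 0 < T.n + 1 := by
      simpa [BExp.eval, NExp.eval, hl.frame.nat 0 (by simp), hb.size] using hbv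
    obtain ⟨l', hl', h1⟩ := collectCmd_run hb hl hlt hs
    obtain ⟨n, -, he⟩ := Cmd.exec_run env (c := collectCmd) (by simp [collectCmd, Cmd.LoopFree]) σ'
    exact ⟨_, n, he, ⟨⟨l', hl'⟩, by omega⟩, by omega⟩
  have hinit : I σ := by
    refine ⟨⟨[], Frame.refl σ, h13, h14, by simp, fun x => ?_, by simp⟩, by omega⟩
    simp only [List.not_mem_nil, false_iff, not_and, h15]
    intro hx
    have := GameTree.lt_of_mem_children hx
    simp only [Fin.lt_def] at this
    omega
  obtain ⟨σ', n, he, ⟨⟨l, hl⟩, hs⟩, hf⟩ := Exec.exists_while I _ hstep hinit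
  refine ⟨σ', n, he, hl.frame, hl.node, l, ?_, hl.length, hl.queue⟩
  have hge : T.n + 1 ≤ σ'.nat 15 0 := by
    simpa [BExp.eval, NExp.eval, hl.frame.nat 0 (by simp), hb.size] using hf
  rw [Multiset.Nodup.ext (Multiset.coe_nodup.mpr hl.nodup) (T.children s).nodup]
  intro x
  rw [Multiset.mem_coe, hl.mem, Finset.mem_val]
  exact and_iff_left (x.isLt.trans_le hge)

/-- While the nodes in the queue are merged into the binary tree of `s`, whose children are
`l`. -/
structure Merging (T : GameTree) (env : Env) (θ δ : ℝ) (s : T.Node) (l : List T.Node) (M : ℕ)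
    (bt : ℕ → BT T.Node) (Q : List ℕ) (σ : State) : Prop where
  base : Base T env θ δ (s.val + 1) M bt σ
  roots : Roots T (s.val + 1) M bt (σ.nat 3)
  active : Active T (s.val + 1) M (σ.nat 6) (σ.nat 3) (Waiting T s) Q
  node : σ.nat 13 0 = s.val
  length : σ.nat 14 0 = l.length
  lt : σ.nat 16 0 < l.length
  children : ∀ c ∈ l, s < c
  queue : (List.range' (σ.nat 16 0 + σ.nat 16 0) (l.length - σ.nat 16 0)).map (σ.nat 8) = Q
  merges : ∀ t, BT.Merges (T.isMax s) (Q.map bt) t →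
    BT.Merges (T.isMax s) (l.map fun c => bt (σ.nat 3 c.val)) t

theorem linkCmd_run {q₁ q₂ j : ℕ} (hj : σ.nat 16 0 = j) (h₁ : σ.nat 8 (j + j) = q₁)
    (h₂ : σ.nat 8 (j + j + 1) = q₂) (hM : σ.nat 18 0 = M) :
    let σ₁ := linkCmd.run env σ
    σ₁.nat 12 0 = M ∧ σ₁.nat 4 = Function.update (σ.nat 4) M q₁ ∧
    σ₁.nat 5 = Function.update (σ.nat 5) M q₂ ∧
    σ₁.nat 6 = Function.update (Function.update (σ.nat 6) q₁ M) q₂ M ∧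
    σ₁.nat 7 = Function.update (σ.nat 7) M (σ.nat 2 (σ.nat 13 0)) ∧
    (∀ a, a ∉ [12, 4, 5, 6, 7] → σ₁.nat a = σ.nat a) ∧
    σ₁.real = σ.real ∧ σ₁.log = σ.log ∧ σ₁.out = σ.out := by
  refine ⟨?_, ?_, ?_, ?_, ?_, ?_, rfl, rfl, rfl⟩
  · simp [linkCmd, Cmd.run, NExp.eval, State.setNat_nat, hM]
  · simp [linkCmd, Cmd.run, NExp.eval, State.setNat_nat, hM, hj, h₁]
  · simp [linkCmd, Cmd.run, NExp.eval, State.setNat_nat, hM, hj, h₂]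
  · simp [linkCmd, Cmd.run, NExp.eval, State.setNat_nat, hM, hj, h₁, h₂]
  · simp [linkCmd, Cmd.run, NExp.eval, State.setNat_nat, hM]
  · intro a ha
    simp only [List.mem_cons, List.not_mem_nil, or_false, not_or] at ha
    simp [linkCmd, Cmd.run, State.setNat_nat, ha]

end Build

section Build

variable {T : GameTree} {env : Env} {θ δ : ℝ} {i M : ℕ} {bt : ℕ → BT T.Node} {σ σ' : State}

theorem enqueueCmd_run (σ : State) :
    let σ' := enqueueCmd.run env σ
    σ'.nat 8 = Function.update (σ.nat 8) (σ.nat 14 0 + σ.nat 16 0) (σ.nat 12 0) ∧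
    σ'.nat 18 0 = σ.nat 18 0 + 1 ∧ σ'.nat 16 0 = σ.nat 16 0 + 1 ∧
    (∀ a, a ∉ [8, 16, 18] → σ'.nat a = σ.nat a) ∧
    σ'.real = σ.real ∧ σ'.log = σ.log ∧ σ'.out = σ.out := by
  refine ⟨?_, ?_, ?_, ?_, rfl, rfl, rfl⟩
  · simp [enqueueCmd, Cmd.run, NExp.eval, State.setNat_nat]
  · simp [enqueueCmd, Cmd.run, NExp.eval, State.setNat_nat]
  · simp [enqueueCmd, Cmd.run, NExp.eval, State.setNat_nat]
  · intro a ha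
    simp only [List.mem_cons, List.not_mem_nil, or_false, not_or] at ha
    simp [enqueueCmd, Cmd.run, State.setNat_nat, ha]

theorem Base.merge (h : Base T env θ δ i M bt σ) {s : T.Node} (h13 : σ.nat 13 0 = s.val)
    {q₁ q₂ j : ℕ} (hv₁ : Valid T i M q₁) (hv₂ : Valid T i M q₂) (hu₁ : σ.nat 6 q₁ = 0)
    (hu₂ : σ.nat 6 q₂ = 0) (hj : σ.nat 16 0 = j) (h₁ : σ.nat 8 (j + j) = q₁)
    (h₂ : σ.nat 8 (j + j + 1) = q₂) :
    let σ' := mergeCmd.run env σ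
    Base T env θ δ i (M + 1) (Function.update bt M (.node (T.isMax s) (bt q₁) (bt q₂))) σ' ∧
      σ'.nat 8 = Function.update (σ.nat 8) (σ.nat 14 0 + j) M ∧
      σ'.nat 6 = Function.update (Function.update (σ.nat 6) q₁ M) q₂ M ∧
      σ'.nat 16 0 = j + 1 ∧ ∀ a ∈ [3, 13, 14], σ'.nat a = σ.nat a := by
  rw [show mergeCmd.run env σ = enqueueCmd.run env (updateCmd.run env (linkCmd.run env σ))
    from rfl]
  obtain ⟨a12, a4, a5, a6, a7, aN, aR, aL, aO⟩ := linkCmd_run (env := env) hj h₁ h₂ h.fresh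
  set σ₁ := linkCmd.run env σ
  have w := updateCmd_onlyAt (env := env) a12
  have hlt₁ := hv₁.lt h.shape.le
  have hlt₂ := hv₂.lt h.shape.le
  have hrec := updateCmd_record (env := env) a12 (by simpa [a4] using hlt₁.ne)
    (by simpa [a5] using hlt₂.ne)
  set σ₂ := updateCmd.run env σ₁
  obtain ⟨b8, b18, b16, bN, bR, bL, bO⟩ := enqueueCmd_run (env := env) σ₂
  set σ₃ := enqueueCmd.run env σ₂
  have hrec₁ : σ₁.record = σ.record :=
    State.record_congr aR (aN _ (by simp)) (aN _ (by simp)) (aN _ (by simp))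
  have hrec₃ : σ₃.record = σ₂.record :=
    State.record_congr bR (bN _ (by simp)) (bN _ (by simp)) (bN _ (by simp))
  have hN : ∀ a, a ∉ [8, 16, 18, 9, 10, 11, 12, 4, 5, 6, 7] → σ₃.nat a = σ.nat a := by
    intro a ha
    simp only [List.mem_cons, List.not_mem_nil, or_false, not_or] at ha
    rw [bN a (by simp [ha]), w.nat_eq (by simp [ha]), aN a (by simp [ha])]
  have c4 : σ₃.nat 4 = Function.update (σ.nat 4) M q₁ := by
    rw [bN _ (by simp), w.nat_eq (by simp), a4]
  have c5 : σ₃.nat 5 = Function.update (σ.nat 5) M q₂ := by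
    rw [bN _ (by simp), w.nat_eq (by simp), a5]
  have c6 : σ₃.nat 6 = Function.update (Function.update (σ.nat 6) q₁ M) q₂ M := by
    rw [bN _ (by simp), w.nat_eq (by simp), a6]
  have c7 : σ₃.nat 7 = Function.update (σ.nat 7) M (if T.isMax s then 1 else 0) := by
    rw [bN _ (by simp), w.nat_eq (by simp), a7, h13, h.label]
  have hlog : σ₃.log = σ.log := by rw [bL, w.log, aL]
  refine ⟨⟨?_, ?_, ?_, ?_, ?_, ?_, ?_, ?_, ?_, ?_⟩, ?_, c6, ?_, ?_⟩
  · rw [hN _ (by simp), h.size]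
  · rw [hN _ (by simp)]; exact h.parent
  · rw [hN _ (by simp)]; exact h.label
  · rw [b18, w.nat_eq (by simp), aN _ (by simp), h.fresh]
  · have := h.shape.merge (x := if T.isMax s then 1 else 0) hv₁ hv₂ hu₁ hu₂
    rw [c4, c5, c6, c7]
    convert this using 4
    simp
  · intro v h1 h2
    rw [Joined, hrec₃, c4, c5, c7]
    rcases eq_or_ne v M with rfl | hne
    · rw [hrec, a4, a5, a7, h13, h.label]
      simp only [Function.update_self]
      rw [w.record_eq hlt₁.ne, w.record_eq hlt₂.ne]
    · have h3 : v < M := by omega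
      simp only [Function.update_of_ne hne]
      have h4 := h.shape.ltL v h1 h3
      have h5 := h.shape.ltR v h1 h3
      rw [w.record_eq hne, w.record_eq (by omega), w.record_eq (by omega), hrec₁]
      exact h.joined v h1 h3
  · have d₁ : Data T env θ δ i σ₁ := h.data.congr aR (aN _ (by simp)) (aN _ (by simp))
      (aN _ (by simp)) (aN _ (by simp)) aL
    exact (d₁.update h.shape.le w).congr bR (bN _ (by simp)) (bN _ (by simp))
      (bN _ (by simp)) (bN _ (by simp)) bL
  · rw [hlog]; exact h.nodup
  · rw [hlog]; exact h.mem_log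
  · rw [bO, w.out, aO, h.out]
  · rw [b8]
    simp only [w.nat_eq (a := 8) (by simp), w.nat_eq (a := 14) (by simp),
      w.nat_eq (a := 16) (by simp), w.nat_eq (a := 12) (by simp), aN 8 (by simp), aN 14 (by simp),
      aN 16 (by simp), a12, hj]
  · rw [b16, w.nat_eq (by simp), aN _ (by simp), hj]
  · intro a ha
    refine hN a fun h => ?_
    fin_cases ha <;> simp at h

theorem mergeCmd_run {s : T.Node} {l : List T.Node} {Q : List ℕ}
    (h : Merging T env θ δ s l M bt Q σ) (hlt : σ.nat 16 0 + 1 < l.length) :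
    (∃ M' bt' Q', Merging T env θ δ s l M' bt' Q' (mergeCmd.run env σ)) ∧
      (mergeCmd.run env σ).nat 16 0 = σ.nat 16 0 + 1 := by
  obtain ⟨m, hm⟩ : ∃ m, l.length - σ.nat 16 0 = m + 1 + 1 := ⟨l.length - σ.nat 16 0 - 2, by omega⟩
  have hQ := h.queue
  rw [hm, List.range'_succ, List.range'_succ, List.map_cons, List.map_cons] at hQ
  set j := σ.nat 16 0 with hj
  set q₁ := σ.nat 8 (j + j) with hq₁
  set q₂ := σ.nat 8 (j + j + 1) with hq₂
  set Q₀ := (List.range' (j + j + 1 + 1) m).map (σ.nat 8) with hQ₀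
  have hA := h.active
  rw [← hQ] at hA
  obtain ⟨hv₁, hu₁, -⟩ := hA.queue q₁ (by simp)
  obtain ⟨hv₂, hu₂, -⟩ := hA.queue q₂ (by simp)
  have hv : ∀ v, Valid T (s.val + 1) M v → v ≠ M := fun v hv => (hv.lt h.base.shape.le).ne
  have hQ₀v : ∀ q ∈ Q₀, Valid T (s.val + 1) M q := fun q hq => (hA.queue q (by simp [hq])).1
  obtain ⟨hb, h8, h6, h16, hN⟩ := h.base.merge (env := env) h.node hv₁ hv₂ hu₁ hu₂ hj.symm hq₁.symm
    hq₂.symm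
  have h3 := hN 3 (by simp)
  refine ⟨⟨M + 1, _, Q₀ ++ [M], hb, ?_, ?_, ?_, ?_, ?_, h.children, ?_, fun t ht => ?_⟩, h16⟩
  · rw [h3]
    exact h.roots.mono (Nat.le_succ M) fun v hv' => Function.update_of_ne (hv v hv') _ _
  · rw [h3, h6]
    exact hA.merge h.base.shape
  · rw [hN 13 (by simp), h.node]
  · rw [hN 14 (by simp), h.length]
  · rw [h16]
    exact hlt
  · rw [h16, h8, h.length, show l.length - (j + 1) = m + 1 by omega, List.range'_concat,
      List.map_append, show j + 1 + (j + 1) = j + j + 1 + 1 by omega, hQ₀]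
    congr 1
    · refine List.map_congr_left fun x hx => Function.update_of_ne ?_ _ _
      simp only [List.mem_range'_1] at hx
      omega
    · rw [List.map_singleton, show j + j + 1 + 1 + 1 * m = l.length + j by omega,
        Function.update_self]
  · rw [h3]
    have e1 : (l.map fun c => Function.update bt M (.node (T.isMax s) (bt q₁) (bt q₂))
        (σ.nat 3 c.val)) = l.map fun c => bt (σ.nat 3 c.val) := by
      refine List.map_congr_left fun c hc => Function.update_of_ne (hv _ ?_) _ _
      exact h.roots.valid c (h.children c hc)
    rw [e1]
    refine h.merges t ?_
    rw [← hQ, List.map_cons, List.map_cons]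
    refine .step ?_
    rw [List.map_append, List.map_singleton, Function.update_self] at ht
    rwa [List.map_congr_left (g := bt) fun q hq => Function.update_of_ne (hv q (hQ₀v q hq)) _ _]
      at ht

/-- The game tree nodes `≥ i` have been processed. -/
structure Built (T : GameTree) (env : Env) (θ δ : ℝ) (i M : ℕ) (bt : ℕ → BT T.Node)
    (σ : State) : Prop where
  base : Base T env θ δ i M bt σ
  roots : Roots T i M bt (σ.nat 3)
  active : Active T i M (σ.nat 6) (σ.nat 3) (Pending T i) []

theorem merge_loop {s : T.Node} {l : List T.Node} {Q : List ℕ}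
    (h : Merging T env θ δ s l M bt Q σ) :
    ∃ σ' n, Exec env (.while (.natLt (.add (.var 16) (.lit 1)) (.var 14)) mergeCmd) σ σ' n ∧
      (∃ M' bt' Q', Merging T env θ δ s l M' bt' Q' σ') ∧ σ'.nat 16 0 + 1 = l.length := by
  let I : State → Prop := fun σ' => ∃ M' bt' Q', Merging T env θ δ s l M' bt' Q' σ'
  have hstep : ∀ σ', I σ' →
      BExp.eval env σ' (.natLt (.add (.var 16) (.lit 1)) (.var 14)) = true →
      ∃ σ'' n, Exec env mergeCmd σ' σ'' n ∧ I σ'' ∧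
        l.length - σ''.nat 16 0 < l.length - σ'.nat 16 0 := by
    rintro σ' ⟨M', bt', Q', h'⟩ hbv
    have hlt : σ'.nat 16 0 + 1 < l.length := by simpa [BExp.eval, NExp.eval, h'.length] using hbv
    obtain ⟨h1, h2⟩ := mergeCmd_run h' hlt
    obtain ⟨n, -, he⟩ := Cmd.exec_run env (c := mergeCmd)
      ⟨by simp [linkCmd, Cmd.LoopFree], updateCmd_writesAt.loopFree,
        by simp [enqueueCmd, Cmd.LoopFree]⟩ σ'
    exact ⟨_, n, he, h1, by omega⟩
  obtain ⟨σ', n, he, ⟨M', bt', Q', h'⟩, hf⟩ := Exec.exists_while I _ hstep ⟨M, bt, Q, h⟩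
  refine ⟨σ', n, he, ⟨M', bt', Q', h'⟩, ?_⟩
  have h1 : l.length ≤ σ'.nat 16 0 + 1 := by
    simpa [BExp.eval, NExp.eval, h'.length] using hf
  have := h'.lt
  omega

theorem Merging.built {s : T.Node} {l : List T.Node} {Q : List ℕ}
    (h : Merging T env θ δ s l M bt Q σ) (hl : (l : Multiset T.Node) = (T.children s).val)
    (hs : T.children s ≠ ∅) (hlen : σ.nat 16 0 + 1 = l.length) :
    Built T env θ δ s.val M bt
      (σ.setNat 3 s.val (σ.nat 8 (σ.nat 14 0 + σ.nat 16 0 - 1))) := by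
  have hQ := h.queue
  have hs' : s ∉ T.leaves := by simpa [GameTree.mem_leaves] using hs
  have hi := succ_le_iff_of_notMem_leaves hs'
  rw [show l.length - σ.nat 16 0 = 1 by omega, List.range'_one, List.map_singleton,
    show σ.nat 16 0 + σ.nat 16 0 = σ.nat 14 0 + σ.nat 16 0 - 1 by rw [h.length]; omega] at hQ
  set q := σ.nat 8 (σ.nat 14 0 + σ.nat 16 0 - 1)
  have h3 : (σ.setNat 3 s.val q).nat 3 = Function.update (σ.nat 3) s.val q := by
    rw [State.setNat_nat, if_pos rfl]
  have hA := h.active.congr hi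
  rw [← hQ] at hA
  refine ⟨(h.base.of_notMem_leaves hs').setRoot _ _, ?_, ?_⟩
  · rw [h3]
    refine h.roots.add (fun v hv => by rwa [valid_congr hi]) (hA.queue q (by simp)).1
      (fun h => absurd h hs) fun _ => ⟨l, hl, h.merges _ ?_⟩
    rw [← hQ]
    exact .single _
  · rw [h3, State.setNat_nat, if_neg (by simp)]
    refine hA.ofQueue (fun h => absurd h.1 (lt_irrefl s)) fun c => pending_iff s c

theorem Built.exec_nodeCmd {s : T.Node} (h : Built T env θ δ (s.val + 1) M bt σ)
    (h13 : σ.nat 13 0 = s.val + 1) :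
    ∃ σ' n, Exec env nodeCmd σ σ' n ∧ (∃ M' bt', Built T env θ δ s.val M' bt' σ') ∧
      σ'.nat 13 0 = s.val := by
  obtain ⟨σ₁, hσ₁⟩ : ∃ σ₁, σ₁ = ((σ.setNat 13 0 s.val).setNat 14 0 0).setNat 15 0 (s.val + 1) :=
    ⟨_, rfl⟩
  have f₁ : Frame σ σ₁ := by
    rw [hσ₁]
    exact ((Frame.setNat _ (by simp) _ _).trans (.setNat _ (by simp) _ _)).trans
      (.setNat _ (by simp) _ _)
  obtain ⟨n₁, -, e₁⟩ := Cmd.exec_run env (c := .seq (.setNat 13 (.lit 0) (.sub (.var 13) (.lit 1)))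
    (.seq (.setNat 14 (.lit 0) (.lit 0)) (.setNat 15 (.lit 0) (.add (.var 13) (.lit 1)))))
    (by simp [Cmd.LoopFree]) σ
  rw [show Cmd.run env _ σ = σ₁ by
    rw [hσ₁]; simp [Cmd.run, NExp.eval, State.setNat_nat, h13]] at e₁
  obtain ⟨σ₂, n₂, e₂, f₂, g₂, l, hl, hlen, hq⟩ := collect_loop (s := s) (h.base.frame f₁)
    (by simp [hσ₁, State.setNat_nat]) (by simp [hσ₁, State.setNat_nat])
    (by simp [hσ₁, State.setNat_nat])
  have f := f₁.trans f₂
  have h3 : σ₂.nat 3 = σ.nat 3 := f.nat _ (by simp)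
  have h6 : σ₂.nat 6 = σ.nat 6 := f.nat _ (by simp)
  rw [f₁.nat 3 (by simp)] at hq
  have hmem : ∀ c, c ∈ l ↔ c ∈ T.children s := fun c => by
    rw [← Finset.mem_val, ← hl, Multiset.mem_coe]
  have hnd : l.Nodup := by
    rw [← Multiset.coe_nodup, hl]
    exact (T.children s).nodup
  have hlt : ∀ c ∈ l, s < c := fun c hc => GameTree.lt_of_mem_children ((hmem c).mp hc)
  by_cases hs : T.children s = ∅
  · have hs' : s ∈ T.leaves := by simpa [GameTree.mem_leaves] using hs
    have hl0 : l = [] := List.eq_nil_iff_forall_not_mem.mpr fun c hc => by simp [hmem, hs] at hc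
    have f₃ : Frame σ₂ (σ₂.setNat 12 0 s.val) := .setNat _ (by simp) _ _
    have hd := drawCmd_run (env := env) (σ := σ₂.setNat 12 0 s.val) (v := s.val)
      (by simp [State.setNat_nat])
    obtain ⟨n₃, -, e₃⟩ := Cmd.exec_run env (c := .seq (.setNat 12 (.lit 0) (.var 13))
      (.seq drawCmd (.setNat 3 (.var 13) (.var 13))))
      (by simp [Cmd.LoopFree, drawCmd_loopFree]) σ₂
    set σ₄ := drawCmd.run env (σ₂.setNat 12 0 s.val) with hσ₄
    have h13' : σ₄.nat 13 0 = s.val := by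
      rw [hd.nat _ (by simp) (by simp) (by simp) (by simp), State.setNat_nat, if_neg (by simp), g₂]
    rw [show Cmd.run env _ σ₂ = σ₄.setNat 3 s.val s.val by
      simp only [Cmd.run, NExp.eval, g₂]
      rw [← hσ₄, h13']] at e₃
    have g3 : σ₄.nat 3 = σ.nat 3 := by
      rw [hd.nat _ (by simp) (by simp) (by simp) (by simp), State.setNat_nat, if_neg (by simp), h3]
    have g6 : σ₄.nat 6 = σ.nat 6 := by
      rw [hd.nat _ (by simp) (by simp) (by simp) (by simp), State.setNat_nat, if_neg (by simp), h6]
    have hV : ∀ v, Valid T (s.val + 1) M v → Valid T s.val M v := fun v hv =>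
      (valid_leaf_iff hs').mpr (Or.inr hv)
    have hself : Valid T s.val M s.val := (valid_leaf_iff hs').mpr (Or.inl rfl)
    have hne : ∀ v, Valid T (s.val + 1) M v → v ≠ s.val := by
      rintro v (⟨l, -, h1, rfl⟩ | h1)
      · omega
      · have := s.isLt
        omega
    have hwait : ∀ c, Pending T (s.val + 1) c ↔ Waiting T s c := fun c => by
      rw [pending_succ_iff, hs]
      simp
    refine ⟨_, _, .seq e₁ (.seq e₂ (.iteTrue (by simp [BExp.eval, NExp.eval, hlen, hl0]) e₃)),
      ⟨M, Function.update bt s.val (.leaf s), ?_, ?_, ?_⟩, ?_⟩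
    · exact (((h.base.frame f).frame f₃).drawLeaf hs' hd).setRoot _ _
    · rw [State.setNat_nat, if_pos rfl, g3]
      refine (h.roots.mono le_rfl fun v hv => Function.update_of_ne (hne v hv) _ _).add hV hself
        (fun _ => by simp) fun h => absurd hs h
    · have hA := h.active.addLeaf hs' h.base.shape
      rw [State.setNat_nat σ₄ 3 s.val s.val 6, if_neg (by simp), State.setNat_nat, if_pos rfl, g3,
        g6]
      refine hA.ofQueue (s := s) (P' := Pending T (s.val + 1)) (fun h => ?_) fun c => ?_
      · exact absurd h.1 (by simp)
      · rw [pending_iff, hwait]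
    · rw [State.setNat_nat, if_neg (by simp), h13']
  · have hlpos : 0 < l.length := by
      refine List.length_pos_iff.mpr fun h0 => hs (Finset.eq_empty_of_forall_notMem fun c hc => ?_)
      simpa [h0] using (hmem c).mpr hc
    have f₃ : Frame σ₂ (σ₂.setNat 16 0 0) := .setNat _ (by simp) _ _
    set σ₃ := σ₂.setNat 16 0 0 with hσ₃
    have h3' : σ₃.nat 3 = σ.nat 3 := (f.trans f₃).nat 3 (by simp)
    have h6' : σ₃.nat 6 = σ.nat 6 := (f.trans f₃).nat 6 (by simp)
    have h16' : σ₃.nat 16 0 = 0 := by simp [hσ₃, State.setNat_nat]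
    have hM : Merging T env θ δ s l M bt (l.map fun c => σ.nat 3 c.val) σ₃ := by
      refine ⟨(h.base.frame f).frame f₃, ?_, ?_, ?_, ?_, ?_, hlt, ?_, fun t ht => ?_⟩
      · rw [h3']; exact h.roots
      · rw [h3', h6']
        refine h.active.toQueue hnd (fun c => by rw [pending_succ_iff, hmem]) fun c hc hcl => ?_
        exact absurd ((GameTree.mem_children.mp ((hmem c).mp hcl)).2) hc.2.ne
      · simp [hσ₃, State.setNat_nat, g₂]
      · simp [hσ₃, State.setNat_nat, hlen]
      · rw [h16']; exact hlpos
      · rw [h16']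
        simpa [hσ₃, State.setNat_nat] using hq
      · rw [h3']
        simpa [List.map_map, Function.comp_def] using ht
    obtain ⟨σ₄, n₄, e₄, ⟨M', bt', Q', hM'⟩, hj⟩ := merge_loop hM
    refine ⟨_, _, .seq e₁ (.seq e₂ (.iteFalse
      (by simpa [BExp.eval, NExp.eval, hlen] using List.length_pos_iff.mp hlpos)
      (.seq (.setNat _ _ _ _) (.seq e₄ (.setNat _ _ _ _))))), ⟨M', bt', ?_⟩, ?_⟩
    · have := hM'.built hl hs hj
      simpa [NExp.eval, hM'.node] using this
    · rw [State.setNat_nat, if_neg (by simp), hM'.node]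

theorem exec_initCmd (T : GameTree) (env : Env) (θ δ : ℝ) :
    ∃ σ n, Exec env initCmd (input T θ δ) σ n ∧ ∃ M bt, Built T env θ δ 0 M bt σ := by
  obtain ⟨n₁, -, e₁⟩ := Cmd.exec_run env (c := .seq (.setNat 18 (.lit 0) (.get 0 (.lit 0)))
    (.setNat 13 (.lit 0) (.get 0 (.lit 0)))) (by simp [Cmd.LoopFree]) (input T θ δ)
  have h0 : (input T θ δ).nat 0 0 = T.n + 1 := by simp [input]
  rw [show Cmd.run env _ (input T θ δ) =
    ((input T θ δ).setNat 18 0 (T.n + 1)).setNat 13 0 (T.n + 1) by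
      simp [Cmd.run, NExp.eval, State.setNat_nat, h0]] at e₁
  set σ := ((input T θ δ).setNat 18 0 (T.n + 1)).setNat 13 0 (T.n + 1) with hσ
  have hnat : ∀ a, a ≠ 18 → a ≠ 13 → σ.nat a = (input T θ δ).nat a := fun a h1 h2 => by
    simp [hσ, State.setNat_nat, h1, h2]
  have hreal : σ.real = (input T θ δ).real := rfl
  have hlog : σ.log = [] := rfl
  have hzero : ∀ a v, 3 ≤ a → (input T θ δ).nat a v = 0 := fun a v ha => by
    simp [input, show a ≠ 0 by omega, show a ≠ 1 by omega, show a ≠ 2 by omega]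
  have hzero' : ∀ a v, 0 < a → (input T θ δ).real a v = 0 := fun a v ha => by
    simp [input, ha.ne']
  have hV : ∀ v, ¬Valid T (T.n + 1) (T.n + 1) v := by
    rintro v (⟨l, -, h1, -⟩ | h1)
    · exact absurd l.isLt (not_lt.mpr h1)
    · omega
  have hlt : ∀ s : T.Node, ¬T.n + 1 ≤ s.val := fun s => not_le.mpr s.isLt
  have hbuilt : Built T env θ δ (T.n + 1) (T.n + 1) (fun _ => .leaf 0) σ := by
    refine ⟨⟨?_, fun s => ?_, fun s => ?_, ?_, ?_, fun v _ _ => by omega, ?_, ?_, ?_, rfl⟩, ?_, ?_⟩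
    · rw [hnat 0 (by simp) (by simp), h0]
    · rw [hnat 1 (by simp) (by simp)]
      simp [input, s.is_le]
    · rw [hnat 2 (by simp) (by simp)]
      simp [input, s.is_le]
    · simp [hσ, State.setNat_nat]
    · refine ⟨le_rfl, fun v _ _ => by omega, fun v _ _ => by omega, fun v _ _ => by omega,
        fun v _ _ => by omega, fun v _ _ => by omega, fun v _ _ => by omega, fun v _ _ => by omega,
        fun v hv => absurd ?_ hv, fun l _ hl => absurd hl (hlt l)⟩
      rw [hnat 6 (by simp) (by simp), hzero 6 v (by simp)]
    · refine ⟨by simp [hreal, input], by simp [hreal, input], ?_, fun l => ?_, fun l => ?_,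
        fun l _ hl => absurd hl (hlt l)⟩
      · rw [hnat 17 (by simp) (by simp), hzero 17 0 (by simp), hlog]
        rfl
      · rw [hreal, hzero' 2 _ (by simp), hlog]
        simp [rewardSum]
      · rw [hreal, hzero' 11 _ (by simp), hlog]
        simp
    · rw [hlog]
      simp
    · intro x
      rw [hlog]
      simp only [List.not_mem_nil, false_iff, not_exists, not_and]
      exact fun l _ hl => absurd hl (hlt l)
    · exact ⟨fun s hs => absurd hs (hlt s), fun s hs => absurd hs (hlt s),
        fun s hs => absurd hs (hlt s)⟩
    · exact ⟨by simp, by simp, fun c hc => absurd hc.1 (hlt c),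
        fun c _ hc => absurd hc.1 (hlt c), fun v hv => absurd hv (hV v)⟩
  let I : State → Prop := fun σ => σ.nat 13 0 ≤ T.n + 1 ∧ ∃ M bt,
    Built T env θ δ (σ.nat 13 0) M bt σ
  have hstep : ∀ σ, I σ → BExp.eval env σ (.natLt (.lit 0) (.var 13)) = true →
      ∃ σ' n, Exec env nodeCmd σ σ' n ∧ I σ' ∧ σ'.nat 13 0 < σ.nat 13 0 := by
    rintro σ ⟨hle, M, bt, h⟩ hbv
    have hpos : 0 < σ.nat 13 0 := of_decide_eq_true hbv
    obtain ⟨s, hs⟩ : ∃ s : T.Node, σ.nat 13 0 = s.val + 1 :=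
      ⟨⟨σ.nat 13 0 - 1, by omega⟩, by simp only; omega⟩
    rw [hs] at h
    obtain ⟨σ', n, he, ⟨M', bt', h'⟩, hs'⟩ := h.exec_nodeCmd hs
    exact ⟨σ', n, he, ⟨by omega, M', bt', hs' ▸ h'⟩, by omega⟩
  have h13 : σ.nat 13 0 = T.n + 1 := by simp [hσ, State.setNat_nat]
  obtain ⟨σ', n, he, ⟨-, M, bt, h⟩, hf⟩ := Exec.exists_while I _ hstep (σ := σ)
    ⟨h13.le, _, _, by rw [h13]; exact hbuilt⟩
  have h0' : σ'.nat 13 0 = 0 := Nat.eq_zero_of_not_pos (of_decide_eq_false hf)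
  exact ⟨σ', _, .seq e₁ he, M, bt, h0' ▸ h⟩

end Build

/-! ### The rounds -/

/-- The root of the binary tree of the whole game tree. -/
abbrev NExp.root : NExp := .get 3 (.lit 0)

/-- Make the leaf to be drawn the current node. -/
noncomputable def selectCmd : Cmd :=
  .ite (.realLt (.get 11 .root)
      (.sub (.sqrt (.add (.ofNat (.var 17)) (.lit 1))) (.div (.get 9 .root) (.lit 2))))
    (.setNat 12 (.lit 0) (.get 11 .root))
    (.ite (.realEq (.get 6 .root) (.lit 0))
      (.setNat 12 (.lit 0) (.get 9 .root)) (.setNat 12 (.lit 0) (.get 10 .root)))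

def parentCmd : Cmd := .setNat 12 (.lit 0) (.get 6 .cur)

/-- Update the statistics of the proper ancestors of the current node. -/
def climbCmd : Cmd := .seq parentCmd (.while (.natLt (.lit 0) .cur) (.seq updateCmd parentCmd))

/-- The argument of `hTilde` in `Cexp (log (1 / δ) / cnt)`. -/
noncomputable def RExp.threshArg : RExp :=
  .div (.add (.hInv (.add (.lit 1) (.div (.log (.div (.lit 1) (.get 0 (.lit 1)))) (.get 9 .root))))
    (.lit (Real.log (Real.pi ^ 2 / 3)))) (.lit 2)

/-- The threshold, for the value `x` of `hTilde`. -/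
noncomputable def RExp.thresh (x : RExp) : RExp :=
  .add (.mul (.lit 3) (.get 10 .root)) (.mul (.get 9 .root) (.mul (.lit 2) x))

/-- Return the answer if the statistic reaches the threshold `x`. -/
noncomputable def answerCmd (x : RExp) : Cmd :=
  .ite (.realEq (.get 6 .root) (.lit 0))
    (.ite (.realLt (.get 4 .root) x) .skip (.ret (.natEq (.lit 0) (.lit 0))))
    (.ite (.realLt (.get 7 .root) x) .skip (.ret (.not (.natEq (.lit 0) (.lit 0)))))

noncomputable def stopCmd : Cmd :=
  .ite (.realLt .threshArg (.lit (hFun (1 / Real.log (3 / 2)))))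
    (answerCmd (.thresh (.mul (.lit (3 / 2)) (.sub .threshArg (.lit (Real.log (Real.log (3 / 2))))))))
    (answerCmd (.thresh (.mul (.exp (.div (.lit 1) (.hInv .threshArg))) (.hInv .threshArg))))

noncomputable def roundCmd : Cmd := .seq selectCmd (.seq drawCmd (.seq climbCmd stopCmd))

/-- A bound for the time of a round, divided by the height of the binary tree plus `1`. -/
noncomputable def roundCost : ℕ :=
  selectCmd.maxCost + drawCmd.maxCost + parentCmd.maxCost + stopCmd.maxCost +
    2 * (1 + (BExp.natLt (.lit 0) .cur).cost + (Cmd.seq updateCmd parentCmd).maxCost)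

section Round

variable {T : GameTree} {env : Env} {θ δ : ℝ} {i M c : ℕ} {bt : ℕ → BT T.Node} {σ σ' : State}

/-- The invariant of the rounds, where at the binary node `c` the statistics may be outdated. -/
structure Inv (T : GameTree) (env : Env) (θ δ : ℝ) (M : ℕ) (bt : ℕ → BT T.Node) (c : ℕ)
    (σ : State) : Prop where
  shape : Shape T 0 M bt (σ.nat 4) (σ.nat 5) (σ.nat 6) (σ.nat 7)
  joined : ∀ v, T.n + 1 ≤ v → v < M → v ≠ c → Joined σ v
  roots : Roots T 0 M bt (σ.nat 3)
  root : ∀ v, Valid T 0 M v → σ.nat 6 v = 0 → v = σ.nat 3 0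
  data : Data T env θ δ 0 σ
  mem_log : ∀ l ∈ T.leaves, l.val ∈ σ.log

theorem Built.inv (h : Built T env θ δ 0 M bt σ) : Inv T env θ δ M bt 0 σ := by
  refine ⟨h.base.shape, fun v h1 h2 _ => h.base.joined v h1 h2, h.roots, fun v hv hv0 => ?_,
    h.base.data, fun l hl => (h.base.mem_log _).mpr ⟨l, hl, Nat.zero_le _, rfl⟩⟩
  obtain ⟨c, hc, rfl⟩ := (h.active.cover v hv hv0).resolve_left (by simp)
  rcases hc.2 with rfl | hc
  · rfl
  · exact absurd hc (Nat.not_lt_zero _)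

namespace Inv

theorem congr (h : Inv T env θ δ M bt c σ) (hnat : ∀ a, a ≠ 12 → σ'.nat a = σ.nat a)
    (hreal : σ'.real = σ.real) (hlog : σ'.log = σ.log) : Inv T env θ δ M bt c σ' := by
  have h3 := hnat 3 (by simp)
  have h4 := hnat 4 (by simp)
  have h5 := hnat 5 (by simp)
  have h6 := hnat 6 (by simp)
  have h7 := hnat 7 (by simp)
  have hrec := State.record_congr hreal (hnat 9 (by simp)) (hnat 10 (by simp)) (hnat 11 (by simp))
  refine ⟨?_, ?_, ?_, ?_, ?_, ?_⟩
  · rw [h4, h5, h6, h7]; exact h.shape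
  · simp only [Joined, hrec, h4, h5, h7]; exact h.joined
  · rw [h3]; exact h.roots
  · rw [h3, h6]; exact h.root
  · exact h.data.congr hreal (hnat 9 (by simp)) (hnat 10 (by simp)) (hnat 11 (by simp))
      (hnat 17 (by simp)) hlog
  · rw [hlog]; exact h.mem_log

theorem draw (h : Inv T env θ δ M bt 0 σ) {s : T.Node} (hd : Draws env s.val σ σ') :
    Inv T env θ δ M bt (σ.nat 6 s.val) σ' := by
  have h3 := hd.nat 3 (by simp) (by simp) (by simp) (by simp)
  have h4 := hd.nat 4 (by simp) (by simp) (by simp) (by simp)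
  have h5 := hd.nat 5 (by simp) (by simp) (by simp) (by simp)
  have h6 := hd.nat 6 (by simp) (by simp) (by simp) (by simp)
  have h7 := hd.nat 7 (by simp) (by simp) (by simp) (by simp)
  have hs := s.isLt
  refine ⟨?_, fun v h1 h2 hv => ?_, ?_, ?_, ?_, fun l hl => ?_⟩
  · rw [h4, h5, h6, h7]; exact h.shape
  · have hL : σ.nat 4 v ≠ s.val := fun heq => hv (by rw [← heq, h.shape.upL v h1 h2])
    have hR : σ.nat 5 v ≠ s.val := fun heq => hv (by rw [← heq, h.shape.upR v h1 h2])
    rw [Joined, h4, h5, h7, hd.record_ne v (by omega), hd.record_ne _ hL, hd.record_ne _ hR]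
    exact h.joined v h1 h2 (by omega)
  · rw [h3]; exact h.roots
  · rw [h3, h6]; exact h.root
  · exact h.data.draw hd fun l _ _ => Or.inr (Nat.zero_le _)
  · rw [hd.log]
    exact List.mem_append_left _ (h.mem_log l hl)

theorem update (h : Inv T env θ δ M bt c σ) (hc : σ.nat 12 0 = c) (h1 : T.n + 1 ≤ c)
    (h2 : c < M) : Inv T env θ δ M bt (σ.nat 6 c) (updateCmd.run env σ) := by
  have w := updateCmd_onlyAt (env := env) hc
  have hrec := updateCmd_record (env := env) hc (h.shape.ltL c h1 h2).ne (h.shape.ltR c h1 h2).ne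
  set σ' := updateCmd.run env σ
  have hn : ∀ a, a ∉ [9, 10, 11] → σ'.nat a = σ.nat a := fun a ha => w.nat_eq ha
  have h3 := hn 3 (by simp)
  have h4 := hn 4 (by simp)
  have h5 := hn 5 (by simp)
  have h6 := hn 6 (by simp)
  have h7 := hn 7 (by simp)
  refine ⟨?_, fun v hv1 hv2 hv => ?_, ?_, ?_, h.data.update h1 w, ?_⟩
  · rw [h4, h5, h6, h7]; exact h.shape
  · rw [Joined, h4, h5, h7]
    have hL : σ.nat 4 v ≠ c := fun heq => hv (by rw [← heq, h.shape.upL v hv1 hv2])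
    have hR : σ.nat 5 v ≠ c := fun heq => hv (by rw [← heq, h.shape.upR v hv1 hv2])
    rw [w.record_eq hL, w.record_eq hR]
    rcases eq_or_ne v c with rfl | hne
    · exact hrec
    · rw [w.record_eq hne]
      exact h.joined v hv1 hv2 hne
  · rw [h3]; exact h.roots
  · rw [h3, h6]; exact h.root
  · rw [w.log]; exact h.mem_log

theorem record_eq_fold (h : Inv T env θ δ M bt 0 σ) {v : ℕ} (hv : Valid T 0 M v) :
    σ.record v = (bt v).fold fun l => leafRec env.kl θ (σ.log.count l.val)
      (empMean T env.reward σ.log l) l.val := by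
  induction v using Nat.strong_induction_on with
  | _ v ih =>
    rcases hv with ⟨l, hl, -, rfl⟩ | ⟨h1, h2⟩
    · rw [h.shape.leaf l hl (Nat.zero_le _), h.data.leaf l hl (Nat.zero_le _)]
      rfl
    · rw [h.joined v h1 h2 (by omega), h.shape.node v h1 h2,
        ih _ (h.shape.ltL v h1 h2) (h.shape.validL v h1 h2),
        ih _ (h.shape.ltR v h1 h2) (h.shape.validR v h1 h2)]
      rfl

theorem height_le (h : Inv T env θ δ M bt c σ) {v : ℕ} (hv : Valid T 0 M v) :
    (bt v).height ≤ (bt (σ.nat 3 0)).height := by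
  induction hm : M - v using Nat.strong_induction_on generalizing v with
  | _ m ih =>
    by_cases h0 : σ.nat 6 v = 0
    · rw [h.root v hv h0]
    · obtain ⟨h1, h2, -⟩ := h.shape.up v h0
      have h3 := h.shape.lt_up h0
      exact (h.shape.height_lt_up h0).le.trans (ih _ (by omega) (Or.inr ⟨h1, h2⟩) rfl)

theorem exec_climb (h : Inv T env θ δ M bt c σ) (hc : σ.nat 12 0 = c)
    (hv : c ≠ 0 → T.n + 1 ≤ c ∧ c < M) :
    ∃ σ', ∃ n ≤ ((bt (σ.nat 3 0)).height + 2) *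
        (1 + (BExp.natLt (.lit 0) .cur).cost + (Cmd.seq updateCmd parentCmd).maxCost),
      Exec env (.while (.natLt (.lit 0) .cur) (.seq updateCmd parentCmd)) σ σ' n ∧
        Inv T env θ δ M bt 0 σ' ∧ σ'.nat 3 = σ.nat 3 ∧ σ'.log = σ.log ∧ σ'.out = σ.out := by
  set H := (bt (σ.nat 3 0)).height
  let I : State → Prop := fun σ' => Inv T env θ δ M bt (σ'.nat 12 0) σ' ∧
    (σ'.nat 12 0 ≠ 0 → T.n + 1 ≤ σ'.nat 12 0 ∧ σ'.nat 12 0 < M) ∧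
    σ'.nat 3 = σ.nat 3 ∧ σ'.log = σ.log ∧ σ'.out = σ.out
  let meas : State → ℕ := fun σ' =>
    if σ'.nat 12 0 = 0 then 0 else H + 1 - (bt (σ'.nat 12 0)).height
  have hstep : ∀ σ', I σ' → BExp.eval env σ' (.natLt (.lit 0) .cur) = true →
      ∃ σ'', ∃ n ≤ (Cmd.seq updateCmd parentCmd).maxCost,
        Exec env (.seq updateCmd parentCmd) σ' σ'' n ∧ I σ'' ∧ meas σ'' < meas σ' := by
    rintro σ' ⟨h1, h2, h3, h4, h5⟩ hb
    have hpos : σ'.nat 12 0 ≠ 0 := Nat.pos_iff_ne_zero.mp (of_decide_eq_true hb)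
    obtain ⟨h6, h7⟩ := h2 hpos
    obtain ⟨n, hn, he⟩ := Cmd.exec_run env (c := .seq updateCmd parentCmd)
      ⟨updateCmd_writesAt.loopFree, trivial⟩ σ'
    have w := updateCmd_onlyAt (env := env) (σ := σ') rfl
    have hu := h1.update (env := env) rfl h6 h7
    have hrun : (Cmd.seq updateCmd parentCmd).run env σ' =
        (updateCmd.run env σ').setNat 12 0 (σ'.nat 6 (σ'.nat 12 0)) := by
      simp [Cmd.run, parentCmd, NExp.eval, w.nat_eq]
    rw [hrun] at he
    set σ'' := (updateCmd.run env σ').setNat 12 0 (σ'.nat 6 (σ'.nat 12 0)) with hσ''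
    have h12 : σ''.nat 12 0 = σ'.nat 6 (σ'.nat 12 0) := by simp [hσ'', State.setNat_nat]
    have hn' : ∀ a, a ≠ 12 → σ''.nat a = (updateCmd.run env σ').nat a := fun a ha => by
      rw [hσ'', State.setNat_nat, if_neg ha]
    refine ⟨σ'', n, hn, he, ⟨?_, fun h0 => ?_, ?_, ?_, ?_⟩, ?_⟩
    · rw [h12]
      exact hu.congr hn' rfl rfl
    · rw [h12] at h0 ⊢
      obtain ⟨h8, h9, -⟩ := h1.shape.up _ h0
      exact ⟨h8, h9⟩
    · rw [hn' 3 (by simp), w.nat_eq (by simp), h3]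
    · rw [← h4, ← w.log]
      rfl
    · rw [← h5, ← w.out]
      rfl
    · have h8 := h1.height_le (Or.inr ⟨h6, h7⟩)
      rw [h3] at h8
      simp only [meas]
      rw [h12, if_neg hpos]
      split_ifs with h0
      · omega
      · have := h1.shape.height_lt_up h0
        omega
  obtain ⟨σ', n, hn, he, ⟨h1, -, h3, h4, h5⟩, hf⟩ := Exec.exists_while_le I meas _ hstep (σ := σ)
    ⟨hc ▸ h, hc ▸ hv, rfl, rfl, rfl⟩
  have h0 : σ'.nat 12 0 = 0 := Nat.eq_zero_of_not_pos (of_decide_eq_false hf)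
  refine ⟨σ', n, hn.trans (Nat.mul_le_mul_right _ ?_), he, h0 ▸ h1, h3, h4, h5⟩
  have : meas σ ≤ H + 1 := by
    simp only [meas]
    split_ifs <;> omega
  omega

end Inv

theorem BExp.eval_realEq {x y : RExp} :
    (BExp.realEq x y).eval env σ = true ↔ x.eval env σ = y.eval env σ := by
  simp [BExp.eval]

theorem BExp.eval_realLt {x y : RExp} :
    (BExp.realLt x y).eval env σ = true ↔ x.eval env σ < y.eval env σ := by
  simp [BExp.eval]

theorem selectCmd_run (env : Env) (σ : State) : selectCmd.run env σ =
    σ.setNat 12 0 (nextLeaf (σ.record (σ.nat 3 0)) (σ.nat 17 0)) := by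
  simp only [selectCmd, Cmd.run, BExp.eval_realLt, BExp.eval_realEq]
  simp only [nextLeaf, State.record, RExp.eval, NExp.eval, cond_true, cond_false]
  by_cases h1 : σ.real 11 (σ.nat 3 0) < √((σ.nat 17 0 : ℝ) + 1) - σ.real 9 (σ.nat 3 0) / 2
  · simp [h1]
  · by_cases h2 : σ.real 6 (σ.nat 3 0) = 0 <;> simp [h1, h2]

theorem answerCmd_run (x : RExp) : (answerCmd x).run env σ =
    let R := σ.record (σ.nat 3 0)
    let dir : Bool := decide ((R.agg false).f = 0)
    if (R.agg dir).g < x.eval env σ then σ else { σ with out := some dir } := by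
  simp only [answerCmd, Cmd.run, BExp.eval_realLt, BExp.eval_realEq]
  simp only [BExp.eval, RExp.eval, NExp.eval, State.record, cond_false]
  by_cases h0 : σ.real 6 (σ.nat 3 0) = 0 <;> simp [h0]

theorem stopCmd_run (hδ : σ.real 0 1 = δ) : stopCmd.run env σ =
    let R := σ.record (σ.nat 3 0)
    let dir : Bool := decide ((R.agg false).f = 0)
    if (R.agg dir).g < 3 * R.lsum + R.cnt * Cexp (Real.log (1 / δ) / R.cnt) then σ
    else { σ with out := some dir } := by
  have hX : RExp.threshArg.eval env σ =
      (hInv (1 + Real.log (1 / δ) / (σ.record (σ.nat 3 0)).cnt) + Real.log (Real.pi ^ 2 / 3)) / 2 := by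
    simp [RExp.threshArg, RExp.eval, NExp.eval, hδ, State.record]
  have hB : ∀ x : RExp, (RExp.thresh x).eval env σ = 3 * (σ.record (σ.nat 3 0)).lsum +
      (σ.record (σ.nat 3 0)).cnt * (2 * x.eval env σ) := fun x => rfl
  rw [stopCmd, Cmd.run, answerCmd_run, answerCmd_run, hB, hB]
  simp only [BExp.eval_realLt, Cexp, hTilde, ← hX]
  by_cases hlt : RExp.threshArg.eval env σ < hFun (1 / Real.log (3 / 2))
  · simp only [if_neg (not_le.mpr hlt)]
    exact if_pos hlt
  · simp only [if_pos (not_lt.mp hlt)]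
    exact if_neg hlt

end Round

section Main

variable {T : GameTree} {E : ExpFamily} {θ δ : ℝ} {r : ℕ → ℝ} {M : ℕ} {bt : ℕ → BT T.Node}
  {σ : State}

/-- The environment of an instance. -/
noncomputable abbrev envOf (E : ExpFamily) (θ : ℝ) (r : ℕ → ℝ) : Env :=
  ⟨fun x => (E.d x θ).toReal, r⟩

theorem Inv.record_root (h : Inv T (envOf E θ r) θ δ M bt 0 σ) :
    σ.record (σ.nat 3 0) = rootRec E θ (fun s => bt (σ.nat 3 s.val)) r σ.log :=
  h.record_eq_fold (h.roots.valid 0 (Nat.zero_le _))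

/-- A round is performed correctly, in time proportional to the height of the binary tree. -/
theorem Inv.exec_roundCmd (h : Inv T (envOf E θ r) θ δ M bt 0 σ) (hθ : θ ∈ interior E.X)
    (hr : ∀ k, r k ∈ E.X) (hout : σ.out = none) {e : ℕ} (he : T.maxBranching ≤ 2 ^ e) :
    ∃ σ', ∃ n ≤ roundCost * (T.depth * e + 1), Exec (envOf E θ r) roundCmd σ σ' n ∧
      CorrectRound E T θ δ r σ σ' ∧ Inv T (envOf E θ r) θ δ M bt 0 σ' := by
  have hcount : ∀ log : List ℕ, (∀ l ∈ T.leaves, l.val ∈ log) →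
      ∀ l ∈ T.leaves, 0 < log.count l.val := fun log h l hl => List.count_pos_iff.mpr (h l hl)
  obtain ⟨s, hs, hnext⟩ := maySample_nextLeaf hθ h.roots.binarizes hr (hcount _ h.mem_log)
  obtain ⟨n₁, hn₁, e₁⟩ := Cmd.exec_run (envOf E θ r) (c := selectCmd)
    (by simp [selectCmd, Cmd.LoopFree]) σ
  rw [selectCmd_run, h.record_root, h.data.time, ← hnext] at e₁
  have h₁ : Inv T (envOf E θ r) θ δ M bt 0 (σ.setNat 12 0 s.val) :=
    h.congr (fun a ha => by rw [State.setNat_nat, if_neg ha]) rfl rfl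
  have hd := drawCmd_run (env := envOf E θ r) (σ := σ.setNat 12 0 s.val) (v := s.val)
    (by simp [State.setNat_nat])
  obtain ⟨n₂, hn₂, e₂⟩ := Cmd.exec_run (envOf E θ r) drawCmd_loopFree (σ.setNat 12 0 s.val)
  set σ₂ := drawCmd.run (envOf E θ r) (σ.setNat 12 0 s.val)
  have h₂ := h₁.draw hd
  obtain ⟨n₃, hn₃, e₃⟩ := Cmd.exec_run (envOf E θ r) (c := parentCmd) trivial σ₂
  have h12 : σ₂.nat 12 0 = s.val := by
    rw [hd.nat 12 (by simp) (by simp) (by simp) (by simp)]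
    simp [State.setNat_nat]
  rw [show parentCmd.run (envOf E θ r) σ₂ = σ₂.setNat 12 0 (σ₂.nat 6 s.val) by
    simp [parentCmd, Cmd.run, NExp.eval, h12]] at e₃
  have h6 : (σ.setNat 12 0 s.val).nat 6 = σ₂.nat 6 :=
    (hd.nat 6 (by simp) (by simp) (by simp) (by simp)).symm
  rw [h6] at h₂
  set σ₃ := σ₂.setNat 12 0 (σ₂.nat 6 s.val) with hσ₃
  have h₃ : Inv T (envOf E θ r) θ δ M bt (σ₂.nat 6 s.val) σ₃ :=
    h₂.congr (fun a ha => by rw [hσ₃, State.setNat_nat, if_neg ha]) rfl rfl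
  obtain ⟨σ₄, n₄, hn₄, e₄, h₄, h43, h4log, h4out⟩ := h₃.exec_climb (by simp [hσ₃, State.setNat_nat])
    fun h0 => ⟨(h₂.shape.up _ h0).1, (h₂.shape.up _ h0).2.1⟩
  obtain ⟨n₅, hn₅, e₅⟩ := Cmd.exec_run (envOf E θ r) (c := stopCmd)
    (by simp [stopCmd, answerCmd, Cmd.LoopFree]) σ₄
  have hlog : σ₄.log = σ.log ++ [s.val] := by rw [h4log, ← State.setNat_log σ 12 0 s.val, ← hd.log]; rfl
  have hout₄ : σ₄.out = none := by
    rw [h4out, ← hout, ← State.setNat_out σ 12 0 s.val, ← hd.out]; rfl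
  set τ : T.Node → BT T.Node := fun s => bt (σ₄.nat 3 s.val)
  have hτ : T.Binarizes τ := h₄.roots.binarizes
  set R := rootRec E θ τ r σ₄.log with hR
  have hpos := hcount _ h₄.mem_log
  have hwin := win_iff_rootRec hθ hτ hr hpos
  have hdir : decide ((R.agg false).f = 0) = true ↔ T.Win θ (empMean T r σ₄.log) := by
    rw [hwin, decide_eq_true_iff]
  have hreach := stops_iff_rootRec hθ hτ hr hpos hdir δ
  rw [stopCmd_run h₄.data.delta, h₄.record_root, ← hR] at e₅
  rw [beta_eq_rootRec (E := E) (θ := θ) (r := r) hτ δ, ← hR] at hreach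
  dsimp only at e₅
  set σ₅ := if (R.agg (decide ((R.agg false).f = 0))).g <
      3 * R.lsum + R.cnt * Cexp (Real.log (1 / δ) / R.cnt) then σ₄
    else { σ₄ with out := some (decide ((R.agg false).f = 0)) } with hσ₅
  have h5log : σ₅.log = σ₄.log := by rw [hσ₅]; split_ifs <;> rfl
  refine ⟨σ₅, _, ?_, .seq e₁ (.seq e₂ (.seq (.seq e₃ e₄) e₅)), ⟨⟨s, hs, by rw [h5log, hlog]⟩, ?_⟩,
    ?_⟩
  · have hH : (bt (σ₃.nat 3 0)).height ≤ T.depth * e := h₃.roots.binarizes.height_le he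
    set W := 1 + (BExp.natLt (.lit 0) .cur).cost + (Cmd.seq updateCmd parentCmd).maxCost with hW
    have h5 : ((bt (σ₃.nat 3 0)).height + 2) * W ≤ (T.depth * e + 2) * W :=
      Nat.mul_le_mul_right _ (by omega)
    simp only [roundCost]
    rw [← hW]
    nlinarith [Nat.zero_le (T.depth * e), Nat.zero_le W]
  · rw [h5log, hreach, hwin]
    refine ⟨fun hn => ?_, fun hst hw => ?_, fun hst hw => ?_⟩
    · rw [hσ₅, if_pos (not_le.mp hn), hout₄]
    all_goals
      rw [hσ₅, if_neg (not_lt.mpr hst)]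
      simpa using hw
  · rw [hσ₅]
    split_ifs
    · exact h₄
    · exact h₄.congr (fun _ _ => rfl) rfl rfl

/-- RD-Tracking-TMCTS. -/
noncomputable def trackingProg : Prog := ⟨initCmd, roundCmd⟩

theorem trackingProg_runsWithin (hθ : θ ∈ interior E.X) (hr : ∀ k, r k ∈ E.X) {e : ℕ}
    (he : T.maxBranching ≤ 2 ^ e) {B : ℝ} (hB : ((roundCost * (T.depth * e + 1) : ℕ) : ℝ) ≤ B) :
    RunsWithin trackingProg E T θ δ r B := by
  obtain ⟨σ₀, n₀, e₀, M, bt, h₀⟩ := exec_initCmd T (envOf E θ r) θ δ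
  have hstep : ∀ σ : {σ // Inv T (envOf E θ r) θ δ M bt 0 σ}, ∃ σ' : {σ // Inv T (envOf E θ r) θ δ
      M bt 0 σ}, σ.1.out = none → ∃ n ≤ roundCost * (T.depth * e + 1),
        Exec (envOf E θ r) roundCmd σ.1 σ'.1 n ∧ CorrectRound E T θ δ r σ.1 σ'.1 := by
    rintro ⟨σ, h⟩
    by_cases hout : σ.out = none
    · obtain ⟨σ', n, hn, h1, h2, h3⟩ := h.exec_roundCmd hθ hr hout he
      exact ⟨⟨σ', h3⟩, fun _ => ⟨n, hn, h1, h2⟩⟩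
    · exact ⟨⟨σ, h⟩, fun h => absurd h hout⟩
  choose next hnext using hstep
  let run : ℕ → {σ // Inv T (envOf E θ r) θ δ M bt 0 σ} := fun k => next^[k] ⟨σ₀, h₀.inv⟩
  refine ⟨fun k => (run k).1, ⟨n₀, e₀⟩, ⟨h₀.base.nodup, fun i => (h₀.base.mem_log i).trans ?_⟩,
    h₀.base.out, fun k hk => ?_⟩
  · simp
  · obtain ⟨n, hn, h1, h2⟩ := hnext (run k) hk
    have hrun : run (k + 1) = next (run k) := Function.iterate_succ_apply' next k _
    refine ⟨n, ?_, ?_, le_trans (by exact_mod_cast hn) hB⟩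
    · simp only [hrun]; exact h1
    · simpa only [hrun] using h2

theorem GameTree.one_le_depth (hK : 2 ≤ T.maxBranching) : 1 ≤ T.depth := by
  obtain ⟨s, -, hs⟩ := Finset.exists_mem_eq_sup Finset.univ ⟨(0 : T.Node), Finset.mem_univ _⟩
    fun s => (T.children s).card
  obtain ⟨c, hc⟩ : (T.children s).Nonempty := Finset.card_pos.mp (by
    rw [← hs]
    exact lt_of_lt_of_le Nat.two_pos hK)
  have := T.depthOf_le c
  rw [T.depthOf_children hc] at this
  omega

theorem GameTree.two_le_card_leaves (hK : 2 ≤ T.maxBranching) : 2 ≤ T.leaves.card := by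
  obtain ⟨s, -, hs⟩ := Finset.exists_mem_eq_sup Finset.univ ⟨(0 : T.Node), Finset.mem_univ _⟩
    fun s => (T.children s).card
  replace hs : 2 ≤ (T.children s).card := hs ▸ hK
  have h1 : (Finset.univ.filter fun c : T.Node => c ≠ 0).card = ∑ s : T.Node, (T.children s).card := by
    rw [Finset.card_eq_sum_card_fiberwise (f := T.parent) (t := Finset.univ) (by simp)]
    simp only [Finset.filter_filter, GameTree.children]
  have h2 : (Finset.univ.filter fun c : T.Node => c ≠ 0).card = T.n := by
    rw [Finset.filter_ne', Finset.card_erase_of_mem (Finset.mem_univ _)]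
    simp
  have h3 : ∑ s' : T.Node, ((if s' ∈ T.leaves then 0 else 1) + if s' = s then 1 else 0) ≤
      ∑ s : T.Node, (T.children s).card := by
    refine Finset.sum_le_sum fun s' _ => ?_
    by_cases h4 : s' ∈ T.leaves
    · have : s' ≠ s := by
        rintro rfl
        rw [GameTree.mem_leaves] at h4
        simp [h4] at hs
      simp [h4, this]
    · have : 0 < (T.children s').card := by
        rw [Finset.card_pos, Finset.nonempty_iff_ne_empty]
        exact fun h => h4 (GameTree.mem_leaves.mpr h)
      split_ifs with h5
      · rw [h5]; exact hs
      · exact this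
  have h5 : ∑ s' : T.Node, (if s' ∈ T.leaves then 0 else 1) = T.n + 1 - T.leaves.card := by
    rw [Finset.sum_ite, Finset.sum_const_zero, zero_add, ← Finset.card_eq_sum_ones,
      Finset.filter_not, Finset.filter_mem_eq_inter, Finset.univ_inter,
      Finset.card_sdiff_of_subset (Finset.subset_univ _)]
    simp
  have h6 : T.leaves.card ≤ T.n + 1 := by simpa using Finset.card_le_univ T.leaves
  rw [Finset.sum_add_distrib, h5, Finset.sum_ite_eq' , if_pos (Finset.mem_univ _), ← h1, h2] at h3
  omega

/-- The number of time units of a round, in terms of `D log K`. -/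
theorem roundCost_le (hK : 2 ≤ T.maxBranching) :
    ((roundCost * (T.depth * Nat.clog 2 T.maxBranching + 1) : ℕ) : ℝ) ≤
      3 * roundCost / Real.log 2 * (T.depth * Real.log T.maxBranching) := by
  set K := T.maxBranching
  set e := Nat.clog 2 K
  have hD : (1 : ℝ) ≤ T.depth := by exact_mod_cast GameTree.one_le_depth hK
  have h2 : 0 < Real.log 2 := Real.log_pos one_lt_two
  have hlog : Real.log 2 ≤ Real.log K := Real.log_le_log two_pos (by exact_mod_cast hK)
  have he : (e - 1 : ℝ) * Real.log 2 ≤ Real.log K := by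
    have he0 : 0 < e := Nat.clog_pos one_lt_two hK
    have h3 : 2 ^ (e - 1) < K := Nat.pow_pred_clog_lt_self one_lt_two hK
    have h4 : Real.log ((2 : ℝ) ^ (e - 1)) ≤ Real.log K :=
      Real.log_le_log (by positivity) (by exact_mod_cast h3.le)
    rwa [Real.log_pow, Nat.cast_pred he0] at h4
  have h5 : (T.depth * e + 1 : ℝ) * Real.log 2 ≤ 3 * (T.depth * Real.log K) := by
    nlinarith
  have h6 : (T.depth * e + 1 : ℝ) ≤ 3 * (T.depth * Real.log K) / Real.log 2 :=
    (le_div_iff₀ h2).mpr h5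
  have h7 : (0 : ℝ) ≤ roundCost := Nat.cast_nonneg _
  push_cast
  calc (roundCost : ℝ) * (T.depth * e + 1) ≤ roundCost * (3 * (T.depth * Real.log K) / Real.log 2) :=
        mul_le_mul_of_nonneg_left h6 h7
    _ = _ := by ring

theorem depth_mul_log_le (hK : 2 ≤ T.maxBranching) {c : ℝ} (hc : 0 < c)
    (h : c * (T.maxBranching : ℝ) ^ T.depth ≤ T.leaves.card) :
    T.depth * Real.log T.maxBranching ≤ (1 + |Real.log c| / Real.log 2) *
      Real.log T.leaves.card := by
  have hK' : (0 : ℝ) < T.maxBranching := by exact_mod_cast lt_of_lt_of_le Nat.two_pos hK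
  have h2 : 0 < Real.log 2 := Real.log_pos one_lt_two
  have hlog : Real.log 2 ≤ Real.log T.leaves.card :=
    Real.log_le_log two_pos (by exact_mod_cast GameTree.two_le_card_leaves hK)
  have h1 := Real.log_le_log (by positivity) h
  rw [Real.log_mul hc.ne' (by positivity), Real.log_pow] at h1
  have h3 := neg_abs_le (Real.log c)
  have h4 : |Real.log c| ≤ |Real.log c| / Real.log 2 * Real.log T.leaves.card := by
    rw [div_mul_eq_mul_div, le_div_iff₀ h2]
    exact mul_le_mul_of_nonneg_left hlog (abs_nonneg _)
  linarith

end Main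

end TMCTS

theorem mainTheorem8 :
    ∃ p : TMCTS.Prog,
      (∃ C : ℝ, ∀ (E : TMCTS.ExpFamily) (T : TMCTS.GameTree) (θ δ : ℝ) (r : ℕ → ℝ),
        θ ∈ interior E.X → 0 < δ → δ < 1 → (∀ k, r k ∈ E.X) → 2 ≤ T.maxBranching →
          TMCTS.RunsWithin p E T θ δ r (C * (T.depth * Real.log T.maxBranching))) ∧
      (∀ c : ℝ, 0 < c →
        ∃ C : ℝ, ∀ (E : TMCTS.ExpFamily) (T : TMCTS.GameTree) (θ δ : ℝ) (r : ℕ → ℝ),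
          θ ∈ interior E.X → 0 < δ → δ < 1 → (∀ k, r k ∈ E.X) → 2 ≤ T.maxBranching →
            c * (T.maxBranching : ℝ) ^ T.depth ≤ T.leaves.card →
              TMCTS.RunsWithin p E T θ δ r (C * Real.log T.leaves.card)) := by
  refine ⟨TMCTS.trackingProg, ⟨3 * TMCTS.roundCost / Real.log 2, ?_⟩, fun c hc =>
    ⟨3 * TMCTS.roundCost / Real.log 2 * (1 + |Real.log c| / Real.log 2), ?_⟩⟩
  · intro E T θ δ r hθ _ _ hr hK
    exact TMCTS.trackingProg_runsWithin hθ hr (Nat.le_pow_clog one_lt_two _)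
      (TMCTS.roundCost_le hK)
  · intro E T θ δ r hθ _ _ hr hK h
    refine TMCTS.trackingProg_runsWithin hθ hr (Nat.le_pow_clog one_lt_two _)
      ((TMCTS.roundCost_le hK).trans ?_)
    rw [mul_assoc]
    exact mul_le_mul_of_nonneg_left (TMCTS.depth_mul_log_le hK hc h)
      (div_nonneg (by positivity) (Real.log_nonneg one_le_two))
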